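/- Conventions. For $l\ge 1$, an $l$-component string link is a (tame) proper embedding of $l$ disjoint copies of $I=[0,1]$ in $D^2\times I$, the $i$-th string running from the $i$-th of $l$ standard (collinear) points of $D^2\times\{0\}$ to the $i$-th of the same points in $D^2\times\{1\}$; isotopies of string links fix the boundary. Let $1_l$ be the trivial string link, $\sigma\sigma'$ the stacking product ($\sigma'$ on top of $\sigma$), and $\sigma\otimes\sigma'$ the horizontal juxtaposition ($\sigma$ on the left). A link is a (tame) embedding of $l$ ordered, oriented circles in $\mathbb R^3$; $\hat\sigma$ is the closure of $\sigma$. For $l$-component string links $\sigma,\sigma'$ and a $2l$-component string link $\Sigma$, whose first $l$ strings are run through downwards and whose last $l$ strings are run through upwards: $\sigma\Sigma$ is the $l$-component string link obtained by closing up the bottom of $\Sigma$ with $\sigma$ bent into a U, and unbending the top (the ends of the first half of the strings become the beginnings, those of the last half the ends, of the strings of $\sigma\Sigma$); $\Sigma\sigma'$ is obtained by closing up the top of $\Sigma$ with $\sigma'$ bent into a cap and unbending the bottom; $\sigma\Sigma\sigma'$ is the closed $l$-component link obtained by doing both closings. All bendings are planar, so that string $l+1-i$ of $\Sigma$ is paired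 with string $l+i$. Finally $\overline\sigma=R_t\circ\sigma\circ R_s$, where $R_s,R_t$ are the reflections of $I$ and of $D^2\times I$ in the $I$-direction. Let $E$ be an equivalence relation on string links and on links (for all $l$) which is implied by isotopy, write $E(x)$ for the class of $x$, and let $ESL(l)$, $EL(l)$ be the sets of classes of $l$-component string links and links. $E$ is called *local* if for all $l$-component string links with $E(\sigma_1)=E(\sigma_2)$ and all $2l$-component string links with $E(\Sigma_1)=E(\Sigma_2)$ one has (1) $E(\hat\sigma_1)=E(\hat\sigma_2)$, (2) $E(1_l\otimes\sigma_1)=E(1_l\otimes\sigma_2)$, (3) $E(\sigma_1\Sigma_1)=E(\sigma_2\Sigma_2)$, (4) $E(\Sigma_1\sigma_1)=E(\Sigma_2\sigma_2)$. Consider also the axioms: (5) for every string link $\sigma$ there is a string link $\sigma_1$ with $E(\sigma\sigma_1)=E(1_l)$; (5$'$) $E(\sigma\overline\sigma)=E(1_l)$ for every string link $\sigma$. **Proposition.** Let $E$ be a local equivalence relation. (a) If $\sigma_i,\sigma_i'$ are $l$-component and $\Sigma_i$ are $2l$-component string links ($i=1,2$) with $E(\sigma_1)=E(\sigma_2)$,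 $E(\sigma_1')=E(\sigma_2')$, $E(\Sigma_1)=E(\Sigma_2)$, then $E(\sigma_1\sigma_1')=E(\sigma_2\sigma_2')$ and $E(\sigma_1\Sigma_1\sigma_1')=E(\sigma_2\Sigma_2\sigma_2')$. (b) The formulas $E(\sigma)E(\tau)=E(\sigma\tau)$, $E(\sigma)E(\Sigma)=E(\sigma\Sigma)$, $E(\Sigma)E(\sigma)=E(\Sigma\sigma)$ and $\widehat{E(\sigma)}=E(\hat\sigma)$ define, for each $l$, a monoid structure on $ESL(l)$ with unit $E(1_l)$, a right and a left action of the monoid $ESL(2l)$ on the set $ESL(l)$, and a closure map $ESL(l)\to EL(l)$. (c) The right stabilizer $ES^R(l)=\{a\in ESL(2l): E(1_l)\,a=E(1_l)\}$ and the left stabilizer $ES^L(l)=\{a\in ESL(2l): a\,E(1_l)=E(1_l)\}$ are submonoids of $ESL(2l)$. (d) The closure map passes to the set of orbits of the left action of $ES^R(l)$ on $ESL(l)$, and to the set of orbits of the right action of $ES^L(l)$ on $ESL(l)$ (the set of orbits of a monoid action being the quotient by the equivalence relation generated by relating each element to its translates). (e) If Axiom (5) holds, then the monoid $ESL(l)$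 is a group for each $l$, and $ES^R(l)$ and $ES^L(l)$ are subgroups of $ESL(2l)$. (f) If Axiom (5$'$) holds, then $ES^R(l)=ES^L(l)$ for each $l$. -/

import Mathlib

namespace HL

open Set

/-- Euclidean three-space, with coordinates `(x, y, z)`.  Only its topology and its affine
structure are used. -/
abbrev E3 : Type := ℝ × ℝ × ℝ

/-- The interior of the cylinder `D² × I`, where the disc `D²` is modelled by the square
`[-1,1] × [-1,1]` and `I = [0,1]` is the `z`-direction. -/
def cylinderInterior : Set E3 :=
  {q | (-1 < q.1 ∧ q.1 < 1) ∧ (-1 < q.2.1 ∧ q.2.1 < 1) ∧ (0 < q.2.2 ∧ q.2.2 < 1)}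

/-- The abscissa of the `i`-th of the `n` standard points of `D²`: they are equally spaced on the
diameter `y = 0`. -/
noncomputable def pt (n : ℕ) (i : Fin n) : ℝ := (2 * (i : ℝ) + 1) / n - 1

/-- The `i`-th of the `n` standard points of `D²`, at level `z`. -/
noncomputable def marked (n : ℕ) (i : Fin n) (z : ℝ) : E3 := (pt n i, 0, z)

/-- A finite union of straight segments. -/
def IsPolygonal (S : Set E3) : Prop :=
  ∃ s : Finset (E3 × E3), S = ⋃ p ∈ s, segment ℝ p.1 p.2

/-- A (tame, i.e. piecewise linear) `n`-component string link: a proper embedding of `n` disjoint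
copies of `I` in `D² × I` whose `i`-th string runs from the `i`-th standard point at level `0` to the
`i`-th standard point at level `1`.  As is usual in order to be able to stack, the strings are
required to be vertical near the bottom and near the top. -/
structure StringLink (n : ℕ) where
  strand : ∀ i : Fin n, Path (marked n i 0) (marked n i 1)
  injective : Function.Injective (fun q : Fin n × unitInterval => strand q.1 q.2)
  proper : ∀ i t, t ≠ 0 → t ≠ 1 → strand i t ∈ cylinderInterior
  polygonal : ∀ i, IsPolygonal (range (strand i))
  vertical : ∃ ε : ℝ, 0 < ε ∧ ∀ i, ∀ q ∈ range (strand i),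
    (q.2.2 ≤ ε ∨ 1 - ε ≤ q.2.2) → q.1 = pt n i ∧ q.2.1 = 0

/-- A (tame, i.e. piecewise linear) link with `n` ordered and oriented components: an embedding of
`n` disjoint copies of the circle in three-space. -/
structure Link (n : ℕ) where
  component : Fin n → C(UnitAddCircle, E3)
  injective : Function.Injective (fun q : Fin n × UnitAddCircle => component q.1 q.2)
  polygonal : ∀ i, IsPolygonal (range (component i))

/-- An ambient isotopy of three-space: a level preserving homeomorphism of `I × ℝ³` which is the
identity at time `0`. -/
structure AmbientIsotopy where
  toHomeo : (unitInterval × E3) ≃ₜ (unitInterval × E3)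
  level : ∀ p, (toHomeo p).1 = p.1
  start : ∀ x, toHomeo (0, x) = (0, x)

/-- The homeomorphism of three-space at time `s` of an ambient isotopy, as a map. -/
def AmbientIsotopy.at (H : AmbientIsotopy) (s : unitInterval) (x : E3) : E3 := (H.toHomeo (s, x)).2

/-- Isotopy of string links, fixing the boundary of `D² × I`: an ambient isotopy of `D² × I` rel
boundary (extended by the identity to the outside) takes each string of `σ` to the corresponding
string of `τ`.  The orientations of the strings are then preserved, since their ends are fixed. -/
def StringLink.Isotopic {n : ℕ} (σ τ : StringLink n) : Prop :=
  ∃ H : AmbientIsotopy, (∀ s x, x ∉ cylinderInterior → H.at s x = x) ∧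
    ∀ i, H.at 1 '' range (σ.strand i) = range (τ.strand i)

/-- Isotopy of links: an ambient isotopy takes each component of `K` to the corresponding component
of `L`, up to an orientation preserving reparametrization of the circle (given by an increasing lift
`φ` to the line). -/
def Link.Isotopic {n : ℕ} (K L : Link n) : Prop :=
  ∃ H : AmbientIsotopy, ∀ i, ∃ φ : ℝ ≃o ℝ, (∀ t, φ (t + 1) = φ t + 1) ∧
    ∀ t : ℝ, H.at 1 (K.component i (t : UnitAddCircle)) = L.component i (φ t : UnitAddCircle)

/-! ### Auxiliary facts -/

theorem pt_bounds {n : ℕ} (i : Fin n) : -1 < pt n i ∧ pt n i < 1 := by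
  have hi : ((i : ℕ) : ℝ) + 1 ≤ n := by exact_mod_cast i.2
  have h0 : (0 : ℝ) ≤ (i : ℕ) := Nat.cast_nonneg _
  have hn : (0 : ℝ) < n := by linarith
  unfold pt
  have h1 : 0 < (2 * ((i : ℕ) : ℝ) + 1) / n := by positivity
  have h2 : (2 * ((i : ℕ) : ℝ) + 1) / n < 2 := by rw [div_lt_iff₀ hn]; linarith
  constructor <;> linarith

theorem pt_injective {n : ℕ} : Function.Injective (pt n) := by
  intro i j h
  have hi : ((i : ℕ) : ℝ) + 1 ≤ n := by exact_mod_cast i.2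
  have h0 : (0 : ℝ) ≤ (i : ℕ) := Nat.cast_nonneg _
  have hn : (n : ℝ) ≠ 0 := by linarith
  unfold pt at h
  have h2 : (2 * ((i : ℕ) : ℝ) + 1) / n = (2 * ((j : ℕ) : ℝ) + 1) / n := by linarith
  rw [div_left_inj' hn] at h2
  have h3 : ((i : ℕ) : ℝ) = (j : ℕ) := by linarith
  exact Fin.ext (by exact_mod_cast h3)

theorem pt_castAdd {l : ℕ} (i : Fin l) : pt (l + l) (Fin.castAdd l i) = (pt l i - 1) / 2 := by
  have hi : ((i : ℕ) : ℝ) + 1 ≤ l := by exact_mod_cast i.2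
  have h0 : (0 : ℝ) ≤ (i : ℕ) := Nat.cast_nonneg _
  have hn : (l : ℝ) ≠ 0 := by linarith
  simp only [pt, Fin.val_castAdd, Nat.cast_add]
  field_simp
  ring

theorem pt_natAdd {l : ℕ} (i : Fin l) : pt (l + l) (Fin.natAdd l i) = (pt l i + 1) / 2 := by
  have hi : ((i : ℕ) : ℝ) + 1 ≤ l := by exact_mod_cast i.2
  have h0 : (0 : ℝ) ≤ (i : ℕ) := Nat.cast_nonneg _
  have hn : (l : ℝ) ≠ 0 := by linarith
  simp only [pt, Fin.val_natAdd, Nat.cast_add]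
  field_simp
  ring

theorem pt_rev {n : ℕ} (i : Fin n) : pt n i.rev = - pt n i := by
  have hi : ((i : ℕ) : ℝ) + 1 ≤ n := by exact_mod_cast i.2
  have h0 : (0 : ℝ) ≤ (i : ℕ) := Nat.cast_nonneg _
  have hn : (n : ℝ) ≠ 0 := by linarith
  have : ((i.rev : ℕ) : ℝ) = n - ((i : ℕ) + 1) := by
    rw [Fin.val_rev, Nat.cast_sub i.2]; push_cast; ring
  simp only [pt, this]
  field_simp
  ring

theorem pt_castAdd_rev {l : ℕ} (i : Fin l) :
    pt (l + l) (Fin.castAdd l i.rev) = -((pt l i + 1) / 2) := by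
  rw [pt_castAdd, pt_rev]; ring

theorem IsPolygonal.segment (a b : E3) : IsPolygonal (segment ℝ a b) :=
  ⟨{(a, b)}, by simp⟩

theorem IsPolygonal.union {S T : Set E3} (hS : IsPolygonal S) (hT : IsPolygonal T) :
    IsPolygonal (S ∪ T) := by
  classical
  obtain ⟨s, rfl⟩ := hS
  obtain ⟨t, rfl⟩ := hT
  exact ⟨s ∪ t, by rw [Finset.set_biUnion_union]⟩

/-- `f` is an affine map. -/
def IsAff (f : E3 → E3) : Prop :=
  ∀ x y : E3, ∀ a b : ℝ, a + b = 1 → f (a • x + b • y) = a • f x + b • f y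

theorem IsPolygonal.image {S : Set E3} (hS : IsPolygonal S) {f : E3 → E3} (hf : IsAff f) :
    IsPolygonal (f '' S) := by
  classical
  obtain ⟨s, rfl⟩ := hS
  refine ⟨s.image (fun p => (f p.1, f p.2)), ?_⟩
  have key : ∀ x y : E3, f '' _root_.segment ℝ x y = _root_.segment ℝ (f x) (f y) := by
    intro x y
    ext q
    constructor
    · rintro ⟨_, ⟨a, b, ha, hb, hab, rfl⟩, rfl⟩
      exact ⟨a, b, ha, hb, hab, (hf x y a b hab).symm⟩
    · rintro ⟨a, b, ha, hb, hab, rfl⟩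
      exact ⟨_, ⟨a, b, ha, hb, hab, rfl⟩, hf x y a b hab⟩
  simp only [image_iUnion, key, Finset.set_biUnion_finset_image]

theorem polygonal_trans {a b c : E3} {γ : Path a b} {γ' : Path b c}
    (h : IsPolygonal (range γ)) (h' : IsPolygonal (range γ')) :
    IsPolygonal (range (γ.trans γ')) := by
  rw [Path.trans_range]; exact h.union h'

theorem polygonal_seg (a b : E3) : IsPolygonal (range (Path.segment a b)) := by
  rw [Path.range_segment]; exact IsPolygonal.segment a b

theorem trans_injective {X : Type*} [TopologicalSpace X] {a b c : X} {γ : Path a b} {γ' : Path b c}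
    (h : Function.Injective γ) (h' : Function.Injective γ')
    (hd : ∀ q ∈ range γ, q ∈ range γ' → q = b) : Function.Injective (γ.trans γ') := by
  have aux : ∀ s t : unitInterval, (s : ℝ) ≤ 1 / 2 → ¬ (t : ℝ) ≤ 1 / 2 →
      γ.trans γ' s ≠ γ.trans γ' t := by
    intro s t hs ht he
    rw [Path.trans_apply, Path.trans_apply, dif_pos hs, dif_neg ht] at he
    have h1 := hd _ (mem_range_self _) (by rw [he]; exact mem_range_self _)
    have h2 := congrArg Subtype.val (h' ((h1.symm.trans he).symm.trans γ'.source.symm)).symm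
    simp only [Icc.coe_zero] at h2
    linarith
  intro s t he
  by_cases hs : (s : ℝ) ≤ 1 / 2 <;> by_cases ht : (t : ℝ) ≤ 1 / 2
  · rw [Path.trans_apply, Path.trans_apply, dif_pos hs, dif_pos ht] at he
    have h2 := congrArg Subtype.val (h he)
    exact Subtype.ext (by simpa using h2)
  · exact absurd he (aux s t hs ht)
  · exact absurd he.symm (aux t s ht hs)
  · rw [Path.trans_apply, Path.trans_apply, dif_neg hs, dif_neg ht] at he
    have h2 := congrArg Subtype.val (h' he)
    exact Subtype.ext (by simpa using h2)

theorem injective_family {Y : Type*} [TopologicalSpace Y] {n : ℕ} {a b : Fin n → Y}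
    {γ : ∀ i, Path (a i) (b i)} (h : ∀ i, Function.Injective (γ i))
    (hd : ∀ i j, ∀ q ∈ range (γ i), q ∈ range (γ j) → i = j) :
    Function.Injective (fun q : Fin n × unitInterval => γ q.1 q.2) := by
  rintro ⟨i, s⟩ ⟨j, t⟩ he
  obtain rfl : i = j := hd i j _ (mem_range_self s) (by rw [show γ i s = γ j t from he]; simp)
  exact Prod.ext rfl (h i he)

/-- The image of a path under a map, with prescribed names of its ends. -/
def mapPath {a b a' b' : E3} (γ : Path a b) (f : E3 → E3) (hf : Continuous f) (ha : a' = f a)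
    (hb : b' = f b) : Path a' b' := (γ.map hf).cast ha hb

theorem mapPath_coe {a b a' b' : E3} (γ : Path a b) {f : E3 → E3} (hf : Continuous f)
    (ha : a' = f a) (hb : b' = f b) : (mapPath γ f hf ha hb : unitInterval → E3) = f ∘ γ := rfl

theorem mapPath_range {a b a' b' : E3} (γ : Path a b) {f : E3 → E3} (hf : Continuous f)
    (ha : a' = f a) (hb : b' = f b) : range (mapPath γ f hf ha hb) = f '' range γ := by
  rw [mapPath_coe, range_comp]

theorem mapPath_injective {a b a' b' : E3} {γ : Path a b} {f : E3 → E3} (hf : Continuous f)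
    (ha : a' = f a) (hb : b' = f b) (h : Function.Injective γ) (hi : Function.Injective f) :
    Function.Injective (mapPath γ f hf ha hb) := hi.comp h

theorem symm_injective {a b : E3} {γ : Path a b} (h : Function.Injective γ) :
    Function.Injective γ.symm := h.comp unitInterval.symm_bijective.injective

namespace StringLink

variable {n : ℕ} (σ : StringLink n)

theorem strand_injective (i : Fin n) : Function.Injective (σ.strand i) := by
  intro s t h
  have := @σ.injective (i, s) (i, t) h
  exact (Prod.ext_iff.mp this).2

theorem eq_of_mem {i j : Fin n} {q : E3} (hi : q ∈ range (σ.strand i))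
    (hj : q ∈ range (σ.strand j)) : i = j := by
  obtain ⟨s, rfl⟩ := hi
  obtain ⟨t, ht⟩ := hj
  have := @σ.injective (j, t) (i, s) ht
  exact (Prod.ext_iff.mp this).1.symm

theorem mem_cases {i : Fin n} {q : E3} (hq : q ∈ range (σ.strand i)) :
    q = marked n i 0 ∨ q = marked n i 1 ∨ q ∈ cylinderInterior := by
  obtain ⟨t, rfl⟩ := hq
  by_cases h0 : t = 0
  · left; rw [h0, Path.source]
  by_cases h1 : t = 1
  · right; left; rw [h1, Path.target]
  · exact Or.inr (Or.inr (σ.proper i t h0 h1))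

theorem mem_bounds {i : Fin n} {q : E3} (hq : q ∈ range (σ.strand i)) :
    (-1 < q.1 ∧ q.1 < 1) ∧ (-1 < q.2.1 ∧ q.2.1 < 1) ∧ (0 ≤ q.2.2 ∧ q.2.2 ≤ 1) ∧
      (q.2.2 = 0 → q = marked n i 0) ∧ (q.2.2 = 1 → q = marked n i 1) := by
  have hp := pt_bounds i
  rcases σ.mem_cases hq with rfl | rfl | h
  · simp [marked, hp]
  · simp [marked, hp]
  · obtain ⟨h1, h2, h3⟩ := h
    exact ⟨h1, h2, ⟨h3.1.le, h3.2.le⟩, fun h => absurd h h3.1.ne', fun h => absurd h h3.2.ne⟩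

end StringLink

/-- A constructor for the field `proper`. -/
theorem proper_of {n : ℕ} {i : Fin n} {γ : Path (marked n i 0) (marked n i 1)}
    (hinj : Function.Injective γ)
    (h : ∀ q ∈ range γ, q = marked n i 0 ∨ q = marked n i 1 ∨ q ∈ cylinderInterior) (t : unitInterval)
    (h0 : t ≠ 0) (h1 : t ≠ 1) : γ t ∈ cylinderInterior := by
  rcases h _ (mem_range_self t) with h | h | h
  · exact absurd (hinj (h.trans γ.source.symm)) h0
  · exact absurd (hinj (h.trans γ.target.symm)) h1
  · exact h

/-! ### The trivial string link, stacking, juxtaposition, symmetries -/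

theorem mem_seg {a b q : E3} (h : q ∈ range (Path.segment a b)) : ∃ s : ℝ, 0 ≤ s ∧ s ≤ 1 ∧
    q.1 = (1 - s) * a.1 + s * b.1 ∧ q.2.1 = (1 - s) * a.2.1 + s * b.2.1 ∧
    q.2.2 = (1 - s) * a.2.2 + s * b.2.2 := by
  rw [Path.range_segment, segment_eq_image] at h
  obtain ⟨s, hs, rfl⟩ := h
  exact ⟨s, hs.1, hs.2, by simp, by simp, by simp⟩

theorem marked_ne {n : ℕ} (i : Fin n) : marked n i 0 ≠ marked n i 1 := fun h =>
  zero_ne_one (α := ℝ) (congrArg (fun q : E3 => q.2.2) h)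

theorem mem_vertical {n : ℕ} {i : Fin n} {q : E3}
    (h : q ∈ range (Path.segment (marked n i 0) (marked n i 1))) :
    ∃ s : ℝ, 0 ≤ s ∧ s ≤ 1 ∧ q = marked n i s := by
  obtain ⟨s, h0, h1, hx, hy, hz⟩ := mem_seg h
  refine ⟨s, h0, h1, ?_⟩
  simp only [marked] at hx hy hz
  exact Prod.ext (by simp only [marked]; linarith)
    (Prod.ext (by simp only [marked]; linarith) (by simp only [marked]; linarith))

/-- The trivial string link `1_n`. -/
noncomputable def StringLink.one (n : ℕ) : StringLink n where
  strand i := Path.segment (marked n i 0) (marked n i 1)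
  injective := by
    refine injective_family (fun i => Path.segment_injective_of_ne (marked_ne i)) ?_
    intro i j q hi hj
    obtain ⟨s, -, -, rfl⟩ := mem_vertical hi
    obtain ⟨t, -, -, h⟩ := mem_vertical hj
    exact pt_injective (congrArg (fun q : E3 => q.1) h)
  proper i := by
    refine proper_of (Path.segment_injective_of_ne (marked_ne i)) ?_
    intro q hq
    obtain ⟨s, h0, h1, rfl⟩ := mem_vertical hq
    rcases h0.eq_or_lt with rfl | h0
    · exact Or.inl rfl
    rcases h1.eq_or_lt with rfl | h1
    · exact Or.inr (Or.inl rfl)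
    · exact Or.inr (Or.inr ⟨pt_bounds i, by norm_num [marked], h0, h1⟩)
  polygonal i := polygonal_seg _ _
  vertical := by
    refine ⟨1, one_pos, fun i q hq _ => ?_⟩
    obtain ⟨s, h0, h1, rfl⟩ := mem_vertical hq
    exact ⟨rfl, rfl⟩

/-- The map of the cylinder onto its lower half. -/
noncomputable def lowerHalf (q : E3) : E3 := (q.1, q.2.1, q.2.2 / 2)

/-- The map of the cylinder onto its upper half. -/
noncomputable def upperHalf (q : E3) : E3 := (q.1, q.2.1, (q.2.2 + 1) / 2)

theorem lowerHalf_cont : Continuous lowerHalf := by unfold lowerHalf; fun_prop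
theorem upperHalf_cont : Continuous upperHalf := by unfold upperHalf; fun_prop

theorem lowerHalf_aff : IsAff lowerHalf := by
  intro x y a b h
  ext <;> simp [lowerHalf]
  ring

theorem upperHalf_aff : IsAff upperHalf := by
  intro x y a b h
  ext <;> simp [upperHalf]
  linear_combination (-1 / 2 : ℝ) * h

theorem lowerHalf_inj : Function.Injective lowerHalf := by
  rintro ⟨x, y, z⟩ ⟨x', y', z'⟩ h
  simp only [lowerHalf, Prod.mk.injEq] at h
  obtain ⟨rfl, rfl, h⟩ := h
  simp; linarith

theorem upperHalf_inj : Function.Injective upperHalf := by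
  rintro ⟨x, y, z⟩ ⟨x', y', z'⟩ h
  simp only [upperHalf, Prod.mk.injEq] at h
  obtain ⟨rfl, rfl, h⟩ := h
  simp; linarith

theorem lowerHalf_zero {n : ℕ} (i : Fin n) : marked n i 0 = lowerHalf (marked n i 0) := by
  simp [marked, lowerHalf]

theorem lowerHalf_one {n : ℕ} (i : Fin n) : marked n i (1 / 2) = lowerHalf (marked n i 1) := by
  simp [marked, lowerHalf]

theorem upperHalf_zero {n : ℕ} (i : Fin n) : marked n i (1 / 2) = upperHalf (marked n i 0) := by
  simp [marked, upperHalf]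

theorem upperHalf_one {n : ℕ} (i : Fin n) : marked n i 1 = upperHalf (marked n i 1) := by
  simp [marked, upperHalf]

/-- The `i`-th string of the stacking product. -/
noncomputable def stackStrand {n : ℕ} (σ τ : StringLink n) (i : Fin n) :
    Path (marked n i 0) (marked n i 1) :=
  (mapPath (σ.strand i) lowerHalf lowerHalf_cont (lowerHalf_zero i) (lowerHalf_one i)).trans
    (mapPath (τ.strand i) upperHalf upperHalf_cont (upperHalf_zero i) (upperHalf_one i))

theorem stackStrand_range {n : ℕ} (σ τ : StringLink n) (i : Fin n) :
    range (stackStrand σ τ i) =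
      lowerHalf '' range (σ.strand i) ∪ upperHalf '' range (τ.strand i) := by
  rw [stackStrand, Path.trans_range, mapPath_range, mapPath_range]

theorem stack_meet {n : ℕ} (σ τ : StringLink n) {i j : Fin n} {p r : E3}
    (hp : p ∈ range (σ.strand i)) (hr : r ∈ range (τ.strand j))
    (h : lowerHalf p = upperHalf r) : i = j ∧ lowerHalf p = marked n i (1 / 2) := by
  have h3 : p.2.2 / 2 = (r.2.2 + 1) / 2 := congrArg (fun q => q.2.2) h
  have hx : p.1 = r.1 := congrArg (fun q => q.1) h
  obtain ⟨-, -, ⟨-, p1⟩, -, p2⟩ := σ.mem_bounds hp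
  obtain ⟨-, -, ⟨r1, -⟩, r2, -⟩ := τ.mem_bounds hr
  have e1 := p2 (by linarith)
  have e2 := r2 (by linarith)
  rw [e1, e2] at hx
  refine ⟨pt_injective hx, ?_⟩
  rw [e1]; simp [marked, lowerHalf]

theorem stackStrand_inj {n : ℕ} (σ τ : StringLink n) (i : Fin n) :
    Function.Injective (stackStrand σ τ i) := by
  apply trans_injective
  · exact mapPath_injective _ _ _ (σ.strand_injective i) lowerHalf_inj
  · exact mapPath_injective _ _ _ (τ.strand_injective i) upperHalf_inj
  · rw [mapPath_range, mapPath_range]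
    rintro _ ⟨p, hp, rfl⟩ ⟨r, hr, h⟩
    exact (stack_meet σ τ hp hr h.symm).2

/-- The stacking product `σ τ`: `τ` is put on top of `σ`. -/
noncomputable def StringLink.stack {n : ℕ} (σ τ : StringLink n) : StringLink n where
  strand := stackStrand σ τ
  injective := by
    refine injective_family (stackStrand_inj σ τ) ?_
    intro i j q hi hj
    rw [stackStrand_range] at hi hj
    rcases hi with ⟨p, hp, rfl⟩ | ⟨p, hp, rfl⟩ <;> rcases hj with ⟨r, hr, h⟩ | ⟨r, hr, h⟩
    · exact σ.eq_of_mem hp (lowerHalf_inj h ▸ hr)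
    · exact (stack_meet σ τ hp hr h.symm).1
    · exact (stack_meet σ τ hr hp h).1.symm
    · exact τ.eq_of_mem hp (upperHalf_inj h ▸ hr)
  proper i := by
    refine proper_of (stackStrand_inj σ τ i) ?_
    intro q hq
    have hb := pt_bounds i
    rw [stackStrand_range] at hq
    rcases hq with ⟨p, hp, rfl⟩ | ⟨p, hp, rfl⟩
    · rcases σ.mem_cases hp with rfl | rfl | ⟨h1, h2, h3⟩
      · left; simp [marked, lowerHalf]
      · right; right
        refine ⟨hb, ?_, ?_⟩ <;> norm_num [marked, lowerHalf]
      · right; right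
        refine ⟨h1, h2, ?_⟩
        simp only [lowerHalf]
        constructor <;> linarith
    · rcases τ.mem_cases hp with rfl | rfl | ⟨h1, h2, h3⟩
      · right; right
        refine ⟨hb, ?_, ?_⟩ <;> norm_num [marked, upperHalf]
      · right; left; simp [marked, upperHalf]
      · right; right
        refine ⟨h1, h2, ?_⟩
        simp only [upperHalf]
        constructor <;> linarith
  polygonal i := by
    rw [stackStrand_range]
    exact ((σ.polygonal i).image lowerHalf_aff).union ((τ.polygonal i).image upperHalf_aff)
  vertical := by
    obtain ⟨ε, hε, hσ⟩ := σ.vertical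
    obtain ⟨δ, hδ, hτ⟩ := τ.vertical
    refine ⟨min (min (ε / 2) (δ / 2)) (1 / 4), by positivity, ?_⟩
    intro i q hq h
    have m1 : min (min (ε / 2) (δ / 2)) (1 / 4) ≤ ε / 2 := (min_le_left _ _).trans (min_le_left _ _)
    have m2 : min (min (ε / 2) (δ / 2)) (1 / 4) ≤ δ / 2 := (min_le_left _ _).trans (min_le_right _ _)
    have m3 : min (min (ε / 2) (δ / 2)) (1 / 4) ≤ 1 / 4 := min_le_right _ _
    rw [stackStrand_range] at hq
    rcases hq with ⟨p, hp, rfl⟩ | ⟨p, hp, rfl⟩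
    · refine hσ i p hp ?_
      have := (σ.mem_bounds hp).2.2.1
      simp only [lowerHalf] at h
      rcases h with h | h
      · left; linarith
      · linarith
    · refine hτ i p hp ?_
      have := (τ.mem_bounds hp).2.2.1
      simp only [upperHalf] at h
      rcases h with h | h
      · linarith
      · right; linarith

/-- The map of the cylinder onto its left half. -/
noncomputable def leftHalf (q : E3) : E3 := ((q.1 - 1) / 2, q.2.1, q.2.2)

/-- The map of the cylinder onto its right half. -/
noncomputable def rightHalf (q : E3) : E3 := ((q.1 + 1) / 2, q.2.1, q.2.2)

theorem leftHalf_cont : Continuous leftHalf := by unfold leftHalf; fun_prop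
theorem rightHalf_cont : Continuous rightHalf := by unfold rightHalf; fun_prop

theorem leftHalf_aff : IsAff leftHalf := by
  intro x y a b h
  ext <;> simp [leftHalf]
  linear_combination (1 / 2 : ℝ) * h

theorem rightHalf_aff : IsAff rightHalf := by
  intro x y a b h
  ext <;> simp [rightHalf]
  linear_combination (-1 / 2 : ℝ) * h

theorem leftHalf_inj : Function.Injective leftHalf := by
  rintro ⟨x, y, z⟩ ⟨x', y', z'⟩ h
  simp only [leftHalf, Prod.mk.injEq] at h
  obtain ⟨h, rfl, rfl⟩ := h
  simp; linarith

theorem rightHalf_inj : Function.Injective rightHalf := by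
  rintro ⟨x, y, z⟩ ⟨x', y', z'⟩ h
  simp only [rightHalf, Prod.mk.injEq] at h
  obtain ⟨h, rfl, rfl⟩ := h
  simp; linarith

theorem leftHalf_marked {l : ℕ} (i : Fin l) (z : ℝ) :
    marked (l + l) (Fin.castAdd l i) z = leftHalf (marked l i z) := by
  unfold marked leftHalf; rw [pt_castAdd]

theorem rightHalf_marked {l : ℕ} (i : Fin l) (z : ℝ) :
    marked (l + l) (Fin.natAdd l i) z = rightHalf (marked l i z) := by
  unfold marked rightHalf; rw [pt_natAdd]

/-- The strings of the horizontal juxtaposition. -/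
noncomputable def juxtStrand {l : ℕ} (σ τ : StringLink l) (k : Fin (l + l)) :
    Path (marked (l + l) k 0) (marked (l + l) k 1) :=
  Fin.addCases (motive := fun k => Path (marked (l + l) k 0) (marked (l + l) k 1))
    (fun i => mapPath (σ.strand i) leftHalf leftHalf_cont (leftHalf_marked i 0)
      (leftHalf_marked i 1))
    (fun i => mapPath (τ.strand i) rightHalf rightHalf_cont (rightHalf_marked i 0)
      (rightHalf_marked i 1))
    k

theorem juxtStrand_left {l : ℕ} (σ τ : StringLink l) (i : Fin l) :
    (juxtStrand σ τ (Fin.castAdd l i) : unitInterval → E3) = leftHalf ∘ σ.strand i := by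
  rw [juxtStrand, Fin.addCases_left, mapPath_coe]

theorem juxtStrand_right {l : ℕ} (σ τ : StringLink l) (i : Fin l) :
    (juxtStrand σ τ (Fin.natAdd l i) : unitInterval → E3) = rightHalf ∘ τ.strand i := by
  rw [juxtStrand, Fin.addCases_right, mapPath_coe]

theorem juxt_disj {l : ℕ} (σ τ : StringLink l) {i j : Fin l} {p r : E3}
    (hp : p ∈ range (σ.strand i)) (hr : r ∈ range (τ.strand j)) :
    leftHalf p ≠ rightHalf r := by
  intro h
  have h3 : (p.1 - 1) / 2 = (r.1 + 1) / 2 := congrArg (fun q => q.1) h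
  have h1 := (σ.mem_bounds hp).1
  have h2 := (τ.mem_bounds hr).1
  linarith

/-- The horizontal juxtaposition `σ ⊗ τ`: `σ` gives the first `l` strings (in the left half of the
cylinder), and `τ` the last `l` strings (in the right half). -/
noncomputable def StringLink.juxt {l : ℕ} (σ τ : StringLink l) : StringLink (l + l) where
  strand := juxtStrand σ τ
  injective := by
    refine injective_family ?_ ?_
    · intro k
      induction k using Fin.addCases with
      | left i => rw [juxtStrand_left]; exact leftHalf_inj.comp (σ.strand_injective i)
      | right i => rw [juxtStrand_right]; exact rightHalf_inj.comp (τ.strand_injective i)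
    · intro k m q hk hm
      induction k using Fin.addCases with
      | left i =>
        rw [juxtStrand_left, range_comp] at hk
        obtain ⟨p, hp, rfl⟩ := hk
        induction m using Fin.addCases with
        | left j =>
          rw [juxtStrand_left, range_comp] at hm
          obtain ⟨r, hr, h⟩ := hm
          rw [σ.eq_of_mem hp (leftHalf_inj h ▸ hr)]
        | right j =>
          rw [juxtStrand_right, range_comp] at hm
          obtain ⟨r, hr, h⟩ := hm
          exact absurd h.symm (juxt_disj σ τ hp hr)
      | right i =>
        rw [juxtStrand_right, range_comp] at hk
        obtain ⟨p, hp, rfl⟩ := hk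
        induction m using Fin.addCases with
        | left j =>
          rw [juxtStrand_left, range_comp] at hm
          obtain ⟨r, hr, h⟩ := hm
          exact absurd h (juxt_disj σ τ hr hp)
        | right j =>
          rw [juxtStrand_right, range_comp] at hm
          obtain ⟨r, hr, h⟩ := hm
          rw [τ.eq_of_mem hp (rightHalf_inj h ▸ hr)]
  proper k t h0 h1 := by
    induction k using Fin.addCases with
    | left i =>
      rw [juxtStrand_left]
      obtain ⟨hx, hy, hz⟩ := σ.proper i t h0 h1
      refine ⟨?_, hy, hz⟩
      simp only [Function.comp, leftHalf]
      constructor <;> linarith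
    | right i =>
      rw [juxtStrand_right]
      obtain ⟨hx, hy, hz⟩ := τ.proper i t h0 h1
      refine ⟨?_, hy, hz⟩
      simp only [Function.comp, rightHalf]
      constructor <;> linarith
  polygonal k := by
    induction k using Fin.addCases with
    | left i => rw [juxtStrand_left, range_comp]; exact (σ.polygonal i).image leftHalf_aff
    | right i => rw [juxtStrand_right, range_comp]; exact (τ.polygonal i).image rightHalf_aff
  vertical := by
    obtain ⟨ε, hε, hσ⟩ := σ.vertical
    obtain ⟨δ, hδ, hτ⟩ := τ.vertical
    refine ⟨min ε δ, lt_min hε hδ, ?_⟩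
    intro k q hq h
    have m1 : min ε δ ≤ ε := min_le_left _ _
    have m2 : min ε δ ≤ δ := min_le_right _ _
    induction k using Fin.addCases with
    | left i =>
      rw [juxtStrand_left, range_comp] at hq
      obtain ⟨p, hp, rfl⟩ := hq
      have := hσ i p hp (h.imp (fun h => h.trans m1) (fun h => by
        have : p.2.2 = (leftHalf p).2.2 := rfl
        linarith))
      refine ⟨?_, this.2⟩
      rw [pt_castAdd, ← this.1]; rfl
    | right i =>
      rw [juxtStrand_right, range_comp] at hq
      obtain ⟨p, hp, rfl⟩ := hq
      have := hτ i p hp (h.imp (fun h => h.trans m2) (fun h => by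
        have : p.2.2 = (rightHalf p).2.2 := rfl
        linarith))
      refine ⟨?_, this.2⟩
      rw [pt_natAdd, ← this.1]; rfl

/-- The reflection of the cylinder in the `I`-direction. -/
def flip (q : E3) : E3 := (q.1, q.2.1, 1 - q.2.2)

/-- The half turn of the cylinder about the axis `x = 0`, `z = 1/2`. -/
def turn (q : E3) : E3 := (-q.1, q.2.1, 1 - q.2.2)

theorem flip_cont : Continuous flip := by unfold flip; fun_prop
theorem turn_cont : Continuous turn := by unfold turn; fun_prop

theorem flip_aff : IsAff flip := by
  intro x y a b h
  ext <;> simp [flip]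
  linear_combination (-1 : ℝ) * h

theorem turn_aff : IsAff turn := by
  intro x y a b h
  ext <;> simp [turn]
  · ring
  · linear_combination (-1 : ℝ) * h

theorem flip_inj : Function.Injective flip := by
  rintro ⟨x, y, z⟩ ⟨x', y', z'⟩ h
  simp only [flip, Prod.mk.injEq] at h
  obtain ⟨rfl, rfl, h⟩ := h
  simp; linarith

theorem turn_inj : Function.Injective turn := by
  rintro ⟨x, y, z⟩ ⟨x', y', z'⟩ h
  simp only [turn, Prod.mk.injEq] at h
  obtain ⟨h', rfl, h⟩ := h
  simp; constructor <;> linarith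

theorem flip_one {n : ℕ} (i : Fin n) : marked n i 0 = flip (marked n i 1) := by
  simp [marked, flip]

theorem flip_zero {n : ℕ} (i : Fin n) : marked n i 1 = flip (marked n i 0) := by
  simp [marked, flip]

theorem turn_one {n : ℕ} (i : Fin n) : marked n i 0 = turn (marked n i.rev 1) := by
  simp [marked, turn, pt_rev]

theorem turn_zero {n : ℕ} (i : Fin n) : marked n i 1 = turn (marked n i.rev 0) := by
  simp [marked, turn, pt_rev]

/-- The strings of `σ̄`. -/
noncomputable def barStrand {n : ℕ} (σ : StringLink n) (i : Fin n) :
    Path (marked n i 0) (marked n i 1) :=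
  mapPath (σ.strand i).symm flip flip_cont (flip_one i) (flip_zero i)

/-- The strings of the turned string link. -/
noncomputable def rotStrand {n : ℕ} (σ : StringLink n) (i : Fin n) :
    Path (marked n i 0) (marked n i 1) :=
  mapPath (σ.strand i.rev).symm turn turn_cont (turn_one i) (turn_zero i)

/-- The string link `σ̄ = R_t ∘ σ ∘ R_s`, where `R_s` and `R_t` are the reflections of the source
`I` and of the target `D² × I` in the `I`-direction. -/
noncomputable def StringLink.bar {n : ℕ} (σ : StringLink n) : StringLink n where
  strand := barStrand σ
  injective := by
    refine injective_family ?_ ?_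
    · intro i
      exact mapPath_injective _ _ _ (symm_injective (σ.strand_injective i)) flip_inj
    · intro i j q hi hj
      rw [barStrand, mapPath_range, Path.symm_range] at hi hj
      obtain ⟨p, hp, rfl⟩ := hi
      obtain ⟨r, hr, h⟩ := hj
      exact σ.eq_of_mem hp (flip_inj h ▸ hr)
  proper i t h0 h1 := by
    rw [barStrand, mapPath_coe]
    obtain ⟨hx, hy, hz⟩ := σ.proper i (unitInterval.symm t) (fun h => h1 (by simpa using congrArg unitInterval.symm h))
      (fun h => h0 (by simpa using congrArg unitInterval.symm h))
    refine ⟨hx, hy, ?_⟩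
    simp only [Function.comp, flip, Path.symm_apply]
    constructor <;> linarith
  polygonal i := by
    rw [barStrand, mapPath_range, Path.symm_range]
    exact (σ.polygonal i).image flip_aff
  vertical := by
    obtain ⟨ε, hε, hσ⟩ := σ.vertical
    refine ⟨ε, hε, ?_⟩
    intro i q hq h
    rw [barStrand, mapPath_range, Path.symm_range] at hq
    obtain ⟨p, hp, rfl⟩ := hq
    simp only [flip] at h
    exact hσ i p hp (h.elim (fun h => Or.inr (by linarith)) (fun h => Or.inl (by linarith)))

/-- The string link obtained by the half turn `turn`; the strings are numbered from left to right
and oriented upwards again. -/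
noncomputable def StringLink.rot {n : ℕ} (σ : StringLink n) : StringLink n where
  strand := rotStrand σ
  injective := by
    refine injective_family ?_ ?_
    · intro i
      exact mapPath_injective _ _ _ (symm_injective (σ.strand_injective i.rev)) turn_inj
    · intro i j q hi hj
      rw [rotStrand, mapPath_range, Path.symm_range] at hi hj
      obtain ⟨p, hp, rfl⟩ := hi
      obtain ⟨r, hr, h⟩ := hj
      exact Fin.rev_injective (σ.eq_of_mem hp (turn_inj h ▸ hr))
  proper i t h0 h1 := by
    rw [rotStrand, mapPath_coe]
    obtain ⟨hx, hy, hz⟩ := σ.proper i.rev (unitInterval.symm t) (fun h => h1 (by simpa using congrArg unitInterval.symm h))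
      (fun h => h0 (by simpa using congrArg unitInterval.symm h))
    refine ⟨?_, hy, ?_⟩ <;> simp only [Function.comp, turn, Path.symm_apply] <;>
    constructor <;> linarith
  polygonal i := by
    rw [rotStrand, mapPath_range, Path.symm_range]
    exact (σ.polygonal i.rev).image turn_aff
  vertical := by
    obtain ⟨ε, hε, hσ⟩ := σ.vertical
    refine ⟨ε, hε, ?_⟩
    intro i q hq h
    rw [rotStrand, mapPath_range, Path.symm_range] at hq
    obtain ⟨p, hp, rfl⟩ := hq
    simp only [turn] at h ⊢
    have := hσ i.rev p hp
      (h.elim (fun h => Or.inr (by linarith)) (fun h => Or.inl (by linarith)))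
    rw [pt_rev] at this
    exact ⟨by linarith, this.2⟩

/-! ### Bending: the string link `1_l Σ` -/

/-- The quarter turn (and rescaling) which puts the cylinder of `Σ` into `D² × I` in such a way that
its top faces to the left and its bottom faces to the right. -/
noncomputable def place (q : E3) : E3 := (-q.2.2 / 2, q.2.1, 1 / 2 + q.1 / 4)

theorem place_cont : Continuous place := by unfold place; fun_prop

theorem place_aff : IsAff place := by
  intro x y a b h
  ext <;> simp [place]
  · ring
  · linear_combination (-1 / 2 : ℝ) * h

theorem place_inj : Function.Injective place := by
  rintro ⟨x, y, z⟩ ⟨x', y', z'⟩ h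
  simp only [place, Prod.mk.injEq] at h
  obtain ⟨h', rfl, h⟩ := h
  simp; constructor <;> linarith

/-- The (scaled) position of the `i`-th standard point, measured from the left end of the
diameter. -/
noncomputable def off (l : ℕ) (i : Fin l) : ℝ := (pt l i + 1) / 8

theorem off_bounds {l : ℕ} (i : Fin l) : 0 < off l i ∧ off l i < 1 / 4 := by
  have := pt_bounds i
  unfold off
  constructor <;> linarith

theorem pt_eq_off {l : ℕ} (i : Fin l) : pt l i = 8 * off l i - 1 := by unfold off; ring

theorem off_injective {l : ℕ} : Function.Injective (off l) := fun i j h =>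
  pt_injective (by rw [pt_eq_off, pt_eq_off, h])

/-- The polygonal arc from the `i`-th point at the bottom of `D² × I` to the end on top of the first
half of the strings of the placed `Σ`. -/
noncomputable def tail (l : ℕ) (i : Fin l) :
    Path (marked l i 0) ((-1 / 2, 0, 1 / 2 - off l i) : E3) :=
  ((Path.segment (marked l i 0) (marked l i (1 / 8))).trans
    (Path.segment (marked l i (1 / 8)) ((off l i - 3 / 4, 0, 1 / 4) : E3))).trans
    (Path.segment ((off l i - 3 / 4, 0, 1 / 4) : E3) ((-1 / 2, 0, 1 / 2 - off l i) : E3))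

/-- The `i`-th of the nested arcs joining the two halves of the bottom of the placed `Σ`. -/
noncomputable def arc (l : ℕ) (i : Fin l) :
    Path ((0, 0, 1 / 2 - off l i) : E3) ((0, 0, 1 / 2 + off l i) : E3) :=
  (Path.segment ((0, 0, 1 / 2 - off l i) : E3) ((off l i, 0, 1 / 2) : E3)).trans
    (Path.segment ((off l i, 0, 1 / 2) : E3) ((0, 0, 1 / 2 + off l i) : E3))

theorem place_low {l : ℕ} (i : Fin l) (z : ℝ) :
    place (marked (l + l) (Fin.castAdd l i.rev) z) = (-z / 2, 0, 1 / 2 - off l i) := by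
  simp only [place, marked, pt_castAdd_rev, off]
  ext <;> simp
  ring

theorem place_high {l : ℕ} (i : Fin l) (z : ℝ) :
    place (marked (l + l) (Fin.natAdd l i) z) = (-z / 2, 0, 1 / 2 + off l i) := by
  simp only [place, marked, pt_natAdd, off]
  ext <;> simp
  ring

theorem bend_e1 {l : ℕ} (i : Fin l) : ((-1 / 2, 0, 1 / 2 - off l i) : E3) =
    place (marked (l + l) (Fin.castAdd l i.rev) 1) := (place_low i 1).symm

theorem bend_e2 {l : ℕ} (i : Fin l) : ((0, 0, 1 / 2 - off l i) : E3) =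
    place (marked (l + l) (Fin.castAdd l i.rev) 0) := by rw [place_low]; simp

theorem bend_e3 {l : ℕ} (i : Fin l) : ((0, 0, 1 / 2 + off l i) : E3) =
    place (marked (l + l) (Fin.natAdd l i) 0) := by rw [place_high]; simp

theorem bend_e4 {l : ℕ} (i : Fin l) : ((-1 / 2, 0, 1 / 2 + off l i) : E3) =
    place (marked (l + l) (Fin.natAdd l i) 1) := (place_high i 1).symm

theorem bend_e5 {l : ℕ} (i : Fin l) : ((-1 / 2, 0, 1 / 2 + off l i) : E3) =
    flip ((-1 / 2, 0, 1 / 2 - off l i) : E3) := by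
  unfold flip; ext <;> simp; ring

/-- The `i`-th string of `1_l Σ`: from the bottom, it runs backwards along a string of the first
half of `Σ`, follows the arc `arc l i`, runs along a string of the second half of `Σ`, and goes to
the top. -/
noncomputable def bendStrand {l : ℕ} (S : StringLink (l + l)) (i : Fin l) :
    Path (marked l i 0) (marked l i 1) :=
  ((((tail l i).trans
    (mapPath (S.strand (Fin.castAdd l i.rev)).symm place place_cont (bend_e1 i) (bend_e2 i))).trans
    (arc l i)).trans
    (mapPath (S.strand (Fin.natAdd l i)) place place_cont (bend_e3 i) (bend_e4 i))).trans
    (mapPath (tail l i).symm flip flip_cont (bend_e5 i) (flip_zero i))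

/-- The points of a tail. -/
def TailSpec (a : ℝ) (q : E3) : Prop :=
  q.2.1 = 0 ∧ 0 ≤ q.2.2 ∧ q.2.2 ≤ 1 / 2 - a ∧
    ((q.2.2 ≤ 1 / 8 ∧ q.1 = 8 * a - 1) ∨
     (1 / 8 ≤ q.2.2 ∧ q.2.2 ≤ 1 / 4 ∧
        q.1 = (8 * a - 1) * (2 - 8 * q.2.2) + (a - 3 / 4) * (8 * q.2.2 - 1)) ∨
     (1 / 4 ≤ q.2.2 ∧ q.1 = q.2.2 + a - 1))

/-- What is needed about the points of a string of the placed `Σ`. -/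
def BoxSpec (c : ℝ) (q : E3) : Prop :=
  -1 / 2 ≤ q.1 ∧ q.1 ≤ 0 ∧ (-1 < q.2.1 ∧ q.2.1 < 1) ∧ 1 / 4 < q.2.2 ∧ q.2.2 < 3 / 4 ∧
    (q.1 = 0 → q = (0, 0, 1 / 2 + c)) ∧ (q.1 = -1 / 2 → q = (-1 / 2, 0, 1 / 2 + c))

/-- The points of an arc. -/
def ArcSpec (a : ℝ) (q : E3) : Prop :=
  q.2.1 = 0 ∧ 0 ≤ q.1 ∧ ((q.2.2 ≤ 1 / 2 ∧ q.1 = a - (1 / 2 - q.2.2)) ∨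
    (1 / 2 ≤ q.2.2 ∧ q.1 = a - (q.2.2 - 1 / 2)))

theorem tail_seg1 {l : ℕ} {i : Fin l} {q : E3}
    (h : q ∈ range (Path.segment (marked l i 0) (marked l i (1 / 8)))) :
    q.2.1 = 0 ∧ 0 ≤ q.2.2 ∧ q.2.2 ≤ 1 / 8 ∧ q.1 = 8 * off l i - 1 := by
  obtain ⟨s, h0, h1, hx, hy, hz⟩ := mem_seg h
  simp only [marked, pt_eq_off] at hx hy hz
  refine ⟨by linarith, by linarith, by linarith, by linarith⟩

theorem tail_seg2 {l : ℕ} {i : Fin l} {q : E3}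
    (h : q ∈ range (Path.segment (marked l i (1 / 8)) ((off l i - 3 / 4, 0, 1 / 4) : E3))) :
    q.2.1 = 0 ∧ 1 / 8 ≤ q.2.2 ∧ q.2.2 ≤ 1 / 4 ∧
      q.1 = (8 * off l i - 1) * (2 - 8 * q.2.2) + (off l i - 3 / 4) * (8 * q.2.2 - 1) := by
  obtain ⟨s, h0, h1, hx, hy, hz⟩ := mem_seg h
  simp only [marked, pt_eq_off] at hx hy hz
  have hs : s = 8 * q.2.2 - 1 := by linarith
  refine ⟨by linarith, by linarith, by linarith, ?_⟩
  rw [hx, hs]; ring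

theorem tail_seg3 {l : ℕ} {i : Fin l} {q : E3}
    (h : q ∈ range (Path.segment ((off l i - 3 / 4, 0, 1 / 4) : E3)
      ((-1 / 2, 0, 1 / 2 - off l i) : E3))) :
    q.2.1 = 0 ∧ 1 / 4 ≤ q.2.2 ∧ q.2.2 ≤ 1 / 2 - off l i ∧ q.1 = q.2.2 + off l i - 1 := by
  obtain ⟨s, h0, h1, hx, hy, hz⟩ := mem_seg h
  have ha := off_bounds i
  simp only at hx hy hz
  refine ⟨by linarith, by nlinarith, by nlinarith, by linarith⟩

theorem tail_spec {l : ℕ} {i : Fin l} {q : E3} (h : q ∈ range (tail l i)) :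
    TailSpec (off l i) q := by
  have ha := off_bounds i
  rw [tail, Path.trans_range, Path.trans_range] at h
  rcases h with (h | h) | h
  · obtain ⟨h1, h2, h3, h4⟩ := tail_seg1 h
    exact ⟨h1, h2, by linarith, Or.inl ⟨h3, h4⟩⟩
  · obtain ⟨h1, h2, h3, h4⟩ := tail_seg2 h
    exact ⟨h1, by linarith, by linarith, Or.inr (Or.inl ⟨h2, h3, h4⟩)⟩
  · obtain ⟨h1, h2, h3, h4⟩ := tail_seg3 h
    exact ⟨h1, by linarith, by linarith, Or.inr (Or.inr ⟨h2, h4⟩)⟩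

theorem ne_of_height {a b : E3} (h : a.2.2 < b.2.2) : a ≠ b := fun e => by
  rw [e] at h; exact lt_irrefl _ h

theorem tail_injective {l : ℕ} (i : Fin l) : Function.Injective (tail l i) := by
  have ha := off_bounds i
  refine trans_injective (trans_injective ?_ ?_ ?_) ?_ ?_
  · exact Path.segment_injective_of_ne (ne_of_height (by norm_num [marked]))
  · exact Path.segment_injective_of_ne (ne_of_height (by norm_num [marked]))
  · intro q h h'
    obtain ⟨h1, h2, h3, h4⟩ := tail_seg1 h
    obtain ⟨-, h5, -, -⟩ := tail_seg2 h'
    have hz : q.2.2 = 1 / 8 := le_antisymm h3 h5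
    exact Prod.ext (by rw [h4]; exact (pt_eq_off i).symm) (Prod.ext h1 hz)
  · exact Path.segment_injective_of_ne (ne_of_height (by simp only; linarith))
  · intro q h h'
    obtain ⟨h1, h2, h3, h4⟩ := tail_seg3 h'
    rw [Path.trans_range] at h
    have hz : q.2.2 = 1 / 4 := by
      rcases h with h | h
      · have := tail_seg1 h; linarith
      · have := tail_seg2 h; linarith
    exact Prod.ext (by rw [h4, hz]; simp only; ring) (Prod.ext h1 hz)

theorem arc_seg1 {l : ℕ} {i : Fin l} {q : E3}
    (h : q ∈ range (Path.segment ((0, 0, 1 / 2 - off l i) : E3) ((off l i, 0, 1 / 2) : E3))) :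
    q.2.1 = 0 ∧ 0 ≤ q.1 ∧ q.2.2 ≤ 1 / 2 ∧ q.1 = off l i - (1 / 2 - q.2.2) := by
  obtain ⟨s, h0, h1, hx, hy, hz⟩ := mem_seg h
  have ha := off_bounds i
  simp only at hx hy hz
  refine ⟨by linarith, by nlinarith, by nlinarith, by linarith⟩

theorem arc_seg2 {l : ℕ} {i : Fin l} {q : E3}
    (h : q ∈ range (Path.segment ((off l i, 0, 1 / 2) : E3) ((0, 0, 1 / 2 + off l i) : E3))) :
    q.2.1 = 0 ∧ 0 ≤ q.1 ∧ 1 / 2 ≤ q.2.2 ∧ q.1 = off l i - (q.2.2 - 1 / 2) := by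
  obtain ⟨s, h0, h1, hx, hy, hz⟩ := mem_seg h
  have ha := off_bounds i
  simp only at hx hy hz
  refine ⟨by linarith, by nlinarith, by nlinarith, by linarith⟩

theorem arc_spec {l : ℕ} {i : Fin l} {q : E3} (h : q ∈ range (arc l i)) :
    ArcSpec (off l i) q := by
  rw [arc, Path.trans_range] at h
  rcases h with h | h
  · obtain ⟨h1, h2, h3, h4⟩ := arc_seg1 h
    exact ⟨h1, h2, Or.inl ⟨h3, h4⟩⟩
  · obtain ⟨h1, h2, h3, h4⟩ := arc_seg2 h
    exact ⟨h1, h2, Or.inr ⟨h3, h4⟩⟩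

theorem arc_injective {l : ℕ} (i : Fin l) : Function.Injective (arc l i) := by
  have ha := off_bounds i
  refine trans_injective ?_ ?_ ?_
  · exact Path.segment_injective_of_ne (ne_of_height (by simp only; linarith))
  · exact Path.segment_injective_of_ne (ne_of_height (by simp only; linarith))
  · intro q h h'
    obtain ⟨h1, -, h3, h4⟩ := arc_seg1 h
    obtain ⟨-, -, h5, -⟩ := arc_seg2 h'
    have hz : q.2.2 = 1 / 2 := le_antisymm h3 h5
    exact Prod.ext (by rw [h4, hz]; simp) (Prod.ext h1 hz)

theorem box_low {l : ℕ} {S : StringLink (l + l)} {i : Fin l} {q : E3}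
    (h : q ∈ place '' range (S.strand (Fin.castAdd l i.rev))) : BoxSpec (-off l i) q := by
  obtain ⟨p, hp, rfl⟩ := h
  obtain ⟨hx, hy, hz, h0, h1⟩ := S.mem_bounds hp
  simp only [BoxSpec]
  refine ⟨?_, ?_, hy, ?_, ?_, fun h => ?_, fun h => ?_⟩
  · simp only [place]; linarith
  · simp only [place]; linarith
  · simp only [place]; linarith
  · simp only [place]; linarith
  · simp only [place] at h
    rw [h0 (by linarith), ← bend_e2, sub_eq_add_neg]
  · simp only [place] at h
    rw [h1 (by linarith), ← bend_e1, sub_eq_add_neg]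

theorem box_high {l : ℕ} {S : StringLink (l + l)} {i : Fin l} {q : E3}
    (h : q ∈ place '' range (S.strand (Fin.natAdd l i))) : BoxSpec (off l i) q := by
  obtain ⟨p, hp, rfl⟩ := h
  obtain ⟨hx, hy, hz, h0, h1⟩ := S.mem_bounds hp
  simp only [BoxSpec]
  refine ⟨?_, ?_, hy, ?_, ?_, fun h => ?_, fun h => ?_⟩
  · simp only [place]; linarith
  · simp only [place]; linarith
  · simp only [place]; linarith
  · simp only [place]; linarith
  · simp only [place] at h
    rw [h0 (by linarith), ← bend_e3]
  · simp only [place] at h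
    rw [h1 (by linarith), ← bend_e4]

theorem tail_box {a c : ℝ} {q : E3} (ha : 0 < a) (h : TailSpec a q) (h' : BoxSpec c q) :
    c = -a ∧ q = (-1 / 2, 0, 1 / 2 - a) := by
  obtain ⟨h1, h2, h3, h4⟩ := h
  obtain ⟨g1, -, -, g2, -, -, g3⟩ := h'
  rcases h4 with h4 | h4 | h4
  · linarith
  · linarith
  · have hx : q.1 = -1 / 2 := le_antisymm (by linarith) g1
    have hz : q.2.2 = 1 / 2 - a := by linarith
    have hq := g3 hx
    have : q.2.2 = 1 / 2 + c := congrArg (fun q => q.2.2) hq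
    exact ⟨by linarith, Prod.ext hx (Prod.ext h1 hz)⟩

theorem flip_box {c : ℝ} {q : E3} (h : BoxSpec c q) : BoxSpec (-c) (flip q) := by
  obtain ⟨g1, g2, g3, g4, g5, g6, g7⟩ := h
  refine ⟨g1, g2, g3, ?_, ?_, fun h => ?_, fun h => ?_⟩
  · simp only [flip]; linarith
  · simp only [flip]; linarith
  · rw [g6 h]; unfold flip; ext <;> simp; ring
  · rw [g7 h]; unfold flip; ext <;> simp; ring

theorem flip_flip (q : E3) : flip (flip q) = q := by
  unfold flip; ext <;> simp

theorem high_box {a c : ℝ} {q : E3} (ha : 0 < a) (h : TailSpec a (flip q)) (h' : BoxSpec c q) :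
    c = a ∧ q = (-1 / 2, 0, 1 / 2 + a) := by
  obtain ⟨h1, h2⟩ := tail_box ha h (flip_box h')
  refine ⟨by linarith, ?_⟩
  rw [← flip_flip q, h2]; unfold flip; ext <;> simp; ring

theorem tail_arc {a b : ℝ} {q : E3} (ha : 0 < a) (hb : b < 1 / 4) (h : TailSpec a q)
    (h' : ArcSpec b q) : False := by
  obtain ⟨h1, h2, h3, h4⟩ := h
  obtain ⟨-, g1, g2⟩ := h'
  have hz : 1 / 4 < q.2.2 := by rcases g2 with g2 | g2 <;> linarith
  rcases h4 with h4 | h4 | h4 <;> linarith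

theorem flip_arc {b : ℝ} {q : E3} (h : ArcSpec b q) : ArcSpec b (flip q) := by
  obtain ⟨h1, h2, h3⟩ := h
  refine ⟨h1, h2, ?_⟩
  simp only [flip]
  rcases h3 with h3 | h3
  · right; constructor <;> linarith
  · left; constructor <;> linarith

theorem tail_high {a b : ℝ} {q : E3} (ha : 0 < a) (hb : 0 < b) (h : TailSpec a q)
    (h' : TailSpec b (flip q)) : False := by
  have h1 := h.2.2.1
  have h2 := h'.2.2.1
  simp only [flip] at h2
  linarith

theorem tail_tail {a b : ℝ} {q : E3} (h : TailSpec a q) (h' : TailSpec b q) : a = b := by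
  obtain ⟨-, -, -, h⟩ := h
  obtain ⟨-, -, -, g⟩ := h'
  rcases h with ⟨h1, h2⟩ | ⟨h1, h2, h3⟩ | ⟨h1, h2⟩ <;>
    rcases g with ⟨g1, g2⟩ | ⟨g1, g2, g3⟩ | ⟨g1, g2⟩
  · linarith
  · have e : q.2.2 = 1 / 8 := le_antisymm h1 g1
    rw [e] at g3; linarith
  · linarith
  · have e : q.2.2 = 1 / 8 := le_antisymm g1 h1
    rw [e] at h3; linarith
  · have e : (a - b) * (15 - 56 * q.2.2) = 0 := by linarith
    rcases mul_eq_zero.mp e with e | e <;> linarith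
  · have e : q.2.2 = 1 / 4 := le_antisymm h2 g1
    rw [e] at h3 g2; linarith
  · linarith
  · have e : q.2.2 = 1 / 4 := le_antisymm g2 h1
    rw [e] at g3 h2; linarith
  · linarith

theorem arc_arc {a b : ℝ} {q : E3} (h : ArcSpec a q) (h' : ArcSpec b q) : a = b := by
  obtain ⟨-, -, h⟩ := h
  obtain ⟨-, -, g⟩ := h'
  rcases h with h | h <;> rcases g with g | g <;> linarith

theorem arc_box {a c : ℝ} {q : E3} (h : ArcSpec a q) (h' : BoxSpec c q) :
    (c = a ∨ c = -a) ∧ q = (0, 0, 1 / 2 + c) := by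
  obtain ⟨h1, h2, h3⟩ := h
  obtain ⟨-, g1, -, -, -, g2, -⟩ := h'
  have hx : q.1 = 0 := le_antisymm g1 h2
  have hq := g2 hx
  have hz : q.2.2 = 1 / 2 + c := congrArg (fun q => q.2.2) hq
  refine ⟨?_, hq⟩
  rcases h3 with h3 | h3
  · right; linarith
  · left; linarith

theorem bendStrand_range {l : ℕ} (S : StringLink (l + l)) (i : Fin l) :
    range (bendStrand S i) = (((range (tail l i) ∪
      place '' range (S.strand (Fin.castAdd l i.rev))) ∪ range (arc l i)) ∪
      place '' range (S.strand (Fin.natAdd l i))) ∪ flip '' range (tail l i) := by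
  rw [bendStrand, Path.trans_range, Path.trans_range, Path.trans_range, Path.trans_range,
    mapPath_range, mapPath_range, mapPath_range, Path.symm_range, Path.symm_range]

theorem high_spec {l : ℕ} {i : Fin l} {q : E3} (h : q ∈ flip '' range (tail l i)) :
    TailSpec (off l i) (flip q) := by
  obtain ⟨p, hp, rfl⟩ := h
  rw [flip_flip]; exact tail_spec hp

theorem castAdd_ne_natAdd {l : ℕ} (i j : Fin l) : Fin.castAdd l i ≠ Fin.natAdd l j := by
  intro h
  have := congrArg Fin.val h
  simp only [Fin.val_castAdd, Fin.val_natAdd] at this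
  have := i.2
  omega

theorem bendStrand_injective {l : ℕ} (S : StringLink (l + l)) (i : Fin l) :
    Function.Injective (bendStrand S i) := by
  have ha := off_bounds i
  refine trans_injective (trans_injective (trans_injective (trans_injective (tail_injective i)
    (mapPath_injective _ _ _ (symm_injective (S.strand_injective _)) place_inj) ?_)
    (arc_injective i) ?_)
    (mapPath_injective _ _ _ (S.strand_injective _) place_inj) ?_)
    (mapPath_injective _ _ _ (symm_injective (tail_injective i)) flip_inj) ?_
  · intro q h h'
    rw [mapPath_range, Path.symm_range] at h'
    exact (tail_box ha.1 (tail_spec h) (box_low h')).2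
  · intro q h h'
    rw [Path.trans_range, mapPath_range, Path.symm_range] at h
    rcases h with h | h
    · exact (tail_arc ha.1 ha.2 (tail_spec h) (arc_spec h')).elim
    · rw [(arc_box (arc_spec h') (box_low h)).2, ← sub_eq_add_neg]
  · intro q h h'
    rw [Path.trans_range, Path.trans_range, mapPath_range, Path.symm_range] at h
    rw [mapPath_range] at h'
    rcases h with (h | h) | h
    · have := (tail_box ha.1 (tail_spec h) (box_high h')).1
      linarith
    · obtain ⟨p, hp, rfl⟩ := h
      obtain ⟨r, hr, h⟩ := h'
      rw [place_inj h] at hr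
      exact absurd (S.eq_of_mem hp hr) (castAdd_ne_natAdd _ _)
    · exact (arc_box (arc_spec h) (box_high h')).2
  · intro q h h'
    rw [Path.trans_range, Path.trans_range, Path.trans_range, mapPath_range, mapPath_range,
      Path.symm_range] at h
    rw [mapPath_range, Path.symm_range] at h'
    have h' := high_spec h'
    rcases h with ((h | h) | h) | h
    · exact (tail_high ha.1 ha.1 (tail_spec h) h').elim
    · have := (high_box ha.1 h' (box_low h)).1
      linarith
    · exact (tail_arc ha.1 ha.2 h' (flip_arc (arc_spec h))).elim
    · exact (high_box ha.1 h' (box_high h)).2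

theorem bend_disj {l : ℕ} (S : StringLink (l + l)) (i j : Fin l) (q : E3)
    (hi : q ∈ range (bendStrand S i)) (hj : q ∈ range (bendStrand S j)) : i = j := by
  have ha := off_bounds i
  have hb := off_bounds j
  apply off_injective
  rw [bendStrand_range] at hi hj
  rcases hi with (((hi | hi) | hi) | hi) | hi
  · have hi := tail_spec hi
    rcases hj with (((hj | hj) | hj) | hj) | hj
    · exact tail_tail hi (tail_spec hj)
    · linarith [(tail_box ha.1 hi (box_low hj)).1]
    · exact (tail_arc ha.1 hb.2 hi (arc_spec hj)).elim
    · linarith [(tail_box ha.1 hi (box_high hj)).1]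
    · exact (tail_high ha.1 hb.1 hi (high_spec hj)).elim
  · rcases hj with (((hj | hj) | hj) | hj) | hj
    · linarith [(tail_box hb.1 (tail_spec hj) (box_low hi)).1]
    · obtain ⟨p, hp, rfl⟩ := hi
      obtain ⟨r, hr, h⟩ := hj
      rw [place_inj h] at hr
      have := S.eq_of_mem hp hr
      rw [Fin.castAdd_inj, Fin.rev_inj] at this
      rw [this]
    · rcases (arc_box (arc_spec hj) (box_low hi)).1 with h | h <;> linarith
    · obtain ⟨p, hp, rfl⟩ := hi
      obtain ⟨r, hr, h⟩ := hj
      rw [place_inj h] at hr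
      exact absurd (S.eq_of_mem hp hr) (castAdd_ne_natAdd _ _)
    · linarith [(high_box hb.1 (high_spec hj) (box_low hi)).1]
  · have hi := arc_spec hi
    rcases hj with (((hj | hj) | hj) | hj) | hj
    · exact (tail_arc hb.1 ha.2 (tail_spec hj) hi).elim
    · rcases (arc_box hi (box_low hj)).1 with h | h <;> linarith
    · exact arc_arc hi (arc_spec hj)
    · rcases (arc_box hi (box_high hj)).1 with h | h <;> linarith
    · exact (tail_arc hb.1 ha.2 (high_spec hj) (flip_arc hi)).elim
  · rcases hj with (((hj | hj) | hj) | hj) | hj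
    · linarith [(tail_box hb.1 (tail_spec hj) (box_high hi)).1]
    · obtain ⟨p, hp, rfl⟩ := hi
      obtain ⟨r, hr, h⟩ := hj
      rw [place_inj h] at hr
      exact absurd (S.eq_of_mem hr hp) (castAdd_ne_natAdd _ _)
    · rcases (arc_box (arc_spec hj) (box_high hi)).1 with h | h <;> linarith
    · obtain ⟨p, hp, rfl⟩ := hi
      obtain ⟨r, hr, h⟩ := hj
      rw [place_inj h] at hr
      have := S.eq_of_mem hp hr
      rw [Fin.natAdd_inj] at this
      rw [this]
    · linarith [(high_box hb.1 (high_spec hj) (box_high hi)).1]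
  · have hi := high_spec hi
    rcases hj with (((hj | hj) | hj) | hj) | hj
    · exact (tail_high hb.1 ha.1 (tail_spec hj) hi).elim
    · linarith [(high_box ha.1 hi (box_low hj)).1]
    · exact (tail_arc ha.1 hb.2 hi (flip_arc (arc_spec hj))).elim
    · linarith [(high_box ha.1 hi (box_high hj)).1]
    · exact tail_tail hi (high_spec hj)

theorem tail_interior {l : ℕ} {i : Fin l} {q : E3} (h : TailSpec (off l i) q) :
    q = marked l i 0 ∨ q ∈ cylinderInterior := by
  have ha := off_bounds i
  obtain ⟨h1, h2, h3, h4⟩ := h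
  rcases h2.eq_or_lt with h2 | h2
  · left
    refine Prod.ext ?_ (Prod.ext h1 h2.symm)
    rw [show (marked l i 0).1 = 8 * off l i - 1 from pt_eq_off i]
    rcases h4 with h4 | h4 | h4
    · exact h4.2
    · linarith
    · linarith
  · right
    refine ⟨?_, ⟨by linarith, by linarith⟩, ⟨h2, by linarith⟩⟩
    rcases h4 with h4 | ⟨g1, g2, g3⟩ | h4
    · constructor <;> linarith
    · rw [g3]; constructor <;> nlinarith
    · constructor <;> linarith

theorem box_interior {c : ℝ} {q : E3} (h : BoxSpec c q) : q ∈ cylinderInterior := by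
  obtain ⟨g1, g2, g3, g4, g5, g6, g7⟩ := h
  exact ⟨⟨by linarith, by linarith⟩, g3, ⟨by linarith, by linarith⟩⟩

theorem arc_interior {l : ℕ} {i : Fin l} {q : E3} (h : ArcSpec (off l i) q) :
    q ∈ cylinderInterior := by
  have ha := off_bounds i
  obtain ⟨h1, h2, h3⟩ := h
  refine ⟨?_, ⟨by linarith, by linarith⟩, ?_⟩ <;> rcases h3 with h3 | h3 <;>
    constructor <;> linarith

theorem tail_low {a : ℝ} {q : E3} (h : TailSpec a q) (hz : q.2.2 ≤ 1 / 8) : q.1 = 8 * a - 1 := by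
  obtain ⟨h1, h2, h3, h4⟩ := h
  rcases h4 with h4 | h4 | h4
  · exact h4.2
  · have e : q.2.2 = 1 / 8 := le_antisymm hz h4.1
    rw [h4.2.2, e]; ring
  · linarith

/-- The `l`-component string link `1_l Σ` obtained from the `2l`-component string link `Σ` by closing
up its bottom with nested arcs (a trivial string link bent into a `U`) and by unbending its top: the
ends on top of the first half of the strings are led to the bottom of `D² × I`, and those of the last
half to its top.  The first half of the strings of `Σ` is run through downwards; in order that the
picture be planar, the `i`-th string of `1_l Σ` consists of the strings `l + 1 - i` and `l + i` of
`Σ` (counted from `1`). -/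
noncomputable def StringLink.bend {l : ℕ} (S : StringLink (l + l)) : StringLink l where
  strand := bendStrand S
  injective := injective_family (bendStrand_injective S) (bend_disj S)
  proper i := by
    refine proper_of (bendStrand_injective S i) ?_
    intro q hq
    rw [bendStrand_range] at hq
    rcases hq with (((h | h) | h) | h) | h
    · exact (tail_interior (tail_spec h)).imp id Or.inr
    · exact Or.inr (Or.inr (box_interior (box_low h)))
    · exact Or.inr (Or.inr (arc_interior (arc_spec h)))
    · exact Or.inr (Or.inr (box_interior (box_high h)))
    · right
      refine (tail_interior (high_spec h)).imp (fun h => ?_) (fun h => ?_)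
      · rw [← flip_flip q, h, ← flip_zero]
      · obtain ⟨h1, h2, h3⟩ := h
        refine ⟨h1, h2, ?_⟩
        simp only [flip] at h3
        constructor <;> linarith
  polygonal i := by
    have ht : IsPolygonal (range (tail l i)) :=
      polygonal_trans (polygonal_trans (polygonal_seg _ _) (polygonal_seg _ _)) (polygonal_seg _ _)
    rw [bendStrand_range]
    exact (((ht.union ((S.polygonal _).image place_aff)).union
      (polygonal_trans (polygonal_seg _ _) (polygonal_seg _ _))).union
      ((S.polygonal _).image place_aff)).union (ht.image flip_aff)
  vertical := by
    refine ⟨1 / 8, by norm_num, ?_⟩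
    intro i q hq hz
    have ha := off_bounds i
    rw [pt_eq_off]
    rw [bendStrand_range] at hq
    rcases hq with (((h | h) | h) | h) | h
    · have h := tail_spec h
      refine ⟨tail_low h ?_, h.1⟩
      have := h.2.2.1
      rcases hz with hz | hz <;> linarith
    · obtain ⟨-, -, -, g1, g2, -⟩ := box_low h
      rcases hz with hz | hz <;> linarith
    · obtain ⟨-, g1, g2⟩ := arc_spec h
      rcases hz with hz | hz <;> rcases g2 with g2 | g2 <;> linarith
    · obtain ⟨-, -, -, g1, g2, -⟩ := box_high h
      rcases hz with hz | hz <;> linarith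
    · have h := high_spec h
      have h3 : 1 - q.2.2 ≤ 1 / 2 - off l i := h.2.2.1
      refine ⟨tail_low (q := flip q) h ?_, h.1⟩
      simp only [flip]
      rcases hz with hz | hz <;> linarith

/-! ### The closed link `1_l Σ 1_l` -/

theorem trans_loop {a b : E3} {γ : Path a b} {γ' : Path b a} (h : Function.Injective γ)
    (h' : Function.Injective γ') (hd : ∀ q ∈ range γ, q ∈ range γ' → q = a ∨ q = b) {s t : ℝ}
    (hs : s ∈ Ico (0 : ℝ) 1) (ht : t ∈ Ico (0 : ℝ) 1)
    (he : (γ.trans γ').extend s = (γ.trans γ').extend t) : s = t := by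
  have hs' : s ∈ unitInterval := ⟨hs.1, hs.2.le⟩
  have ht' : t ∈ unitInterval := ⟨ht.1, ht.2.le⟩
  rw [Path.extend_apply _ hs', Path.extend_apply _ ht'] at he
  have aux : ∀ (s t : unitInterval), (t : ℝ) < 1 → (s : ℝ) ≤ 1 / 2 → ¬ (t : ℝ) ≤ 1 / 2 →
      γ.trans γ' s ≠ γ.trans γ' t := by
    intro s t ht1 hs ht he
    rw [Path.trans_apply, Path.trans_apply, dif_pos hs, dif_neg ht] at he
    rcases hd _ (mem_range_self _) (by rw [he]; exact mem_range_self _) with h1 | h1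
    · have h2 := congrArg Subtype.val (h' ((h1.symm.trans he).symm.trans γ'.target.symm))
      simp only [Icc.coe_one] at h2
      linarith
    · have h2 := congrArg Subtype.val (h' ((h1.symm.trans he).symm.trans γ'.source.symm))
      simp only [Icc.coe_zero] at h2
      linarith
  by_cases hs2 : s ≤ 1 / 2 <;> by_cases ht2 : t ≤ 1 / 2
  · rw [Path.trans_apply, Path.trans_apply, dif_pos hs2, dif_pos ht2] at he
    have h2 := congrArg Subtype.val (h he)
    simp only at h2
    linarith
  · exact absurd he (aux ⟨s, hs'⟩ ⟨t, ht'⟩ ht.2 hs2 ht2)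
  · exact absurd he.symm (aux ⟨t, ht'⟩ ⟨s, hs'⟩ hs.2 ht2 hs2)
  · rw [Path.trans_apply, Path.trans_apply, dif_neg hs2, dif_neg ht2] at he
    have h2 := congrArg Subtype.val (h' he)
    simp only at h2
    linarith

/-- The map of the circle given by a loop. -/
noncomputable def circleMap {a : E3} (γ : Path a a) : C(UnitAddCircle, E3) where
  toFun := AddCircle.liftIco 1 0 γ.extend
  continuous_toFun := AddCircle.liftIco_zero_continuous (by simp)
    γ.continuous_extend.continuousOn

theorem circleMap_apply {a : E3} (γ : Path a a) {t : ℝ} (ht : t ∈ Ico (0 : ℝ) 1) :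
    circleMap γ (t : UnitAddCircle) = γ.extend t := by
  change AddCircle.liftIco (1 : ℝ) 0 γ.extend (t : AddCircle (1 : ℝ)) = γ.extend t
  exact AddCircle.liftIco_zero_coe_apply ht

theorem exists_rep (x : UnitAddCircle) : ∃ t ∈ Ico (0 : ℝ) 1, (t : UnitAddCircle) = x := by
  obtain ⟨t, ht, h⟩ := AddCircle.coe_image_Ico_eq (1 : ℝ) 0 ▸ mem_univ x
  exact ⟨t, by simpa using ht, h⟩

theorem circleMap_range {a : E3} (γ : Path a a) : range (circleMap γ) = range γ := by
  ext q
  constructor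
  · rintro ⟨x, rfl⟩
    obtain ⟨t, ht, rfl⟩ := exists_rep x
    rw [circleMap_apply γ ht, ← Path.extend_range]
    exact mem_range_self _
  · rintro ⟨t, rfl⟩
    by_cases h1 : t = 1
    · refine ⟨((0 : ℝ) : UnitAddCircle), ?_⟩
      rw [circleMap_apply γ (by simp), h1]
      simp
    · have ht : (t : ℝ) ∈ Ico (0 : ℝ) 1 :=
        ⟨t.2.1, lt_of_le_of_ne t.2.2 (fun h => h1 (Subtype.ext h))⟩
      exact ⟨((t : ℝ) : UnitAddCircle), by rw [circleMap_apply γ ht, Path.extend_apply γ t.2]⟩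

/-- The distance of the points of the `i`-th arc of a plat closure from the axis `x = 0`. -/
noncomputable def rad (l : ℕ) (i : Fin l) : ℝ := (pt l i + 1) / 2

theorem rad_bounds {l : ℕ} (i : Fin l) : 0 < rad l i ∧ rad l i < 1 := by
  have := pt_bounds i
  unfold rad
  constructor <;> linarith

theorem rad_injective {l : ℕ} : Function.Injective (rad l) := fun i j h =>
  pt_injective (by unfold rad at h; linarith)

theorem marked_low {l : ℕ} (i : Fin l) (z : ℝ) :
    marked (l + l) (Fin.castAdd l i.rev) z = (-rad l i, 0, z) := by
  unfold marked; rw [pt_castAdd_rev]; rfl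

theorem marked_high {l : ℕ} (i : Fin l) (z : ℝ) :
    marked (l + l) (Fin.natAdd l i) z = (rad l i, 0, z) := by
  unfold marked; rw [pt_natAdd]; rfl

/-- The `i`-th of the nested arcs below the cylinder. -/
noncomputable def cup (l : ℕ) (i : Fin l) :
    Path (marked (l + l) (Fin.castAdd l i.rev) 0) (marked (l + l) (Fin.natAdd l i) 0) :=
  (Path.segment (marked (l + l) (Fin.castAdd l i.rev) 0) ((0, 0, -rad l i) : E3)).trans
    (Path.segment ((0, 0, -rad l i) : E3) (marked (l + l) (Fin.natAdd l i) 0))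

/-- The `i`-th of the nested arcs above the cylinder. -/
noncomputable def cap (l : ℕ) (i : Fin l) :
    Path (marked (l + l) (Fin.natAdd l i) 1) (marked (l + l) (Fin.castAdd l i.rev) 1) :=
  (Path.segment (marked (l + l) (Fin.natAdd l i) 1) ((0, 0, 1 + rad l i) : E3)).trans
    (Path.segment ((0, 0, 1 + rad l i) : E3) (marked (l + l) (Fin.castAdd l i.rev) 1))

/-- The points of a cup. -/
def CupSpec (b : ℝ) (q : E3) : Prop :=
  q.2.1 = 0 ∧ q.2.2 ≤ 0 ∧ ((q.1 ≤ 0 ∧ q.2.2 = -q.1 - b) ∨ (0 ≤ q.1 ∧ q.2.2 = q.1 - b))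

theorem cup_seg1 {l : ℕ} {i : Fin l} {q : E3} (h : q ∈ range (Path.segment
    (marked (l + l) (Fin.castAdd l i.rev) 0) ((0, 0, -rad l i) : E3))) :
    q.2.1 = 0 ∧ q.2.2 ≤ 0 ∧ q.1 ≤ 0 ∧ q.2.2 = -q.1 - rad l i := by
  obtain ⟨s, h0, h1, hx, hy, hz⟩ := mem_seg h
  have ha := rad_bounds i
  simp only [marked_low] at hx hy hz
  refine ⟨by linarith, by nlinarith, by nlinarith, by linarith⟩

theorem cup_seg2 {l : ℕ} {i : Fin l} {q : E3} (h : q ∈ range (Path.segment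
    ((0, 0, -rad l i) : E3) (marked (l + l) (Fin.natAdd l i) 0))) :
    q.2.1 = 0 ∧ q.2.2 ≤ 0 ∧ 0 ≤ q.1 ∧ q.2.2 = q.1 - rad l i := by
  obtain ⟨s, h0, h1, hx, hy, hz⟩ := mem_seg h
  have ha := rad_bounds i
  simp only [marked_high] at hx hy hz
  refine ⟨by linarith, by nlinarith, by nlinarith, by linarith⟩

theorem cap_seg1 {l : ℕ} {i : Fin l} {q : E3} (h : q ∈ range (Path.segment
    (marked (l + l) (Fin.natAdd l i) 1) ((0, 0, 1 + rad l i) : E3))) :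
    q.2.1 = 0 ∧ 1 ≤ q.2.2 ∧ 0 ≤ q.1 ∧ q.2.2 = 1 - q.1 + rad l i := by
  obtain ⟨s, h0, h1, hx, hy, hz⟩ := mem_seg h
  have ha := rad_bounds i
  simp only [marked_high] at hx hy hz
  refine ⟨by linarith, by nlinarith, by nlinarith, by linarith⟩

theorem cap_seg2 {l : ℕ} {i : Fin l} {q : E3} (h : q ∈ range (Path.segment
    ((0, 0, 1 + rad l i) : E3) (marked (l + l) (Fin.castAdd l i.rev) 1))) :
    q.2.1 = 0 ∧ 1 ≤ q.2.2 ∧ q.1 ≤ 0 ∧ q.2.2 = 1 + q.1 + rad l i := by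
  obtain ⟨s, h0, h1, hx, hy, hz⟩ := mem_seg h
  have ha := rad_bounds i
  simp only [marked_low] at hx hy hz
  refine ⟨by linarith, by nlinarith, by nlinarith, by linarith⟩

theorem cup_spec {l : ℕ} {i : Fin l} {q : E3} (h : q ∈ range (cup l i)) :
    CupSpec (rad l i) q := by
  rw [cup, Path.trans_range] at h
  rcases h with h | h
  · obtain ⟨h1, h2, h3, h4⟩ := cup_seg1 h
    exact ⟨h1, h2, Or.inl ⟨h3, h4⟩⟩
  · obtain ⟨h1, h2, h3, h4⟩ := cup_seg2 h
    exact ⟨h1, h2, Or.inr ⟨h3, h4⟩⟩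

theorem cap_spec {l : ℕ} {i : Fin l} {q : E3} (h : q ∈ range (cap l i)) :
    CupSpec (rad l i) (flip q) := by
  rw [cap, Path.trans_range] at h
  rcases h with h | h
  · obtain ⟨h1, h2, h3, h4⟩ := cap_seg1 h
    refine ⟨h1, ?_, Or.inr ⟨h3, ?_⟩⟩ <;> simp only [flip] <;> linarith
  · obtain ⟨h1, h2, h3, h4⟩ := cap_seg2 h
    refine ⟨h1, ?_, Or.inl ⟨h3, ?_⟩⟩ <;> simp only [flip] <;> linarith

theorem cup_injective {l : ℕ} (i : Fin l) : Function.Injective (cup l i) := by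
  have ha := rad_bounds i
  refine trans_injective ?_ ?_ ?_
  · exact Path.segment_injective_of_ne (ne_of_height (by simp only [marked]; linarith)).symm
  · exact Path.segment_injective_of_ne (ne_of_height (by simp only [marked]; linarith))
  · intro q h h'
    obtain ⟨h1, -, h3, h4⟩ := cup_seg1 h
    obtain ⟨-, -, h5, -⟩ := cup_seg2 h'
    have hx : q.1 = 0 := le_antisymm h3 h5
    exact Prod.ext hx (Prod.ext h1 (by rw [h4, hx]; simp))

theorem cap_injective {l : ℕ} (i : Fin l) : Function.Injective (cap l i) := by
  have ha := rad_bounds i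
  refine trans_injective ?_ ?_ ?_
  · exact Path.segment_injective_of_ne (ne_of_height (by simp only [marked]; linarith))
  · exact Path.segment_injective_of_ne (ne_of_height (by simp only [marked]; linarith)).symm
  · intro q h h'
    obtain ⟨h1, -, h3, h4⟩ := cap_seg1 h
    obtain ⟨-, -, h5, -⟩ := cap_seg2 h'
    have hx : q.1 = 0 := le_antisymm h5 h3
    exact Prod.ext hx (Prod.ext h1 (by rw [h4, hx]; simp))

theorem cup_cup {a b : ℝ} {q : E3} (h : CupSpec a q) (h' : CupSpec b q) : a = b := by
  obtain ⟨-, -, h⟩ := h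
  obtain ⟨-, -, g⟩ := h'
  rcases h with h | h <;> rcases g with g | g <;> linarith

theorem cup_cap {a b : ℝ} {q : E3} (h : CupSpec a q) (h' : CupSpec b (flip q)) : False := by
  have h1 := h.2.1
  have h2 := h'.2.1
  simp only [flip] at h2
  linarith

theorem cup_strand {l : ℕ} {S : StringLink (l + l)} {k : Fin (l + l)} {b : ℝ} {q : E3}
    (h : CupSpec b q) (hq : q ∈ range (S.strand k)) :
    (pt (l + l) k = b ∨ pt (l + l) k = -b) ∧ q = marked (l + l) k 0 := by
  obtain ⟨-, -, hz, h0, -⟩ := S.mem_bounds hq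
  have hz0 : q.2.2 = 0 := le_antisymm h.2.1 hz.1
  have hq := h0 hz0
  have hx : q.1 = pt (l + l) k := congrArg (fun q => q.1) hq
  refine ⟨?_, hq⟩
  rcases h.2.2 with h | h
  · right; linarith
  · left; linarith

theorem cap_strand {l : ℕ} {S : StringLink (l + l)} {k : Fin (l + l)} {b : ℝ} {q : E3}
    (h : CupSpec b (flip q)) (hq : q ∈ range (S.strand k)) :
    (pt (l + l) k = b ∨ pt (l + l) k = -b) ∧ q = marked (l + l) k 1 := by
  obtain ⟨-, -, hz, -, h1⟩ := S.mem_bounds hq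
  have hz1 : 1 - q.2.2 ≤ 0 := h.2.1
  have hz1 : q.2.2 = 1 := by linarith
  have hq := h1 hz1
  have hx : q.1 = pt (l + l) k := congrArg (fun q => q.1) hq
  refine ⟨?_, hq⟩
  rcases h.2.2 with h | h <;> simp only [flip] at h
  · right; linarith
  · left; linarith

theorem pt_low {l : ℕ} (i : Fin l) : pt (l + l) (Fin.castAdd l i.rev) = -rad l i :=
  pt_castAdd_rev i

theorem pt_high {l : ℕ} (i : Fin l) : pt (l + l) (Fin.natAdd l i) = rad l i := pt_natAdd i

/-- The part of a component of a plat closure which is not in the first half of the strings. -/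
noncomputable def platPath {l : ℕ} (S : StringLink (l + l)) (i : Fin l) :
    Path (marked (l + l) (Fin.castAdd l i.rev) 0) (marked (l + l) (Fin.castAdd l i.rev) 1) :=
  ((cup l i).trans (S.strand (Fin.natAdd l i))).trans (cap l i)

/-- The `i`-th component of `1_l Σ 1_l`: it runs along an arc below `Σ`, upwards along a string of
the second half of `Σ`, along an arc above `Σ`, and downwards along a string of the first half. -/
noncomputable def platLoop {l : ℕ} (S : StringLink (l + l)) (i : Fin l) :
    Path (marked (l + l) (Fin.castAdd l i.rev) 0) (marked (l + l) (Fin.castAdd l i.rev) 0) :=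
  (platPath S i).trans (S.strand (Fin.castAdd l i.rev)).symm

theorem platPath_injective {l : ℕ} (S : StringLink (l + l)) (i : Fin l) :
    Function.Injective (platPath S i) := by
  refine trans_injective (trans_injective (cup_injective i) (S.strand_injective _) ?_)
    (cap_injective i) ?_
  · intro q h h'
    exact (cup_strand (cup_spec h) h').2
  · intro q h h'
    rw [Path.trans_range] at h
    rcases h with h | h
    · exact (cup_cap (cup_spec h) (cap_spec h')).elim
    · exact (cap_strand (cap_spec h') h).2

theorem platPath_range {l : ℕ} (S : StringLink (l + l)) (i : Fin l) :
    range (platPath S i) =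
      (range (cup l i) ∪ range (S.strand (Fin.natAdd l i))) ∪ range (cap l i) := by
  rw [platPath, Path.trans_range, Path.trans_range]

theorem plat_ends {l : ℕ} (S : StringLink (l + l)) (i : Fin l) (q : E3)
    (h : q ∈ range (platPath S i))
    (h' : q ∈ range (S.strand (Fin.castAdd l i.rev)).symm) :
    q = marked (l + l) (Fin.castAdd l i.rev) 0 ∨ q = marked (l + l) (Fin.castAdd l i.rev) 1 := by
  rw [Path.symm_range] at h'
  rw [platPath_range] at h
  rcases h with (h | h) | h
  · exact Or.inl (cup_strand (cup_spec h) h').2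
  · exact absurd (S.eq_of_mem h' h) (castAdd_ne_natAdd _ _)
  · exact Or.inr (cap_strand (cap_spec h) h').2

theorem platLoop_range {l : ℕ} (S : StringLink (l + l)) (i : Fin l) :
    range (platLoop S i) = ((range (cup l i) ∪ range (S.strand (Fin.natAdd l i))) ∪
      range (cap l i)) ∪ range (S.strand (Fin.castAdd l i.rev)) := by
  rw [platLoop, Path.trans_range, platPath_range, Path.symm_range]

theorem plat_disj {l : ℕ} (S : StringLink (l + l)) (i j : Fin l) (q : E3)
    (hi : q ∈ range (platLoop S i)) (hj : q ∈ range (platLoop S j)) : i = j := by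
  have ha := rad_bounds i
  have hb := rad_bounds j
  have ph := pt_high i
  have pl := pt_low i
  have qh := pt_high j
  have ql := pt_low j
  apply rad_injective
  rw [platLoop_range] at hi hj
  rcases hi with ((hi | hi) | hi) | hi
  · have hi := cup_spec hi
    rcases hj with ((hj | hj) | hj) | hj
    · exact cup_cup hi (cup_spec hj)
    · rcases (cup_strand hi hj).1 with h | h <;> linarith
    · exact (cup_cap hi (cap_spec hj)).elim
    · rcases (cup_strand hi hj).1 with h | h <;> linarith
  · rcases hj with ((hj | hj) | hj) | hj
    · rcases (cup_strand (cup_spec hj) hi).1 with h | h <;> linarith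
    · have := S.eq_of_mem hi hj
      rw [this] at ph
      linarith
    · rcases (cap_strand (cap_spec hj) hi).1 with h | h <;> linarith
    · exact absurd (S.eq_of_mem hj hi) (castAdd_ne_natAdd _ _)
  · have hi := cap_spec hi
    rcases hj with ((hj | hj) | hj) | hj
    · exact (cup_cap (cup_spec hj) hi).elim
    · rcases (cap_strand hi hj).1 with h | h <;> linarith
    · exact cup_cup hi (cap_spec hj)
    · rcases (cap_strand hi hj).1 with h | h <;> linarith
  · rcases hj with ((hj | hj) | hj) | hj
    · rcases (cup_strand (cup_spec hj) hi).1 with h | h <;> linarith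
    · exact absurd (S.eq_of_mem hi hj) (castAdd_ne_natAdd _ _)
    · rcases (cap_strand (cap_spec hj) hi).1 with h | h <;> linarith
    · have := S.eq_of_mem hi hj
      rw [this] at pl
      linarith

/-- The closed `l`-component link `1_l Σ 1_l`: the bottom and the top of the `2l`-component string
link `Σ` are closed up by nested planar arcs.  The strings of the first half of `Σ` are run through
downwards and those of the second half upwards; the `i`-th component consists of the strings
`l + 1 - i` and `l + i` of `Σ` (counted from `1`). -/
noncomputable def StringLink.plat {l : ℕ} (S : StringLink (l + l)) : Link l where
  component i := circleMap (platLoop S i)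
  injective := by
    rintro ⟨i, x⟩ ⟨j, y⟩ he
    have he : circleMap (platLoop S i) x = circleMap (platLoop S j) y := he
    obtain rfl : i = j := by
      refine plat_disj S i j (circleMap (platLoop S i) x) ?_ ?_
      · rw [← circleMap_range]; exact mem_range_self _
      · rw [he, ← circleMap_range]; exact mem_range_self _
    obtain ⟨s, hs, rfl⟩ := exists_rep x
    obtain ⟨t, ht, rfl⟩ := exists_rep y
    rw [circleMap_apply _ hs, circleMap_apply _ ht] at he
    rw [trans_loop (platPath_injective S i) (symm_injective (S.strand_injective _))
      (plat_ends S i) hs ht he]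
  polygonal i := by
    rw [circleMap_range, platLoop_range]
    exact (((polygonal_trans (polygonal_seg _ _) (polygonal_seg _ _)).union
      (S.polygonal _)).union (polygonal_trans (polygonal_seg _ _) (polygonal_seg _ _))).union
      (S.polygonal _)

/-! ### The actions of `2l`-component string links, and the closure -/

/-- The right action: the string link `σ S`.  The bottom of `S` is closed up by a `U` which carries
the string link `σ` (drawn on the right leg of the `U`, under the last half of the strings of `S`),
and its top is unbent. -/
noncomputable def StringLink.rightAct {l : ℕ} (σ : StringLink l) (S : StringLink (l + l)) :
    StringLink l := (((StringLink.one l).juxt σ).stack S).bend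

/-- The left action: the string link `S σ`.  The top of `S` is closed up by a cap which carries the
string link `σ` (drawn on the right leg of the cap, above the last half of the strings of `S`), and
its bottom is unbent: the `i`-th string starts at the bottom, runs upwards along the string `l + i`
of `S`, along the `i`-th string of `σ`, and downwards along the string `l + 1 - i` of `S`.  After a
half turn, `StringLink.bend` does this. -/
noncomputable def StringLink.leftAct {l : ℕ} (S : StringLink (l + l)) (σ : StringLink l) :
    StringLink l := (S.stack ((StringLink.one l).juxt σ)).rot.bend

/-- The closed link `σ S σ'`: the bottom of `S` is closed up by a `U` carrying `σ`, and its top by a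
cap carrying `σ'`. -/
noncomputable def StringLink.sandwich {l : ℕ} (σ : StringLink l) (S : StringLink (l + l))
    (σ' : StringLink l) : Link l :=
  ((((StringLink.one l).juxt σ).stack S).stack ((StringLink.one l).juxt σ')).plat

/-- The closure of a string link: its top is joined to its bottom by parallel trivial strings running
around it (on the left), i.e. by the trivial string link put to the left of `σ` together with nested
arcs above and below. -/
noncomputable def StringLink.closure {l : ℕ} (σ : StringLink l) : Link l :=
  ((StringLink.one l).juxt σ).plat

/-! ### Equivalence relations on string links and on links -/

/-- An equivalence relation `E` on string links and on links, for every number of components, which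
is implied by isotopy. -/
structure LinkRelation where
  onStringLinks : ∀ l : ℕ, Setoid (StringLink l)
  onLinks : ∀ l : ℕ, Setoid (Link l)
  stringLink_isotopic : ∀ {l : ℕ} {σ τ : StringLink l}, σ.Isotopic τ → onStringLinks l σ τ
  link_isotopic : ∀ {l : ℕ} {K L : Link l}, K.Isotopic L → onLinks l K L

namespace LinkRelation

variable (E : LinkRelation)

/-- The set `E SL(l)` of `E`-classes of `l`-component string links. -/
def SL (l : ℕ) : Type := Quotient (E.onStringLinks l)

/-- The set `E L(l)` of `E`-classes of `l`-component links. -/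
def L (l : ℕ) : Type := Quotient (E.onLinks l)

/-- The class `E(σ)` of a string link. -/
def cls {l : ℕ} (σ : StringLink l) : E.SL l := Quotient.mk (E.onStringLinks l) σ

/-- The class `E(K)` of a link. -/
def linkCls {l : ℕ} (K : Link l) : E.L l := Quotient.mk (E.onLinks l) K

/-- `E` is local: it is compatible with the closure, with juxtaposition of a trivial string link on
the left, and with the right and left actions. -/
structure IsLocal : Prop where
  closure : ∀ {l : ℕ} {σ₁ σ₂ : StringLink l}, E.cls σ₁ = E.cls σ₂ →
    E.linkCls σ₁.closure = E.linkCls σ₂.closure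
  juxt : ∀ {l : ℕ} {σ₁ σ₂ : StringLink l}, E.cls σ₁ = E.cls σ₂ →
    E.cls ((StringLink.one l).juxt σ₁) = E.cls ((StringLink.one l).juxt σ₂)
  rightAct : ∀ {l : ℕ} {σ₁ σ₂ : StringLink l} {S₁ S₂ : StringLink (l + l)},
    E.cls σ₁ = E.cls σ₂ → E.cls S₁ = E.cls S₂ →
    E.cls (σ₁.rightAct S₁) = E.cls (σ₂.rightAct S₂)
  leftAct : ∀ {l : ℕ} {σ₁ σ₂ : StringLink l} {S₁ S₂ : StringLink (l + l)},
    E.cls σ₁ = E.cls σ₂ → E.cls S₁ = E.cls S₂ →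
    E.cls (S₁.leftAct σ₁) = E.cls (S₂.leftAct σ₂)

/-- The axiom that every string link has a right inverse up to `E`. -/
def HasRightInverses : Prop :=
  ∀ (l : ℕ) (σ : StringLink l), ∃ σ₁ : StringLink l,
    E.cls (σ.stack σ₁) = E.cls (StringLink.one l)

/-- The axiom that the reflection `σ̄` of every string link `σ` is a right inverse of it up to
`E`. -/
def HasReflectionInverses : Prop :=
  ∀ (l : ℕ) (σ : StringLink l), E.cls (σ.stack σ.bar) = E.cls (StringLink.one l)

end LinkRelation

end HL

namespace HL
open Set Filter Topology

/-! ### Homeomorphisms that are monotone along the fibres -/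

/-! The content lies in a handful of isotopies; what follows from them is formal algebra. Stacking
is associative with unit `one` (`stack_assoc`, `stack_one`, `one_stack`). Bending `1 ⊗ σ` gives back
`σ` (`bend_one_juxt`). A bent string link standing on a cup can be pulled straight (`bend_snake`,
and `plat_snake` for closed links). A string link slides along the cups from the right legs to the
left ones, where it arrives after a half turn (`bend_slide`). A half turn of space carries `S.plat`
to `S.rot.plat` (`plat_rot`).

Consequences. Since `σ τ` is isotopic to `σ (1 ⊗ τ)`, axioms (2) and (3) make stacking compatible
with `E`. Since `S.plat` is the closure of `S.bend`, which is `1 S` up to isotopy, axioms (1) and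
(3) make closed links compatible. The snake gives `(σ S) T ≅ σ (S T)`. The slide gives `S σ ≅ σ
S.rot`, which reduces the left action to the right one. For the orbits: put `X = S (1 ⊗ σ)`. The
closure of `S σ` is the plat closure of `X.rot`, hence that of `X`, hence the closure of `1 X ≅ (1
S) σ`, which is equivalent to `σ` if `S` fixes the unit on the right. For equality of the
stabilizers: `S.rot.bend` and `S.bar.bend.bar` have the same strings (`bend_rot`), so `S` fixes the
unit on the left iff `S.bar`, its inverse, fixes it on the right.

Construction of the isotopies. By the Alexander trick (`exists_ambientIsotopy`) it is enough to find
one homeomorphism which is the identity outside the cylinder. A string is an arc with fixed ends, so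
it is enough that it be mapped into the target string (`StringLink.image_eq_of_subset`); a long
detour may simply be crushed into a collar in which the target is vertical, whatever the
parametrization. The homeomorphisms are products of shears, each changing a single coordinate by a
continuous function strictly increasing in that coordinate (`exists_xHomeo`, `exists_zHomeo`).
Maxima and minima preserve strict monotonicity. So one writes the formula wanted on the strings and
clips it between two increasing functions equal to the coordinate outside the allowed region.
Margins and collars (`exists_margin`, `exists_collar`) provide room for constants that make the
clipping inactive on the relevant parts of the strings. For closed links orientation must also be
controlled; it is read off from three points of each component (`Link.Isotopic.of_image`). -/

theorem exists_fiberHomeo {P : Type*} [TopologicalSpace P] (F : P × ℝ → ℝ) (hc : Continuous F)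
    (hm : ∀ p, StrictMono fun t => F (p, t)) (hs : ∀ p, Function.Surjective fun t => F (p, t)) :
    ∃ h : (P × ℝ) ≃ₜ (P × ℝ), ∀ q, h q = (q.1, F q) := by
  choose G hG using hs
  have hG : ∀ p t, F (p, G p t) = t := hG
  refine ⟨{ toFun := fun q => (q.1, F q)
            invFun := fun q => (q.1, G q.1 q.2)
            left_inv := fun q => ?_
            right_inv := fun q => ?_
            continuous_toFun := by fun_prop
            continuous_invFun := ?_ }, fun q => rfl⟩
  · exact Prod.ext rfl ((hm q.1).injective (hG q.1 (F q)))
  · exact Prod.ext rfl (hG q.1 q.2)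
  -- Continuity of the inverse comes from monotonicity: `a < G p t` iff `F (p, a) < t`, an open
  -- condition on `(p, t)`, and likewise with the inequalities reversed.
  · refine continuous_fst.prodMk (continuous_iff_continuousAt.2 fun q => tendsto_order.2 ⟨?_, ?_⟩)
    · intro a ha
      have h1 : F (q.1, a) < q.2 := by rw [← hG q.1 q.2]; exact hm q.1 ha
      have h2 : ∀ᶠ r : P × ℝ in 𝓝 q, F (r.1, a) < r.2 :=
        (isOpen_lt (by fun_prop : Continuous fun r : P × ℝ => F (r.1, a)) continuous_snd).mem_nhds h1
      filter_upwards [h2] with r hr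
      refine (hm r.1).lt_iff_lt.1 ?_
      change F (r.1, a) < F (r.1, G r.1 r.2)
      rwa [hG]
    · intro a ha
      have h1 : q.2 < F (q.1, a) := by rw [← hG q.1 q.2]; exact hm q.1 ha
      have h2 : ∀ᶠ r : P × ℝ in 𝓝 q, r.2 < F (r.1, a) :=
        (isOpen_lt continuous_snd (by fun_prop : Continuous fun r : P × ℝ => F (r.1, a))).mem_nhds h1
      filter_upwards [h2] with r hr
      refine (hm r.1).lt_iff_lt.1 ?_
      change F (r.1, G r.1 r.2) < F (r.1, a)
      rwa [hG]

theorem surjective_of_eq_far {f : ℝ → ℝ} (hc : Continuous f) {N : ℝ}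
    (hN : ∀ x, N ≤ |x| → f x = x) : Function.Surjective f := by
  intro t
  set m := max N (max |t| 1)
  have h1 : N ≤ m := le_max_left _ _
  have h2 : |t| ≤ m := (le_max_left _ _).trans (le_max_right _ _)
  have h3 : 1 ≤ m := (le_max_right _ _).trans (le_max_right _ _)
  have e1 : f m = m := hN m (by rw [abs_of_nonneg (by linarith)]; exact h1)
  have e2 : f (-m) = -m := hN (-m) (by rw [abs_neg, abs_of_nonneg (by linarith)]; exact h1)
  have h4 := abs_le.1 h2
  exact intermediate_value_univ (-m) m hc (show t ∈ Icc (f (-m)) (f m) by rw [e1, e2]; exact h4)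

/-- A homeomorphism of three-space moving points in the `x`-direction. -/
theorem exists_xHomeo (f : E3 → ℝ) (hc : Continuous f)
    (hm : ∀ y z, StrictMono fun x => f (x, y, z)) (N : ℝ)
    (hN : ∀ x y z, N ≤ |x| → f (x, y, z) = x) :
    ∃ h : E3 ≃ₜ E3, ∀ q, h q = (f q, q.2.1, q.2.2) := by
  obtain ⟨h, hh⟩ := exists_fiberHomeo (P := ℝ × ℝ) (fun q => f (q.2, q.1.1, q.1.2)) (by fun_prop)
    (fun p => hm p.1 p.2)
    (fun p => surjective_of_eq_far (N := N) (by fun_prop) (fun x hx => hN x _ _ hx))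
  refine ⟨(Homeomorph.prodComm ℝ (ℝ × ℝ)).trans (h.trans (Homeomorph.prodComm (ℝ × ℝ) ℝ)), ?_⟩
  intro q
  simp [hh]

/-- A homeomorphism of three-space moving points in the `z`-direction. -/
theorem exists_zHomeo (f : E3 → ℝ) (hc : Continuous f)
    (hm : ∀ x y, StrictMono fun z => f (x, y, z)) (N : ℝ)
    (hN : ∀ x y z, N ≤ |z| → f (x, y, z) = z) :
    ∃ h : E3 ≃ₜ E3, ∀ q, h q = (q.1, q.2.1, f q) := by
  obtain ⟨h, hh⟩ := exists_fiberHomeo (P := ℝ × ℝ) (fun q => f (q.1.1, q.1.2, q.2)) (by fun_prop)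
    (fun p => hm p.1 p.2)
    (fun p => surjective_of_eq_far (N := N) (by fun_prop) (fun x hx => hN _ _ x hx))
  refine ⟨(Homeomorph.prodAssoc ℝ ℝ ℝ).symm.trans (h.trans (Homeomorph.prodAssoc ℝ ℝ ℝ)), ?_⟩
  intro q
  rw [Homeomorph.trans_apply, Homeomorph.trans_apply, hh]
  rfl

/-! ### The Alexander trick -/

/-- With `d x = h x - x` this is the conjugate of `h` by the dilation about `c` of ratio `s`,
written so that it makes sense at `s = 0`. Continuity there uses only that `d` is bounded: the
displacement is at most `s * C`. -/
theorem alexander_continuous {d : E3 → E3} (hd : Continuous d) {C : ℝ} (hC : ∀ x, ‖d x‖ ≤ C) (c : E3) :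
    Continuous fun p : unitInterval × E3 =>
      p.2 + (p.1 : ℝ) • d (c + (p.1 : ℝ)⁻¹ • (p.2 - c)) := by
  refine continuous_snd.add (continuous_iff_continuousAt.2 ?_)
  rintro ⟨s, x⟩
  by_cases hs : (s : ℝ) = 0
  · have h0 : Tendsto (fun p : unitInterval × E3 => (p.1 : ℝ) * C) (𝓝 (s, x)) (𝓝 0) := by
      have : Continuous fun p : unitInterval × E3 => (p.1 : ℝ) * C := by fun_prop
      have h := this.tendsto (s, x)
      simpa [hs] using h
    unfold ContinuousAt
    simp only [hs, zero_smul]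
    refine squeeze_zero_norm (fun p => ?_) h0
    rw [norm_smul, Real.norm_of_nonneg p.1.2.1]
    exact mul_le_mul_of_nonneg_left (hC _) p.1.2.1
  · have hf : ContinuousAt (fun p : unitInterval × E3 => (p.1 : ℝ)) (s, x) := by fun_prop
    have hi : ContinuousAt (fun p : unitInterval × E3 => (p.1 : ℝ)⁻¹) (s, x) := hf.inv₀ hs
    refine hf.smul (hd.continuousAt.comp ?_)
    exact continuousAt_const.add (hi.smul (by fun_prop))

/-- For `s ≠ 0` the two formulas are conjugates of `h` and `g` by the same dilation; for `s = 0`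
both displacements vanish. -/
theorem alexander_inverse {h g : E3 → E3} (hg : ∀ x, g (h x) = x) (c : E3) (s : ℝ) (x : E3) :
    (x + s • (h (c + s⁻¹ • (x - c)) - (c + s⁻¹ • (x - c)))) +
      s • (g (c + s⁻¹ • ((x + s • (h (c + s⁻¹ • (x - c)) - (c + s⁻¹ • (x - c)))) - c)) -
        (c + s⁻¹ • ((x + s • (h (c + s⁻¹ • (x - c)) - (c + s⁻¹ • (x - c)))) - c))) = x := by
  by_cases hs : s = 0
  · simp [hs]
  set y := c + s⁻¹ • (x - c) with hy
  have hx : x - c = s • (y - c) := by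
    rw [hy, add_sub_cancel_left, smul_smul, mul_inv_cancel₀ hs, one_smul]
  have e : c + s⁻¹ • ((x + s • (h y - y)) - c) = h y := by
    rw [show (x + s • (h y - y)) - c = s • (h y - c) by
      rw [show h y - c = (y - c) + (h y - y) by abel, smul_add, ← hx]; abel]
    rw [smul_smul, inv_mul_cancel₀ hs, one_smul]; abel
  rw [e, hg, add_assoc, ← smul_add]
  simp

/-- The Alexander trick: a homeomorphism with compact support is the end of an ambient isotopy. -/
theorem exists_ambientIsotopy (h : E3 ≃ₜ E3) {R : ℝ} (hR : ∀ x, R < ‖x‖ → h x = x) (c : E3) :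
    ∃ H : AmbientIsotopy, (∀ x, H.at 1 x = h x) ∧
      ∀ (s : unitInterval) (x : E3),
        h (c + (s : ℝ)⁻¹ • (x - c)) = c + (s : ℝ)⁻¹ • (x - c) → H.at s x = x := by
  have hR' : ∀ x, R < ‖x‖ → h.symm x = x := fun x hx => by
    rw [Homeomorph.symm_apply_eq, hR x hx]
  -- The displacement has compact support, hence is bounded; this is what the continuity at time `0`
  -- requires, for `h` and for its inverse.
  have bound : ∀ g : E3 ≃ₜ E3, (∀ x, R < ‖x‖ → g x = x) → ∃ C, ∀ x, ‖g x - x‖ ≤ C := fun g hg =>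
    Continuous.bounded_above_of_compact_support (f := fun x => g x - x) (by fun_prop)
      (HasCompactSupport.intro (isCompact_closedBall (0 : E3) R) (fun x hx => by
        rw [hg x (by simpa using hx), sub_self]))
  obtain ⟨C, hC⟩ := bound h hR
  obtain ⟨D, hD⟩ := bound h.symm hR'
  refine ⟨{ toHomeo :=
      { toFun := fun p => (p.1, p.2 + (p.1 : ℝ) • (h (c + (p.1 : ℝ)⁻¹ • (p.2 - c)) -
          (c + (p.1 : ℝ)⁻¹ • (p.2 - c))))
        invFun := fun p => (p.1, p.2 + (p.1 : ℝ) • (h.symm (c + (p.1 : ℝ)⁻¹ • (p.2 - c)) -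
          (c + (p.1 : ℝ)⁻¹ • (p.2 - c))))
        left_inv := fun p => Prod.ext rfl (alexander_inverse h.symm_apply_apply c p.1 p.2)
        right_inv := fun p => Prod.ext rfl (alexander_inverse h.apply_symm_apply c p.1 p.2)
        continuous_toFun := continuous_fst.prodMk
          (alexander_continuous (d := fun x => h x - x) (by fun_prop) hC c)
        continuous_invFun := continuous_fst.prodMk
          (alexander_continuous (d := fun x => h.symm x - x) (by fun_prop) hD c) }
            level := fun p => rfl
            start := fun x => by simp }, fun x => ?_, fun s x hx => ?_⟩
  · simp [AmbientIsotopy.at]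
  · simp [AmbientIsotopy.at, hx]

/-! ### Arcs -/

/-- An injective continuous map from a compact space to a Hausdorff one is a closed embedding, so
the set-theoretic lift is continuous. -/
theorem exists_reparam {X : Type*} [TopologicalSpace X] [CompactSpace X] {Y : Type*} [TopologicalSpace Y]
    [T2Space Y] {Z : Type*} [TopologicalSpace Z] {f : Z → Y} {g : X → Y} (hf : Continuous f)
    (hg : Continuous g) (hi : Function.Injective g) (h : range f ⊆ range g) :
    ∃ φ : Z → X, Continuous φ ∧ ∀ z, g (φ z) = f z := by
  choose φ hφ using fun z => h (mem_range_self z)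
  refine ⟨φ, ?_, hφ⟩
  rw [(hg.isClosedEmbedding hi).isInducing.continuous_iff]
  convert hf using 1
  funext z
  exact hφ z

/-- An arc which is contained in another one with the same ends is equal to it. -/
theorem arc_eq_of_subset {Y : Type*} [TopologicalSpace Y] [T2Space Y] {a b : Y} (γ γ' : Path a b)
    (hi : Function.Injective γ') (h : range γ ⊆ range γ') : range γ = range γ' := by
  obtain ⟨φ, hc, hφ⟩ := exists_reparam γ.continuous γ'.continuous hi h
  -- The lift to the parameter interval fixes both ends, so it is onto by the intermediate value
  -- theorem.
  have h0 : φ 0 = 0 := hi (by rw [hφ]; simp)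
  have h1 : φ 1 = 1 := hi (by rw [hφ]; simp)
  refine h.antisymm ?_
  rintro _ ⟨t, rfl⟩
  obtain ⟨s, rfl⟩ := intermediate_value_univ 0 1 hc
    (show t ∈ Icc (φ 0) (φ 1) by rw [h0, h1]; exact ⟨t.2.1, t.2.2⟩)
  exact ⟨s, (hφ s).symm⟩

/-! ### Homeomorphisms of the cylinder rel boundary -/

namespace StringLink

/-- A homeomorphism of the cylinder rel boundary takes the strings of `σ` to those of `τ`. -/
def HomeoEq {n : ℕ} (σ τ : StringLink n) : Prop :=
  ∃ h : E3 ≃ₜ E3, (∀ x, x ∉ cylinderInterior → h x = x) ∧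
    ∀ i, ∀ q ∈ range (σ.strand i), h q ∈ range (τ.strand i)

theorem marked_notMem {n : ℕ} (i : Fin n) (z : ℝ) (hz : z ≤ 0 ∨ 1 ≤ z) :
    marked n i z ∉ cylinderInterior := by
  rintro ⟨-, -, h1, h2⟩
  simp only [marked] at h1 h2
  rcases hz with hz | hz <;> linarith

/-- The image is an arc with the ends of the target string, and an arc contained in another arc with
the same ends fills it. This is why `HomeoEq` asks only for containment. -/
theorem image_eq_of_subset {n : ℕ} {σ τ : StringLink n} (h : E3 ≃ₜ E3)
    (hc : ∀ x, x ∉ cylinderInterior → h x = x) {i : Fin n}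
    (hi : ∀ q ∈ range (σ.strand i), h q ∈ range (τ.strand i)) :
    h '' range (σ.strand i) = range (τ.strand i) := by
  have e0 := hc _ (marked_notMem i 0 (Or.inl le_rfl))
  have e1 := hc _ (marked_notMem i 1 (Or.inr le_rfl))
  rw [← mapPath_range (σ.strand i) h.continuous e0.symm e1.symm]
  refine arc_eq_of_subset _ _ (τ.strand_injective i) ?_
  rw [mapPath_range]
  rintro _ ⟨q, hq, rfl⟩
  exact hi q hq

/-- The open cylinder is convex and contains `(0, 0, 1/2)`, so dilating away from this centre keeps
exterior points outside. Hence the Alexander isotopy stays fixed on the exterior at all times. -/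
theorem cylinder_scale {s : ℝ} (hs : s ∈ unitInterval) {x : E3} (hx : x ∉ cylinderInterior)
    (h0 : s ≠ 0) : ((0, 0, 1 / 2) : E3) + s⁻¹ • (x - (0, 0, 1 / 2)) ∉ cylinderInterior := by
  have hs0 : 0 < s := lt_of_le_of_ne hs.1 (Ne.symm h0)
  have hs1 := hs.2
  contrapose! hx
  obtain ⟨⟨a1, a2⟩, ⟨b1, b2⟩, c1, c2⟩ := hx
  simp only [Prod.fst_add, Prod.snd_add, Prod.smul_fst, Prod.smul_snd, Prod.fst_sub, Prod.snd_sub,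
    smul_eq_mul, zero_add, sub_zero] at a1 a2 b1 b2 c1 c2
  have key : ∀ w : ℝ, w = s * (s⁻¹ * w) := fun w => by rw [← mul_assoc, mul_inv_cancel₀ h0, one_mul]
  have k1 := key x.1
  have k2 := key x.2.1
  have k3 := key (x.2.2 - 1 / 2)
  set u := s⁻¹ * x.1
  set v := s⁻¹ * x.2.1
  set w := s⁻¹ * (x.2.2 - 1 / 2)
  refine ⟨⟨?_, ?_⟩, ⟨?_, ?_⟩, ?_, ?_⟩ <;> nlinarith

theorem HomeoEq.isotopic {n : ℕ} {σ τ : StringLink n} (h : σ.HomeoEq τ) : σ.Isotopic τ := by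
  obtain ⟨h, hc, hi⟩ := h
  -- The norm of `E3` is the sup norm, so the cylinder lies in the unit ball.
  obtain ⟨H, H1, Hs⟩ := exists_ambientIsotopy h (R := 1) (fun x hx => hc x (fun hm => by
    obtain ⟨⟨a1, a2⟩, ⟨b1, b2⟩, c1, c2⟩ := hm
    have : ‖x‖ ≤ 1 := by
      rw [Prod.norm_def, Prod.norm_def]
      refine max_le (abs_le.2 ⟨a1.le, a2.le⟩) (max_le (abs_le.2 ⟨b1.le, b2.le⟩) (abs_le.2 ⟨by linarith, c2.le⟩))
    linarith)) (0, 0, 1 / 2)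
  refine ⟨H, fun s x hx => ?_, fun i => ?_⟩
  · by_cases hs : (s : ℝ) = 0
    · have : s = 0 := Subtype.ext hs
      rw [this]; simp [AmbientIsotopy.at, H.start]
    · exact Hs s x (hc _ (cylinder_scale s.2 hx hs))
  · rw [← image_eq_of_subset h hc (hi i)]
    exact image_congr fun x _ => H1 x

theorem HomeoEq.of_range {n : ℕ} {σ τ : StringLink n} (h : ∀ i, range (σ.strand i) = range (τ.strand i)) :
    σ.HomeoEq τ := ⟨Homeomorph.refl _, fun _ _ => rfl, fun i _ hq => h i ▸ hq⟩

theorem HomeoEq.trans {n : ℕ} {σ τ ρ : StringLink n} (h : σ.HomeoEq τ) (h' : τ.HomeoEq ρ) : σ.HomeoEq ρ := by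
  obtain ⟨f, hf, hf'⟩ := h
  obtain ⟨g, hg, hg'⟩ := h'
  refine ⟨f.trans g, fun x hx => ?_, fun i q hq => hg' i _ (hf' i q hq)⟩
  rw [Homeomorph.trans_apply, hf x hx, hg x hx]

theorem HomeoEq.symm {n : ℕ} {σ τ : StringLink n} (h : σ.HomeoEq τ) : τ.HomeoEq σ := by
  obtain ⟨f, hf, hf'⟩ := h
  refine ⟨f.symm, fun x hx => by rw [Homeomorph.symm_apply_eq, hf x hx], fun i q hq => ?_⟩
  rw [← image_eq_of_subset f hf (hf' i)] at hq
  obtain ⟨p, hp, rfl⟩ := hq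
  rwa [f.symm_apply_apply]

end StringLink

/-! ### Membership criteria for segments, arcs, cups and trivial strings -/

theorem seg_mem {a b q : E3} {s : ℝ} (h0 : 0 ≤ s) (h1 : s ≤ 1) (hx : q.1 = (1 - s) * a.1 + s * b.1)
    (hy : q.2.1 = (1 - s) * a.2.1 + s * b.2.1) (hz : q.2.2 = (1 - s) * a.2.2 + s * b.2.2) :
    q ∈ range (Path.segment a b) := by
  rw [Path.range_segment, segment_eq_image]
  exact ⟨s, ⟨h0, h1⟩, Prod.ext (by simp [hx]) (Prod.ext (by simp [hy]) (by simp [hz]))⟩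

theorem mem_arc_iff {l : ℕ} {i : Fin l} {q : E3} : q ∈ range (arc l i) ↔ ArcSpec (off l i) q := by
  refine ⟨arc_spec, ?_⟩
  rintro ⟨hy, hx, h⟩
  have ha := (off_bounds i).1
  rw [arc, Path.trans_range]
  rcases h with ⟨hz, h⟩ | ⟨hz, h⟩
  · refine Or.inl (seg_mem (s := q.1 / off l i) (by positivity) ?_ ?_ ?_ ?_)
    · rw [div_le_one ha]; linarith
    · simp; field_simp
    · simpa using hy
    · simp only; field_simp; rw [h]; ring
  · refine Or.inr (seg_mem (s := 1 - q.1 / off l i) ?_ ?_ ?_ ?_ ?_)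
    · rw [sub_nonneg, div_le_one ha]; linarith
    · rw [sub_le_self_iff]; positivity
    · simp; field_simp
    · simpa using hy
    · simp only; field_simp; rw [h]; ring

theorem mem_cup_iff {l : ℕ} {i : Fin l} {q : E3} : q ∈ range (cup l i) ↔ CupSpec (rad l i) q := by
  refine ⟨cup_spec, ?_⟩
  rintro ⟨hy, hz, h⟩
  have ha := (rad_bounds i).1
  rw [cup, Path.trans_range, marked_low, marked_high]
  rcases h with ⟨hx, h⟩ | ⟨hx, h⟩
  · refine Or.inl (seg_mem (s := -q.2.2 / rad l i) (div_nonneg (by linarith) ha.le) ?_ ?_ ?_ ?_)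
    · rw [div_le_one ha]; linarith
    · simp only; field_simp; rw [h]; ring
    · simpa using hy
    · simp only; field_simp; ring
  · refine Or.inr (seg_mem (s := 1 + q.2.2 / rad l i) ?_ ?_ ?_ ?_ ?_)
    · have : -1 ≤ q.2.2 / rad l i := by rw [le_div_iff₀ ha]; linarith
      linarith
    · have : q.2.2 / rad l i ≤ 0 := div_nonpos_of_nonpos_of_nonneg hz ha.le
      linarith
    · simp only; field_simp; rw [h]; ring
    · simpa using hy
    · simp only; field_simp; ring

theorem mem_one_iff {n : ℕ} {i : Fin n} {q : E3} :
    q ∈ range ((StringLink.one n).strand i) ↔ ∃ s : ℝ, 0 ≤ s ∧ s ≤ 1 ∧ q = marked n i s := by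
  refine ⟨mem_vertical, ?_⟩
  rintro ⟨s, h0, h1, rfl⟩
  exact seg_mem h0 h1 (by simp only [marked]; ring) (by simp only [marked]; ring)
    (by simp only [marked]; ring)

/-! ### Ranges of the strings of composite string links -/

theorem stack_range {n : ℕ} (σ τ : StringLink n) (i : Fin n) : range ((σ.stack τ).strand i) =
    lowerHalf '' range (σ.strand i) ∪ upperHalf '' range (τ.strand i) := stackStrand_range σ τ i

theorem juxt_range_left {l : ℕ} (σ τ : StringLink l) (i : Fin l) :
    range ((σ.juxt τ).strand (Fin.castAdd l i)) = leftHalf '' range (σ.strand i) := by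
  rw [← range_comp, ← juxtStrand_left σ τ]; rfl

theorem juxt_range_right {l : ℕ} (σ τ : StringLink l) (i : Fin l) :
    range ((σ.juxt τ).strand (Fin.natAdd l i)) = rightHalf '' range (τ.strand i) := by
  rw [← range_comp, ← juxtStrand_right σ τ]; rfl

theorem rot_range {n : ℕ} (σ : StringLink n) (i : Fin n) :
    range (σ.rot.strand i) = turn '' range (σ.strand i.rev) := by
  change range (rotStrand σ i) = _
  rw [rotStrand, mapPath_range, Path.symm_range]

theorem bar_range {n : ℕ} (σ : StringLink n) (i : Fin n) :
    range (σ.bar.strand i) = flip '' range (σ.strand i) := by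
  change range (barStrand σ i) = _
  rw [barStrand, mapPath_range, Path.symm_range]

theorem bend_range {l : ℕ} (S : StringLink (l + l)) (i : Fin l) :
    range (S.bend.strand i) = (((range (tail l i) ∪
      place '' range (S.strand (Fin.castAdd l i.rev))) ∪ range (arc l i)) ∪
      place '' range (S.strand (Fin.natAdd l i))) ∪ flip '' range (tail l i) := bendStrand_range S i

theorem rev_castAdd {l : ℕ} (i : Fin l) : (Fin.castAdd l i).rev = Fin.natAdd l i.rev := by
  apply Fin.ext
  simp only [Fin.val_rev, Fin.val_castAdd, Fin.val_natAdd]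
  omega

theorem rev_natAdd {l : ℕ} (i : Fin l) : (Fin.natAdd l i).rev = Fin.castAdd l i.rev := by
  apply Fin.ext
  simp only [Fin.val_rev, Fin.val_castAdd, Fin.val_natAdd]
  omega

/-! ### Identities between string links that hold for the ranges of the strings -/

namespace StringLink

/-- The strings of `σ` and `τ` have the same ranges. -/
def RangeEq {n : ℕ} (σ τ : StringLink n) : Prop := ∀ i, range (σ.strand i) = range (τ.strand i)

namespace RangeEq

theorem symm {n : ℕ} {σ τ : StringLink n} (h : σ.RangeEq τ) : τ.RangeEq σ := fun i => (h i).symm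

theorem trans {n : ℕ} {σ τ ρ : StringLink n} (h : σ.RangeEq τ) (h' : τ.RangeEq ρ) : σ.RangeEq ρ :=
  fun i => (h i).trans (h' i)

theorem refl {n : ℕ} (σ : StringLink n) : σ.RangeEq σ := fun _ => rfl

theorem stack {n : ℕ} {σ σ' τ τ' : StringLink n} (h : σ.RangeEq σ') (h' : τ.RangeEq τ') :
    (σ.stack τ).RangeEq (σ'.stack τ') := fun i => by
  rw [stack_range, stack_range, h i, h' i]

theorem juxt {l : ℕ} {σ σ' τ τ' : StringLink l} (h : σ.RangeEq σ') (h' : τ.RangeEq τ') :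
    (σ.juxt τ).RangeEq (σ'.juxt τ') := fun k => by
  induction k using Fin.addCases with
  | left i => rw [juxt_range_left, juxt_range_left, h i]
  | right i => rw [juxt_range_right, juxt_range_right, h' i]

theorem bend {l : ℕ} {S S' : StringLink (l + l)} (h : S.RangeEq S') : S.bend.RangeEq S'.bend :=
  fun i => by rw [bend_range, bend_range, h, h]

theorem homeoEq {n : ℕ} {σ τ : StringLink n} (h : σ.RangeEq τ) : σ.HomeoEq τ := HomeoEq.of_range h

end RangeEq

theorem one_stack_one (n : ℕ) : ((one n).stack (one n)).RangeEq (one n) := fun i => by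
  rw [stack_range]
  ext q
  rw [mem_one_iff]
  constructor
  · rintro (⟨p, hp, rfl⟩ | ⟨p, hp, rfl⟩) <;> obtain ⟨s, h0, h1, rfl⟩ := mem_one_iff.1 hp
    · exact ⟨s / 2, by linarith, by linarith, rfl⟩
    · exact ⟨(s + 1) / 2, by linarith, by linarith, rfl⟩
  · rintro ⟨s, h0, h1, rfl⟩
    rcases le_total s (1 / 2) with h | h
    · exact Or.inl ⟨marked n i (2 * s), mem_one_iff.2 ⟨2 * s, by linarith, by linarith, rfl⟩, by
        simp [lowerHalf, marked]⟩
    · exact Or.inr ⟨marked n i (2 * s - 1), mem_one_iff.2 ⟨2 * s - 1, by linarith, by linarith, rfl⟩,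
        by simp [upperHalf, marked]⟩

theorem one_juxt_one (l : ℕ) : ((one l).juxt (one l)).RangeEq (one (l + l)) := fun k => by
  induction k using Fin.addCases with
  | left i =>
    rw [juxt_range_left]
    ext q
    rw [mem_one_iff]
    constructor
    · rintro ⟨p, hp, rfl⟩
      obtain ⟨s, h0, h1, rfl⟩ := mem_one_iff.1 hp
      exact ⟨s, h0, h1, (leftHalf_marked i s).symm⟩
    · rintro ⟨s, h0, h1, rfl⟩
      exact ⟨_, mem_one_iff.2 ⟨s, h0, h1, rfl⟩, (leftHalf_marked i s).symm⟩
  | right i =>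
    rw [juxt_range_right]
    ext q
    rw [mem_one_iff]
    constructor
    · rintro ⟨p, hp, rfl⟩
      obtain ⟨s, h0, h1, rfl⟩ := mem_one_iff.1 hp
      exact ⟨s, h0, h1, (rightHalf_marked i s).symm⟩
    · rintro ⟨s, h0, h1, rfl⟩
      exact ⟨_, mem_one_iff.2 ⟨s, h0, h1, rfl⟩, (rightHalf_marked i s).symm⟩

/-- The interchange law: the halving maps in the directions `x` and `z` commute. -/
theorem juxt_stack_juxt {l : ℕ} (α β σ τ : StringLink l) :
    ((α.juxt σ).stack (β.juxt τ)).RangeEq ((α.stack β).juxt (σ.stack τ)) := fun k => by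
  induction k using Fin.addCases with
  | left i =>
    rw [stack_range, juxt_range_left, juxt_range_left, juxt_range_left, stack_range, image_union]
    simp only [image_image]
    rfl
  | right i =>
    rw [stack_range, juxt_range_right, juxt_range_right, juxt_range_right, stack_range, image_union]
    simp only [image_image]
    rfl

theorem one_juxt_stack {l : ℕ} (σ τ : StringLink l) :
    (((one l).juxt σ).stack ((one l).juxt τ)).RangeEq ((one l).juxt (σ.stack τ)) :=
  (juxt_stack_juxt _ _ _ _).trans ((one_stack_one l).juxt (RangeEq.refl _))

theorem rot_stack {n : ℕ} (σ τ : StringLink n) :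
    (σ.stack τ).rot.RangeEq (τ.rot.stack σ.rot) := fun i => by
  rw [rot_range, stack_range, stack_range, rot_range, rot_range, image_union, union_comm]
  simp only [image_image]
  congr 1 <;> refine image_congr fun q _ => ?_ <;> simp only [turn, lowerHalf, upperHalf]
  · rw [Prod.mk.injEq, Prod.mk.injEq]; exact ⟨rfl, rfl, by ring⟩
  · rw [Prod.mk.injEq, Prod.mk.injEq]; exact ⟨rfl, rfl, by ring⟩

theorem rot_juxt {l : ℕ} (σ τ : StringLink l) : (σ.juxt τ).rot.RangeEq (τ.rot.juxt σ.rot) := fun k => by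
  induction k using Fin.addCases with
  | left i =>
    rw [rot_range, rev_castAdd, juxt_range_right, juxt_range_left, rot_range]
    simp only [image_image]
    refine image_congr fun q _ => ?_
    simp only [turn, leftHalf, rightHalf]
    rw [Prod.mk.injEq]; exact ⟨by ring, rfl⟩
  | right i =>
    rw [rot_range, rev_natAdd, juxt_range_left, juxt_range_right, rot_range]
    simp only [image_image]
    refine image_congr fun q _ => ?_
    simp only [turn, leftHalf, rightHalf]
    rw [Prod.mk.injEq]; exact ⟨by ring, rfl⟩

theorem rot_one (n : ℕ) : (one n).rot.RangeEq (one n) := fun i => by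
  rw [rot_range]
  ext q
  rw [mem_one_iff]
  constructor
  · rintro ⟨p, hp, rfl⟩
    obtain ⟨s, h0, h1, rfl⟩ := mem_one_iff.1 hp
    exact ⟨1 - s, by linarith, by linarith, by simp [turn, marked, pt_rev]⟩
  · rintro ⟨s, h0, h1, rfl⟩
    exact ⟨_, mem_one_iff.2 ⟨1 - s, by linarith, by linarith, rfl⟩, by simp [turn, marked, pt_rev]⟩

theorem flip_image_arc {l : ℕ} (i : Fin l) : flip '' range (arc l i) = range (arc l i) := by
  ext q
  constructor
  · rintro ⟨p, hp, rfl⟩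
    exact mem_arc_iff.2 (flip_arc (arc_spec hp))
  · intro hq
    exact ⟨flip q, mem_arc_iff.2 (flip_arc (arc_spec hq)), flip_flip q⟩

/-- `flip ∘ place ∘ flip = place ∘ turn`; moreover `flip` preserves the arcs and exchanges the tails
at the bottom with those at the top. This identity is what relates the two stabilizers under the
reflection axiom. -/
theorem bend_rot {l : ℕ} (S : StringLink (l + l)) : S.rot.bend.RangeEq S.bar.bend.bar := fun i => by
  have e : ∀ q, flip (place (flip q)) = place (turn q) := fun q => by
    simp only [flip, place, turn]
    rw [Prod.mk.injEq, Prod.mk.injEq]; exact ⟨rfl, rfl, by ring⟩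
  rw [bar_range, bend_range, bend_range, rot_range, rot_range, bar_range, bar_range, rev_castAdd,
    rev_natAdd, Fin.rev_rev]
  simp only [image_union, flip_image_arc, image_image, e, flip_flip, image_id']
  ext q
  simp only [mem_union]
  tauto

end StringLink

/-! ### Margins and collars -/

/-- The union of the strings is compact and lies strictly inside the lateral walls. The margin
measures the room left for interpolating to the identity. -/
theorem exists_margin {n : ℕ} (σ : StringLink n) : ∃ δ : ℝ, 0 < δ ∧ δ < 1 ∧
    ∀ i, ∀ q ∈ range (σ.strand i), |q.1| ≤ 1 - δ ∧ |q.2.1| ≤ 1 - δ := by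
  have hc : IsCompact (⋃ i, range (σ.strand i)) :=
    isCompact_iUnion fun i => isCompact_range (σ.strand i).continuous
  rcases (⋃ i, range (σ.strand i)).eq_empty_or_nonempty with h | h
  · refine ⟨1 / 2, by norm_num, by norm_num, fun i q hq => ?_⟩
    exact absurd (mem_iUnion.2 ⟨i, hq⟩) (h ▸ notMem_empty q)
  · obtain ⟨p, hp, hmax⟩ := hc.exists_isMaxOn h
      (f := fun q : E3 => max |q.1| |q.2.1|) (by fun_prop)
    obtain ⟨j, hj⟩ := mem_iUnion.1 hp
    obtain ⟨h1, h2, -⟩ := σ.mem_bounds hj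
    have hm : max |p.1| |p.2.1| < 1 := max_lt (abs_lt.2 h1) (abs_lt.2 h2)
    refine ⟨(1 - max |p.1| |p.2.1|) / 2, by linarith, ?_, fun i q hq => ?_⟩
    · have := le_max_left |p.1| |p.2.1|
      have := abs_nonneg p.1
      linarith
    · have h3 : max |q.1| |q.2.1| ≤ max |p.1| |p.2.1| := hmax (mem_iUnion.2 ⟨i, hq⟩)
      have := le_max_left |q.1| |q.2.1|
      have := le_max_right |q.1| |q.2.1|
      constructor <;> linarith

/-- Besides verticality near the ends this gives the converse: every point of the vertical segments
in the collars is on the string. It is used each time a piece of string is crushed into a collar. -/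
theorem exists_collar {n : ℕ} (σ : StringLink n) : ∃ ε : ℝ, 0 < ε ∧ ε < 1 / 2 ∧
    (∀ i, ∀ q ∈ range (σ.strand i), (q.2.2 ≤ ε ∨ 1 - ε ≤ q.2.2) → q.1 = pt n i ∧ q.2.1 = 0) ∧
    ∀ i z, 0 ≤ z → z ≤ 1 → (z ≤ ε ∨ 1 - ε ≤ z) → marked n i z ∈ range (σ.strand i) := by
  obtain ⟨ε, hε, h⟩ := σ.vertical
  have hm : min ε (1 / 4) ≤ ε := min_le_left _ _
  have h1 : ∀ i, ∀ q ∈ range (σ.strand i), (q.2.2 ≤ min ε (1 / 4) ∨ 1 - min ε (1 / 4) ≤ q.2.2) →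
      q.1 = pt n i ∧ q.2.1 = 0 := fun i q hq hz => h i q hq
        (hz.imp (fun hz => hz.trans hm) (fun hz => by linarith))
  refine ⟨min ε (1 / 4), by positivity, (min_le_right _ _).trans_lt (by norm_num), h1, ?_⟩
  intro i z h0 hz1 hz
  -- The height runs from `0` to `1` along a string, so it takes the value `z`; verticality then
  -- identifies the point.
  obtain ⟨t, ht⟩ := intermediate_value_univ 0 1
    (by fun_prop : Continuous fun t => (σ.strand i t).2.2)
    (show z ∈ Icc (σ.strand i 0).2.2 (σ.strand i 1).2.2 by
      rw [Path.source, Path.target]; exact ⟨h0, hz1⟩)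
  have ht : (σ.strand i t).2.2 = z := ht
  obtain ⟨hx, hy⟩ := h1 i _ (mem_range_self t) (by rwa [ht])
  exact ⟨t, Prod.ext hx (Prod.ext hy ht)⟩

/-! ### Vertical reparametrization -/

theorem max_min_eq {b t f : ℝ} (h1 : b ≤ f) (h2 : f ≤ t) : max b (min t f) = f := by
  rw [min_eq_right h2, max_eq_right h1]

/-- Clipping is how the boundary is kept fixed: `b` and `t` will enclose the coordinate and agree
with it outside the allowed region, while `f` is the map wanted on the strings. -/
theorem strictMono_clip {b t f : ℝ → ℝ} (hb : StrictMono b) (ht : StrictMono t)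
    (hf : StrictMono f) : StrictMono fun x => max (b x) (min (t x) (f x)) :=
  fun _ _ h => max_lt_max (hb h) (min_lt_min (ht h) (hf h))

namespace StringLink

/-- The change of height by `F` is clipped to `[z - w, z + w]`, where `w` vanishes outside the
lateral walls and is at least `1` on the strings, because of the factor `δ⁻¹`. As `F` maps `[0, 1]`
to itself, it moves no height of a string by more than `1`, so nothing is clipped there. -/
theorem HomeoEq.of_vertical {n : ℕ} {σ τ : StringLink n} (F : ℝ → ℝ) (hc : Continuous F)
    (hm : StrictMono F) (h0 : ∀ z ≤ 0, F z = z) (h1 : ∀ z, 1 ≤ z → F z = z)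
    (h : ∀ i, ∀ q ∈ range (σ.strand i), (q.1, q.2.1, F q.2.2) ∈ range (τ.strand i)) :
    σ.HomeoEq τ := by
  obtain ⟨δ, hδ, hδ1, hmar⟩ := exists_margin σ
  let w : E3 → ℝ := fun q => δ⁻¹ * max 0 (min (1 - |q.1|) (1 - |q.2.1|))
  have hw0 : ∀ q, 0 ≤ w q := fun q => mul_nonneg (by positivity) (le_max_left _ _)
  have hF : ∀ z, 0 ≤ z → z ≤ 1 → 0 ≤ F z ∧ F z ≤ 1 := fun z hz hz1 =>
    ⟨by rw [← h0 0 le_rfl]; exact hm.monotone hz, by rw [← h1 1 le_rfl]; exact hm.monotone hz1⟩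
  obtain ⟨f, hf⟩ := exists_zHomeo
    (fun q => max (q.2.2 - w q) (min (q.2.2 + w q) (F q.2.2))) (by fun_prop)
    (fun x y => strictMono_clip (b := fun z => z - w (x, y, z)) (t := fun z => z + w (x, y, z))
      (fun a b hab => by simpa [w] using hab) (fun a b hab => by simpa [w] using hab) hm) 1
    (fun x y z hz => by
      have : F z = z := by
        rcases le_abs.1 hz with hz | hz
        · exact h1 z hz
        · exact h0 z (by linarith)
      have := hw0 (x, y, z)
      simp only [‹F z = z›]
      exact max_min_eq (by linarith) (by linarith))
  refine ⟨f, fun q hq => ?_, fun i q hq => ?_⟩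
  · rw [hf]
    refine Prod.ext rfl (Prod.ext rfl ?_)
    simp only
    by_cases hz : 0 < q.2.2 ∧ q.2.2 < 1
    · have hw : w q = 0 := by
        have : min (1 - |q.1|) (1 - |q.2.1|) ≤ 0 := by
          by_contra hcon
          rw [not_le, lt_min_iff, sub_pos, sub_pos, abs_lt, abs_lt] at hcon
          exact hq ⟨hcon.1, hcon.2, hz⟩
        simp only [w, max_eq_left this, mul_zero]
      rw [hw, sub_zero, add_zero]
      rcases le_total q.2.2 (F q.2.2) with h | h
      · rw [min_eq_left h, max_self]
      · rw [min_eq_right h, max_eq_left h]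
    · have : F q.2.2 = q.2.2 := by
        rw [not_and_or, not_lt, not_lt] at hz
        exact hz.elim (h0 _) (h1 _)
      have := hw0 q
      rw [‹F q.2.2 = q.2.2›]
      exact max_min_eq (by linarith) (by linarith)
  · obtain ⟨hx, hy⟩ := hmar i q hq
    obtain ⟨-, -, ⟨hz0, hz1⟩, -⟩ := σ.mem_bounds hq
    have hw : 1 ≤ w q := by
      have : δ ≤ max 0 (min (1 - |q.1|) (1 - |q.2.1|)) :=
        le_max_of_le_right (le_min (by linarith) (by linarith))
      calc (1 : ℝ) = δ⁻¹ * δ := (inv_mul_cancel₀ hδ.ne').symm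
        _ ≤ w q := mul_le_mul_of_nonneg_left this (by positivity)
    obtain ⟨hF0, hF1⟩ := hF _ hz0 hz1
    rw [hf, max_min_eq (by linarith) (by linarith)]
    exact h i q hq

theorem stack_assoc {n : ℕ} (σ τ ρ : StringLink n) :
    ((σ.stack τ).stack ρ).HomeoEq (σ.stack (τ.stack ρ)) := by
  -- The piecewise linear map with `1/4 ↦ 1/2` and `1/2 ↦ 3/4`, which exchanges the two subdivisions
  -- of the interval into three.
  refine HomeoEq.of_vertical (fun z => max z (min (2 * z) (min (z + 1 / 4) ((z + 1) / 2))))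
    (by fun_prop) (fun a b hab => ?_) (fun z hz => ?_) (fun z hz => ?_) (fun i q hq => ?_)
  · exact max_lt_max hab (min_lt_min (by linarith) (min_lt_min (by linarith) (by linarith)))
  · exact max_eq_left ((min_le_left _ _).trans (by linarith))
  · exact max_eq_left ((min_le_right _ _).trans ((min_le_right _ _).trans (by linarith)))
  · simp only [stack_range, image_union] at hq ⊢
    rcases hq with (⟨_, ⟨p, hp, rfl⟩, rfl⟩ | ⟨_, ⟨p, hp, rfl⟩, rfl⟩) | ⟨p, hp, rfl⟩
    · obtain ⟨-, -, ⟨hz0, hz1⟩, -⟩ := σ.mem_bounds hp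
      refine Or.inl ⟨p, hp, ?_⟩
      simp only [lowerHalf]
      rw [min_eq_left (by apply le_min <;> linarith), max_eq_right (by linarith)]
      ring_nf
    · obtain ⟨-, -, ⟨hz0, hz1⟩, -⟩ := τ.mem_bounds hp
      refine Or.inr (Or.inl ⟨_, ⟨p, hp, rfl⟩, ?_⟩)
      simp only [lowerHalf, upperHalf]
      rw [min_eq_left (by linarith : (p.2.2 + 1) / 2 / 2 + 1 / 4 ≤ _), min_eq_right (by linarith),
        max_eq_right (by linarith)]
      ring_nf
    · obtain ⟨-, -, ⟨hz0, hz1⟩, -⟩ := ρ.mem_bounds hp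
      refine Or.inr (Or.inr ⟨_, ⟨p, hp, rfl⟩, ?_⟩)
      simp only [upperHalf]
      rw [min_eq_right (by linarith : ((p.2.2 + 1) / 2 + 1) / 2 ≤ _), min_eq_right (by linarith),
        max_eq_right (by linarith)]

theorem stack_one {n : ℕ} (σ : StringLink n) : (σ.stack (one n)).HomeoEq σ := by
  obtain ⟨ε, hε, hε1, hv, hm⟩ := exists_collar σ
  -- Heights are doubled until the line of slope `ε` through `(1, 1)` is met; everything above is
  -- squeezed into the top collar of `σ`, where the strings are vertical anyway.
  refine HomeoEq.of_vertical (fun z => max z (min (2 * z) (1 - ε * (1 - z))))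
    (by fun_prop) (fun a b hab => ?_) (fun z hz => ?_) (fun z hz => ?_) (fun i q hq => ?_)
  · exact max_lt_max hab (min_lt_min (by linarith) (by nlinarith))
  · exact max_eq_left ((min_le_left _ _).trans (by linarith))
  · exact max_eq_left ((min_le_right _ _).trans (by nlinarith))
  · rw [stack_range] at hq
    rcases hq with ⟨p, hp, rfl⟩ | ⟨p, hp, rfl⟩
    · obtain ⟨-, -, ⟨hz0, hz1⟩, -⟩ := σ.mem_bounds hp
      simp only [lowerHalf]
      rcases le_total p.2.2 (1 - ε) with h | h
      · rw [min_eq_left (by nlinarith), max_eq_right (by linarith)]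
        rw [show 2 * (p.2.2 / 2) = p.2.2 by ring]
        exact hp
      · obtain ⟨hx, hy⟩ := hv i p hp (Or.inr h)
        rw [hx, hy]
        refine hm i _ ?_ ?_ (Or.inr ?_)
        · exact le_max_of_le_left (by linarith)
        · exact max_le (by linarith) ((min_le_right _ _).trans (by nlinarith))
        · exact le_max_of_le_right (le_min (by linarith) (by nlinarith))
    · obtain ⟨s, h0, h1, rfl⟩ := mem_one_iff.1 hp
      simp only [upperHalf, marked]
      refine hm i _ ?_ ?_ (Or.inr ?_)
      · exact le_max_of_le_left (by linarith)
      · exact max_le (by linarith) ((min_le_right _ _).trans (by nlinarith))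
      · exact le_max_of_le_right (le_min (by linarith) (by nlinarith))

theorem one_stack {n : ℕ} (σ : StringLink n) : ((one n).stack σ).HomeoEq σ := by
  obtain ⟨ε, hε, hε1, hv, hm⟩ := exists_collar σ
  -- Symmetrically, the trivial part is squeezed into the bottom collar.
  refine HomeoEq.of_vertical (fun z => min z (max (2 * z - 1) (ε * z)))
    (by fun_prop) (fun a b hab => ?_) (fun z hz => ?_) (fun z hz => ?_) (fun i q hq => ?_)
  · exact min_lt_min hab (max_lt_max (by linarith) (by nlinarith))
  · exact min_eq_left ((by nlinarith : z ≤ ε * z).trans (le_max_right _ _))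
  · exact min_eq_left ((by linarith : z ≤ 2 * z - 1).trans (le_max_left _ _))
  · rw [stack_range] at hq
    rcases hq with ⟨p, hp, rfl⟩ | ⟨p, hp, rfl⟩
    · obtain ⟨s, h0, h1, rfl⟩ := mem_one_iff.1 hp
      simp only [lowerHalf, marked]
      refine hm i _ ?_ ?_ (Or.inl ?_)
      · exact le_min (by linarith) (le_max_of_le_right (by positivity))
      · exact (min_le_left _ _).trans (by linarith)
      · exact (min_le_right _ _).trans (max_le (by linarith) (by nlinarith))
    · obtain ⟨-, -, ⟨hz0, hz1⟩, -⟩ := σ.mem_bounds hp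
      simp only [upperHalf]
      rcases le_total p.2.2 ε with h | h
      · obtain ⟨hx, hy⟩ := hv i p hp (Or.inl h)
        rw [hx, hy]
        refine hm i _ ?_ ?_ (Or.inl ?_)
        · exact le_min (by linarith) (le_max_of_le_right (by positivity))
        · exact (min_le_left _ _).trans (by linarith)
        · exact (min_le_right _ _).trans (max_le (by linarith) (by nlinarith))
      · rw [max_eq_left (by nlinarith), min_eq_right (by linarith)]
        rw [show 2 * ((p.2.2 + 1) / 2) - 1 = p.2.2 by ring]
        exact hp

/-- The map `place` as a homeomorphism. -/
noncomputable def placeHomeo : E3 ≃ₜ E3 where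
  toFun := place
  invFun q := (4 * (q.2.2 - 1 / 2), q.2.1, -2 * q.1)
  left_inv q := by
    simp only [place]
    ext
    · simp only; ring
    · rfl
    · simp only; ring
  right_inv q := by simp only [place]; ext <;> simp
  continuous_toFun := place_cont
  continuous_invFun := by fun_prop

/-- Conjugation by `place` gives a homeomorphism supported in the box of the placed cylinder, and
tails and arcs do not enter its interior. -/
theorem HomeoEq.bend {l : ℕ} {S S' : StringLink (l + l)} (h : S.HomeoEq S') :
    S.bend.HomeoEq S'.bend := by
  obtain ⟨f, hf, hf'⟩ := h
  have hg : ∀ q, (placeHomeo.symm.trans (f.trans placeHomeo)) q = place (f (placeHomeo.symm q)) :=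
    fun q => rfl
  have hid : ∀ q : E3, (q.1 ≤ -1 / 2 ∨ 0 ≤ q.1 ∨ q ∉ cylinderInterior) →
      (placeHomeo.symm.trans (f.trans placeHomeo)) q = q := by
    intro q hq
    rw [hg, hf]
    · exact placeHomeo.apply_symm_apply q
    · rintro ⟨⟨a1, a2⟩, hb, c1, c2⟩
      simp only [placeHomeo, Homeomorph.homeomorph_mk_coe_symm, Equiv.coe_fn_symm_mk] at a1 a2 c1 c2
      rcases hq with hq | hq | hq
      · linarith
      · linarith
      · exact hq ⟨⟨by linarith, by linarith⟩, hb, by linarith, by linarith⟩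
  have hbox : ∀ k, ∀ q ∈ place '' range (S.strand k),
      (placeHomeo.symm.trans (f.trans placeHomeo)) q ∈ place '' range (S'.strand k) := by
    rintro k _ ⟨p, hp, rfl⟩
    refine ⟨f p, hf' k p hp, ?_⟩
    rw [hg, show place p = placeHomeo p from rfl, placeHomeo.symm_apply_apply]
  have htail : ∀ (i : Fin l) (q : E3), TailSpec (off l i) q → q.1 ≤ -1 / 2 ∨ q.2.2 ≤ 1 / 4 := by
    rintro i q ⟨-, -, h3, h4 | h4 | h4⟩
    · exact Or.inr (by linarith)
    · exact Or.inr h4.2.1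
    · exact Or.inl (by linarith)
  refine ⟨placeHomeo.symm.trans (f.trans placeHomeo), fun q hq => hid q (Or.inr (Or.inr hq)),
    fun i q hq => ?_⟩
  have hlow : ∀ q : E3, (q.2.2 ≤ 1 / 4 ∨ 3 / 4 ≤ q.2.2) →
      (placeHomeo.symm.trans (f.trans placeHomeo)) q = q := by
    intro q hq
    rw [hg, hf]
    · exact placeHomeo.apply_symm_apply q
    · rintro ⟨⟨a1, a2⟩, -⟩
      simp only [placeHomeo, Homeomorph.homeomorph_mk_coe_symm, Equiv.coe_fn_symm_mk] at a1 a2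
      rcases hq with hq | hq <;> linarith
  rw [bend_range] at hq ⊢
  rcases hq with (((hq | hq) | hq) | hq) | hq
  · refine Or.inl (Or.inl (Or.inl (Or.inl ?_)))
    rcases htail i q (tail_spec hq) with h | h
    · rwa [hid q (Or.inl h)]
    · rwa [hlow q (Or.inl h)]
  · exact Or.inl (Or.inl (Or.inl (Or.inr (hbox _ q hq))))
  · refine Or.inl (Or.inl (Or.inr ?_))
    rwa [hid q (Or.inr (Or.inl (arc_spec hq).2.1))]
  · exact Or.inl (Or.inr (hbox _ q hq))
  · refine Or.inr ?_
    rcases htail i _ (high_spec hq) with h | h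
    · rwa [hid q (Or.inl h)]
    · rwa [hlow q (Or.inr (by simp only [flip] at h; linarith))]

end StringLink

/-! ### Windows -/

/-- The upper window: an increasing function of `x` above the identity, and equal to it if `1 ≤ |x|`
or if `d ≤ 0`. -/
noncomputable def topW (η K d x : ℝ) : ℝ :=
  max x (min (1 - η * (1 - x)) (min (x + K * (1 + x)) (x + K * d)))

/-- The lower window. -/
noncomputable def botW (η K d x : ℝ) : ℝ :=
  min x (max (-1 + η * (1 + x)) (max (x - K * (1 - x)) (x - K * d)))

section Windows

variable {η K d : ℝ}

theorem topW_strictMono (hη : 0 < η) (hK : 0 ≤ K) : StrictMono (topW η K d) := fun a b h =>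
  max_lt_max h (min_lt_min (by nlinarith) (min_lt_min (by nlinarith) (by linarith)))

theorem botW_strictMono (hη : 0 < η) (hK : 0 ≤ K) : StrictMono (botW η K d) := fun a b h =>
  min_lt_min h (max_lt_max (by nlinarith) (max_lt_max (by nlinarith) (by linarith)))

theorem le_topW (x : ℝ) : x ≤ topW η K d x := le_max_left _ _

theorem botW_le (x : ℝ) : botW η K d x ≤ x := min_le_left _ _

theorem topW_eq (hη : η ≤ 1) (hK : 0 ≤ K) {x : ℝ} (h : 1 ≤ |x| ∨ d ≤ 0) : topW η K d x = x := by
  refine max_eq_left ?_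
  rcases h with h | h
  · rcases le_abs.1 h with h | h
    · exact (min_le_left _ _).trans (by nlinarith)
    · exact (min_le_right _ _).trans ((min_le_left _ _).trans (by nlinarith))
  · exact (min_le_right _ _).trans ((min_le_right _ _).trans (by nlinarith))

theorem botW_eq (hη : η ≤ 1) (hK : 0 ≤ K) {x : ℝ} (h : 1 ≤ |x| ∨ d ≤ 0) : botW η K d x = x := by
  refine min_eq_left ?_
  rcases h with h | h
  · rcases le_abs.1 h with h | h
    · exact le_max_of_le_right (le_max_of_le_left (by nlinarith))
    · exact le_max_of_le_left (by nlinarith)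
  · exact le_max_of_le_right (le_max_of_le_right (by nlinarith))

theorem topW_le_one (hη : 0 ≤ η) {x : ℝ} (hx : x ≤ 1) : topW η K d x ≤ 1 :=
  max_le hx ((min_le_left _ _).trans (by nlinarith))

theorem neg_one_le_botW (hη : 0 ≤ η) {x : ℝ} (hx : -1 ≤ x) : -1 ≤ botW η K d x :=
  le_min hx (le_max_of_le_left (by nlinarith))

/-- Away from the walls by `δ`, the steep lines of slope governed by `K` already exceed `1`, and the
flat line of slope `η` exceeds `1 - 2 * η` because `1 - x ≤ 2`. So there the window does not
obstruct a target `p`. -/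
theorem le_topW_of {δ x p : ℝ} (hKδ : 2 ≤ K * δ) (hK : 0 ≤ K) (hη : 0 ≤ η)
    (hp : p ≤ 1 - 2 * η) (hx : -1 + δ ≤ x) (hd : δ ≤ d) : p ≤ topW η K d x := by
  rcases le_total p x with h | h
  · exact h.trans (le_topW x)
  · refine le_max_of_le_right (le_min ?_ (le_min ?_ ?_))
    · by_cases h1 : -1 ≤ x
      · nlinarith
      · nlinarith
    · have : K * δ ≤ K * (1 + x) := mul_le_mul_of_nonneg_left (by linarith) hK
      by_cases h1 : -1 ≤ x <;> nlinarith
    · have : K * δ ≤ K * d := mul_le_mul_of_nonneg_left hd hK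
      by_cases h1 : -1 ≤ x <;> nlinarith

theorem botW_le_of {δ x p : ℝ} (hKδ : 2 ≤ K * δ) (hK : 0 ≤ K) (hη : 0 ≤ η)
    (hp : -1 + 2 * η ≤ p) (hx : x ≤ 1 - δ) (hd : δ ≤ d) : botW η K d x ≤ p := by
  rcases le_total x p with h | h
  · exact (botW_le x).trans h
  · refine min_le_of_right_le (max_le ?_ (max_le ?_ ?_))
    · by_cases h1 : x ≤ 1 <;> nlinarith
    · have : K * δ ≤ K * (1 - x) := mul_le_mul_of_nonneg_left (by linarith) hK
      by_cases h1 : x ≤ 1 <;> nlinarith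
    · have : K * δ ≤ K * d := mul_le_mul_of_nonneg_left hd hK
      by_cases h1 : x ≤ 1 <;> nlinarith

end Windows

/-! ### Straightening the bend: the tilt -/

/-- The size of the tilt. -/
noncomputable def tiltSize (e K x y : ℝ) : ℝ :=
  max 0 (min (min (e * (x + 1 / 2)) ((e - x) / 2)) (K * (1 - |y|)))

/-- A piecewise linear map of the line which moves points towards `0` by `k`. -/
noncomputable def tilt (k t : ℝ) : ℝ :=
  (fun u => max u (min (u / 2) (min (u + k) (max u (2 * u + 1 / 4)))))
    (min t (max (t / 2) (max (t - k) (min t (2 * t - 1 / 4)))))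

theorem tilt_strictMono (k : ℝ) : StrictMono (tilt k) := by
  have h1 : StrictMono fun t : ℝ => min t (max (t / 2) (max (t - k) (min t (2 * t - 1 / 4)))) :=
    fun a b h => min_lt_min h (max_lt_max (by linarith) (max_lt_max (by linarith)
      (min_lt_min h (by linarith))))
  have h2 : StrictMono fun u : ℝ => max u (min (u / 2) (min (u + k) (max u (2 * u + 1 / 4)))) :=
    fun a b h => max_lt_max h (min_lt_min (by linarith) (min_lt_min (by linarith)
      (max_lt_max h (by linarith))))
  exact h2.comp h1

/-- On the positive side the outer clamp is inactive. For small `k` the graph has slope `1/2` up to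
`2 * k`, then is `t - k`, then catches up with slope `2` and is the identity from `1/4` on. The
outer clamp does the same on the negative side. -/
theorem tilt_of_nonneg {k t : ℝ} (hk : 0 ≤ k) (ht : 0 ≤ t) :
    tilt k t = max (t / 2) (max (t - k) (min t (2 * t - 1 / 4))) := by
  have h1 : max (t / 2) (max (t - k) (min t (2 * t - 1 / 4))) ≤ t :=
    max_le (by linarith) (max_le (by linarith) (min_le_left _ _))
  have h2 : 0 ≤ max (t / 2) (max (t - k) (min t (2 * t - 1 / 4))) := le_max_of_le_left (by linarith)
  unfold tilt
  rw [min_eq_right h1]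
  exact max_eq_left ((min_le_left _ _).trans (by linarith))

theorem tilt_neg {k : ℝ} (hk : 0 ≤ k) (t : ℝ) : tilt k (-t) = -tilt k t := by
  have key : ∀ t : ℝ, 0 ≤ t → tilt k (-t) = -tilt k t := by
    intro t ht
    rw [tilt_of_nonneg hk ht]
    unfold tilt
    have h1 : min (-t) (max (-t / 2) (max (-t - k) (min (-t) (2 * -t - 1 / 4)))) = -t :=
      min_eq_left (le_max_of_le_left (by linarith))
    rw [h1]
    simp only
    have h2 : min (-t / 2) (min (-t + k) (max (-t) (2 * -t + 1 / 4))) =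
        -max (t / 2) (max (t - k) (min t (2 * t - 1 / 4))) := by
      rw [← min_neg_neg, ← min_neg_neg, ← max_neg_neg]
      congr 1
      · ring
      · congr 1
        · ring
        · congr 1; ring
    rw [h2]
    refine max_eq_right ?_
    have : max (t / 2) (max (t - k) (min t (2 * t - 1 / 4))) ≤ t :=
      max_le (by linarith) (max_le (by linarith) (min_le_left _ _))
    linarith
  rcases le_total 0 t with h | h
  · exact key t h
  · have := key (-t) (by linarith)
    rw [neg_neg] at this
    linarith

theorem abs_tilt {k : ℝ} (hk : 0 ≤ k) (t : ℝ) : |tilt k t| = tilt k |t| := by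
  have h0 : ∀ t : ℝ, 0 ≤ t → 0 ≤ tilt k t := fun t ht => by
    rw [tilt_of_nonneg hk ht]; exact le_max_of_le_left (by linarith)
  rcases le_total 0 t with h | h
  · rw [abs_of_nonneg h, abs_of_nonneg (h0 t h)]
  · have := h0 (-t) (by linarith)
    rw [abs_of_nonpos h, tilt_neg hk, abs_of_nonpos]
    rw [tilt_neg hk] at this
    linarith

theorem tilt_far {k u : ℝ} (hk : 0 ≤ k) (h : k = 0 ∨ 1 / 4 ≤ u) (hu : 0 ≤ u) : tilt k u = u := by
  rw [tilt_of_nonneg hk hu]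
  rcases h with rfl | h
  · rw [sub_zero, max_eq_left (min_le_left u _), max_eq_right (by linarith)]
  · rw [min_eq_left (by linarith), max_eq_right (by linarith : u - k ≤ u), max_eq_right (by linarith)]

theorem tilt_near {k u : ℝ} (hk : 0 ≤ k) (h : 2 * k ≤ u) (h' : u + k ≤ 1 / 4) : tilt k u = u - k := by
  rw [tilt_of_nonneg hk (by linarith), 
    max_eq_left ((min_le_right u (2 * u - 1 / 4)).trans (by linarith) :
      min u (2 * u - 1 / 4) ≤ u - k), max_eq_right (by linarith : u / 2 ≤ u - k)]

/-! ### Straightening the bend: the levels -/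

/-- The profile of the level function. -/
noncomputable def profile (e x : ℝ) : ℝ :=
  max (min (x + 1 / 2) (e * (x + 1 / 2))) (max x (min ((x + e) / 2) (x + 1 / 2)))

theorem profile_strictMono {e : ℝ} (he : 0 < e) : StrictMono (profile e) := fun a b h =>
  max_lt_max (min_lt_min (by linarith) (by nlinarith))
    (max_lt_max h (min_lt_min (by linarith) (by linarith)))

/-- The profile is such that, after the tilt, `profile e x + |t|` is constantly `off l i` along the
inner part of the `i`-th string of a bent trivial link: slope `1` on the oblique end of the tail,
slope `e` on the legs, `1/2` where the tilt fades out, and `1` on the rest of the arc. -/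
theorem profile_left {e x : ℝ} (he : 0 < e) (he1 : e ≤ 1 / 2) (hx : x ≤ -1 / 2) :
    profile e x = x + 1 / 2 := by
  unfold profile
  rw [min_eq_left (by nlinarith)]
  exact max_eq_left (max_le (by linarith) (min_le_right _ _))

theorem profile_mid {e x : ℝ} (he : 0 < e) (he1 : e ≤ 1 / 2) (hx : -1 / 2 ≤ x) (hx0 : x ≤ 0) :
    profile e x = e * (x + 1 / 2) := by
  unfold profile
  rw [min_eq_right (by nlinarith)]
  exact max_eq_left (max_le (by nlinarith) ((min_le_left _ _).trans (by nlinarith)))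

theorem profile_right {e x : ℝ} (he : 0 < e) (he1 : e ≤ 1 / 2) (hx0 : 0 ≤ x) :
    profile e x = max x ((x + e) / 2) := by
  unfold profile
  rw [min_eq_left (by linarith : (x + e) / 2 ≤ x + 1 / 2)]
  exact max_eq_right ((min_le_right _ _).trans (le_max_of_le_right (by nlinarith)))

theorem profile_nonneg {e x : ℝ} (he : 0 < e) (he1 : e ≤ 1 / 2) (hx : -1 / 2 ≤ x) :
    0 ≤ profile e x := by
  rcases le_total x 0 with h | h
  · rw [profile_mid he he1 hx h]; nlinarith
  · rw [profile_right he he1 h]; exact le_max_of_le_left h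

theorem le_profile {e x : ℝ} : x ≤ profile e x :=
  le_max_of_le_right (le_max_left _ _)

/-- The interpolation parameter of the outer parts of the tails. -/
noncomputable def outer (u : ℝ) : ℝ := max 0 (min 1 (8 * (u - 1 / 4)))

/-- The level function of the tilted bend of a trivial string link. -/
noncomputable def level (e η x u : ℝ) : ℝ :=
  if u ≤ 1 / 4 then min (8 * (profile e x + u) - 1) (max x (1 - η * (1 - x)))
  else min (8 * ((x + 3 / 4 + outer u / 4) / (1 + 7 * outer u)) - 1) (max x (1 - η * (1 - x)))

theorem outer_nonneg (u : ℝ) : 0 ≤ outer u := le_max_left _ _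

theorem level_strictMono {e η u : ℝ} (he : 0 < e) (hη : 0 < η) :
    StrictMono fun x => level e η x u := by
  have hcap : ∀ a b : ℝ, a < b → max a (1 - η * (1 - a)) < max b (1 - η * (1 - b)) := fun a b h =>
    max_lt_max h (by nlinarith)
  intro a b h
  simp only [level]
  split_ifs
  · exact min_lt_min (by have := profile_strictMono he h; linarith) (hcap a b h)
  · refine min_lt_min ?_ (hcap a b h)
    have := outer_nonneg u
    have : (a + 3 / 4 + outer u / 4) / (1 + 7 * outer u) <
      (b + 3 / 4 + outer u / 4) / (1 + 7 * outer u) := by gcongr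
    linarith

theorem level_continuous {e η : ℝ} (he : 0 < e) (he1 : e ≤ 1 / 2) (hη : 0 < η) (hη1 : η ≤ 1) :
    Continuous fun q : ℝ × ℝ => level e η q.1 q.2 := by
  unfold level
  refine Continuous.if_le ?_ ?_ continuous_snd continuous_const ?_
  · unfold profile; fun_prop
  · have hd : ∀ q : ℝ × ℝ, 1 + 7 * outer q.2 ≠ 0 := fun q => by
      have := outer_nonneg q.2
      positivity
    have ho : Continuous outer := by unfold outer; fun_prop
    have := ho.comp continuous_snd (X := ℝ × ℝ)
    simp only [Function.comp_def] at this
    exact ((continuous_const.mul (((by fun_prop : Continuous fun q : ℝ × ℝ =>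
      q.1 + 3 / 4 + outer q.2 / 4)).div (by fun_prop) hd)).sub continuous_const).min (by fun_prop)
  -- On the seam `u = 1/4` the two formulas agree for `x ≤ -1/2`; for larger `x` both exceed the
  -- common cap `max x (1 - η * (1 - x))`. The cap is there to make the function continuous.
  · rintro ⟨x, u⟩ hu
    have hu : u = 1 / 4 := hu
    subst hu
    have ho : outer (1 / 4) = 0 := by norm_num [outer]
    simp only [ho]
    rcases le_total x (-1 / 2) with h | h
    · rw [profile_left he he1 h]; congr 1; ring
    · have h1 := profile_nonneg he he1 h
      have h2 : x ≤ profile e x := le_profile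
      rw [min_eq_right (max_le (by linarith) ?_), min_eq_right (max_le (by linarith) ?_)]
      · by_cases hx : x ≤ 1 <;> nlinarith
      · by_cases hx : x ≤ 1
        · nlinarith
        · nlinarith

theorem level_far {e η x u : ℝ} (hu : 3 / 8 ≤ u) : level e η x u = x := by
  have ho : outer u = 1 := by
    unfold outer
    rw [min_eq_left (by linarith)]; norm_num
  rw [level, if_neg (by linarith), ho, min_eq_left]
  · ring
  · refine le_max_of_le_left ?_
    linarith

/-- On the slanted segment of a tail, `x` is the affine interpolation of `a - 3/4` and `8 * a - 1`
with parameter `outer u`; the formula in `level` solves this for `a`. -/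
theorem level_outer {e η a u : ℝ} (hη : 0 ≤ η) (ha : 8 * a - 1 ≤ 1 - 2 * η) (h0 : 0 ≤ a) (hu : 1 / 4 < u)
    (hu' : u ≤ 3 / 8) : level e η ((8 * a - 1) * (8 * u - 2) + (a - 3 / 4) * (3 - 8 * u)) u =
      8 * a - 1 := by
  have ho : outer u = 8 * u - 2 := by
    unfold outer
    rw [min_eq_right (by linarith), max_eq_right (by linarith)]; ring
  have hd : 1 + 7 * (8 * u - 2) ≠ 0 := by nlinarith
  have e1 : (8 * a - 1) * (8 * u - 2) + (a - 3 / 4) * (3 - 8 * u) + 3 / 4 + (8 * u - 2) / 4 =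
      a * (1 + 7 * (8 * u - 2)) := by ring
  rw [level, if_neg (by linarith), ho, e1, mul_div_cancel_right₀ _ hd, min_eq_left]
  refine le_max_of_le_right ?_
  have hx : -1 ≤ (8 * a - 1) * (8 * u - 2) + (a - 3 / 4) * (3 - 8 * u) := by nlinarith
  nlinarith

theorem level_inner {e η a x u : ℝ} (hη : 0 ≤ η) (ha : 8 * a - 1 ≤ 1 - 2 * η) (hu : u ≤ 1 / 4)
    (hx : -1 ≤ x) (h : profile e x + u = a) : level e η x u = 8 * a - 1 := by
  rw [level, if_pos hu, h, min_eq_left]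
  exact le_max_of_le_right (by nlinarith)


theorem tiltSize_nonneg (e K x y : ℝ) : 0 ≤ tiltSize e K x y := le_max_left _ _

theorem tiltSize_eq_zero {e K x y : ℝ} (he : 0 < e) (hK : 0 ≤ K)
    (h : x ≤ -1 / 2 ∨ e ≤ x ∨ 1 ≤ |y|) : tiltSize e K x y = 0 := by
  refine max_eq_left ?_
  rcases h with h | h | h
  · exact (min_le_left _ _).trans ((min_le_left _ _).trans (by nlinarith))
  · exact (min_le_left _ _).trans ((min_le_right _ _).trans (by linarith))
  · exact (min_le_right _ _).trans (by nlinarith)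

theorem tiltSize_mid {e K x y δ : ℝ} (he : 0 < e) (he1 : e ≤ 1 / 2) (hK : 2 ≤ K * δ) (hK0 : 0 ≤ K)
    (hx : -1 / 2 ≤ x) (hx0 : x ≤ 0) (hy : |y| ≤ 1 - δ) : tiltSize e K x y = e * (x + 1 / 2) := by
  have : K * δ ≤ K * (1 - |y|) := mul_le_mul_of_nonneg_left (by linarith) hK0
  unfold tiltSize
  rw [min_eq_left (by nlinarith : e * (x + 1 / 2) ≤ (e - x) / 2), min_eq_left (by nlinarith),
    max_eq_right (by nlinarith)]

theorem tiltSize_right {e K x y δ : ℝ} (he : 0 < e) (he1 : e ≤ 1 / 2) (hK : 2 ≤ K * δ) (hK0 : 0 ≤ K)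
    (hx : 0 ≤ x) (hxe : x ≤ e) (hy : |y| ≤ 1 - δ) : tiltSize e K x y = (e - x) / 2 := by
  have : K * δ ≤ K * (1 - |y|) := mul_le_mul_of_nonneg_left (by linarith) hK0
  unfold tiltSize
  rw [min_eq_right (by nlinarith : (e - x) / 2 ≤ e * (x + 1 / 2)), min_eq_left (by nlinarith),
    max_eq_right (by nlinarith)]

theorem tilt_eq_self {k t : ℝ} (hk : 0 ≤ k) (h : k = 0 ∨ 1 / 4 ≤ |t|) : tilt k t = t := by
  have h := tilt_far hk h (abs_nonneg t)
  rcases abs_choice t with h' | h'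
  · rwa [h'] at h
  · rw [h', tilt_neg hk] at h
    linarith

/-- The parameters of the straightening of a bend, depending on a margin `δ`. -/
structure StraightParams where
  (δ e η K : ℝ)
  δ_pos : 0 < δ
  δ_le : δ ≤ 1 / 8
  e_eq : e = δ / 16
  η_pos : 0 < η
  η_le : 2 * η ≤ δ
  K_nonneg : 0 ≤ K
  K_le : 2 ≤ K * δ

namespace StraightParams

variable (P : StraightParams)

theorem e_pos : 0 < P.e := by rw [P.e_eq]; linarith [P.δ_pos]
theorem e_le : P.e ≤ 1 / 128 := by rw [P.e_eq]; linarith [P.δ_le]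

/-- A homeomorphism which makes the bend of a trivial string link vertical. -/
theorem exists_straighten : ∃ g : E3 ≃ₜ E3, (∀ q, q ∉ cylinderInterior → g q = q) ∧
    ∀ x y t : ℝ, g (x, y, 1 / 2 + t) =
      (max (botW P.η P.K (min (1 - |y|) (1 / 2 - |tilt (tiltSize P.e P.K x y) t|)) x)
        (min (topW P.η P.K (min (1 - |y|) (1 / 2 - |tilt (tiltSize P.e P.K x y) t|)) x)
          (level P.e P.η x |tilt (tiltSize P.e P.K x y) t|)), y,
        1 / 2 + tilt (tiltSize P.e P.K x y) t) := by
  obtain ⟨δ, e, η, K, hδ, hδ1, he', hη, hη1, hK, hKδ⟩ := P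
  have he : 0 < e := by rw [he']; linarith
  have he1 : e ≤ 1 / 2 := by rw [he']; linarith
  simp only
  have ht0 : ∀ x y t : ℝ, 1 / 4 ≤ |t| → tilt (tiltSize e K x y) t = t := fun x y t ht =>
    tilt_eq_self (tiltSize_nonneg e K x y) (Or.inr ht)
  -- The first shear tilts the two legs towards each other.
  obtain ⟨f, hf⟩ := exists_zHomeo (fun q => 1 / 2 + tilt (tiltSize e K q.1 q.2.1) (q.2.2 - 1 / 2))
    (by unfold tilt tiltSize; fun_prop) (fun x y a b hab => by
      have := tilt_strictMono (tiltSize e K x y) (show a - 1 / 2 < b - 1 / 2 by linarith)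
      simpa using this) 1 (fun x y z hz => by
      simp only
      rw [ht0]
      · ring
      · rcases le_abs.1 hz with h | h
        · exact le_abs.2 (Or.inl (by linarith))
        · exact le_abs.2 (Or.inr (by linarith)))
  have hcl : Continuous fun q : E3 => level e η q.1 |q.2.2 - 1 / 2| :=
    (level_continuous he he1 hη (by linarith)).comp (g := fun q : ℝ × ℝ => level e η q.1 q.2)
      (f := fun q : E3 => (q.1, |q.2.2 - 1 / 2|)) (by fun_prop)
  -- The second shear makes the level the new abscissa, so that a string on which the level is
  -- constant becomes vertical.
  obtain ⟨g, hg⟩ := exists_xHomeo (fun q =>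
      max (botW η K (min (1 - |q.2.1|) (1 / 2 - |q.2.2 - 1 / 2|)) q.1)
        (min (topW η K (min (1 - |q.2.1|) (1 / 2 - |q.2.2 - 1 / 2|)) q.1)
          (level e η q.1 |q.2.2 - 1 / 2|)))
    (by
      refine Continuous.max ?_ (Continuous.min ?_ hcl)
      · unfold botW; fun_prop
      · unfold topW; fun_prop)
    (fun y z => strictMono_clip
      (botW_strictMono (d := min (1 - |y|) (1 / 2 - |z - 1 / 2|)) hη hK)
      (topW_strictMono (d := min (1 - |y|) (1 / 2 - |z - 1 / 2|)) hη hK)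
      (level_strictMono (u := |z - 1 / 2|) he hη)) 1
    (fun x y z hx => by
      simp only
      rw [topW_eq (by linarith) hK (Or.inl hx), botW_eq (by linarith) hK (Or.inl hx)]
      exact max_eq_left (min_le_left _ _))
  refine ⟨f.trans g, fun q hq => ?_, fun x y t => ?_⟩
  · have h1 : f q = q := by
      rw [hf]
      refine Prod.ext rfl (Prod.ext rfl ?_)
      simp only
      have : tilt (tiltSize e K q.1 q.2.1) (q.2.2 - 1 / 2) = q.2.2 - 1 / 2 := by
        by_cases h : 1 / 4 ≤ |q.2.2 - 1 / 2|
        · exact ht0 _ _ _ h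
        · rw [not_le, abs_lt] at h
          have hk : tiltSize e K q.1 q.2.1 = 0 := by
            refine tiltSize_eq_zero he hK ?_
            by_contra! hcon
            obtain ⟨c1, c2, c3⟩ := hcon
            rw [abs_lt] at c3
            exact hq ⟨⟨by linarith, by linarith⟩, c3, by linarith, by linarith⟩
          rw [hk, tilt_eq_self le_rfl (Or.inl rfl)]
      rw [this]; ring
    rw [Homeomorph.trans_apply, h1, hg]
    refine Prod.ext ?_ rfl
    simp only
    have : 1 ≤ |q.1| ∨ min (1 - |q.2.1|) (1 / 2 - |q.2.2 - 1 / 2|) ≤ 0 := by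
      by_contra! hcon
      obtain ⟨c1, c2⟩ := hcon
      rw [lt_min_iff] at c2
      have c3 := abs_lt.1 c1
      have c4 := abs_lt.1 (show |q.2.1| < 1 by linarith)
      have c5 := abs_lt.1 (show |q.2.2 - 1 / 2| < 1 / 2 by linarith)
      exact hq ⟨c3, c4, by linarith, by linarith⟩
    rw [topW_eq (by linarith) hK this, botW_eq (by linarith) hK this]
    exact max_eq_left (min_le_left _ _)
  · rw [Homeomorph.trans_apply, hf, hg]
    simp only [add_sub_cancel_left]

end StraightParams

/-- `g` straightens the bend of the trivial string link. -/
def IsStraightening (P : StraightParams) (g : E3 ≃ₜ E3) : Prop :=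
  ∀ x y t : ℝ, g (x, y, 1 / 2 + t) =
      (max (botW P.η P.K (min (1 - |y|) (1 / 2 - |tilt (tiltSize P.e P.K x y) t|)) x)
        (min (topW P.η P.K (min (1 - |y|) (1 / 2 - |tilt (tiltSize P.e P.K x y) t|)) x)
          (level P.e P.η x |tilt (tiltSize P.e P.K x y) t|)), y,
        1 / 2 + tilt (tiltSize P.e P.K x y) t)

namespace IsStraightening

variable {P : StraightParams} {g : E3 ≃ₜ E3}

theorem far (hg : IsStraightening P g) {x y t : ℝ} (ht : 3 / 8 ≤ |t|) :
    g (x, y, 1 / 2 + t) = (x, y, 1 / 2 + t) := by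
  rw [hg, tilt_eq_self (tiltSize_nonneg _ _ _ _) (Or.inr (by linarith)), level_far ht,
    max_min_eq (botW_le _) (le_topW _)]

/-- At distance `P.δ` from the walls both windows are inactive, and the new abscissa is exactly the
level. -/
theorem apply_of_level (hg : IsStraightening P g) {x y t t' p : ℝ}
    (h : tilt (tiltSize P.e P.K x y) t = t') (hp : level P.e P.η x |t'| = p) (ht : |t'| ≤ 3 / 8)
    (hx : |x| ≤ 1 - P.δ) (hy : |y| ≤ 1 - P.δ) (hp1 : |p| ≤ 1 - P.δ) :
    g (x, y, 1 / 2 + t) = (p, y, 1 / 2 + t') := by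
  have hd : P.δ ≤ min (1 - |y|) (1 / 2 - |t'|) := le_min (by linarith) (by linarith [P.δ_le])
  rw [abs_le] at hx hp1
  have := P.η_le
  rw [hg, h, hp, max_min_eq]
  · exact botW_le_of P.K_le P.K_nonneg P.η_pos.le (by linarith) (by linarith) hd
  · exact le_topW_of P.K_le P.K_nonneg P.η_pos.le (by linarith) (by linarith) hd

theorem outer (hg : IsStraightening P g) {a x y t : ℝ} (ht : 1 / 4 < |t|) (ht' : |t| ≤ 3 / 8)
    (h0 : 0 ≤ a) (ha : |8 * a - 1| ≤ 1 - P.δ)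
    (h : x = (8 * a - 1) * (8 * |t| - 2) + (a - 3 / 4) * (3 - 8 * |t|))
    (hx : |x| ≤ 1 - P.δ) (hy : |y| ≤ 1 - P.δ) :
    g (x, y, 1 / 2 + t) = (8 * a - 1, y, 1 / 2 + t) := by
  have := P.η_le
  refine hg.apply_of_level (tilt_eq_self (tiltSize_nonneg _ _ _ _) (Or.inr ht.le)) ?_ ht' hx hy ha
  rw [h]
  exact level_outer P.η_pos.le (by linarith [(abs_le.1 ha).2]) h0 ht ht'

theorem inner (hg : IsStraightening P g) {a x y t : ℝ} (ht : 2 * tiltSize P.e P.K x y ≤ |t|)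
    (ht' : |t| + tiltSize P.e P.K x y ≤ 1 / 4)
    (h : profile P.e x + (|t| - tiltSize P.e P.K x y) = a) (ha : |8 * a - 1| ≤ 1 - P.δ)
    (hx : |x| ≤ 1 - P.δ) (hy : |y| ≤ 1 - P.δ) :
    g (x, y, 1 / 2 + t) = (8 * a - 1, y, 1 / 2 + tilt (tiltSize P.e P.K x y) t) ∧
      |tilt (tiltSize P.e P.K x y) t| = |t| - tiltSize P.e P.K x y := by
  have h0 := tiltSize_nonneg P.e P.K x y
  have e1 : |tilt (tiltSize P.e P.K x y) t| = |t| - tiltSize P.e P.K x y := by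
    rw [abs_tilt h0, tilt_near h0 ht ht']
  refine ⟨hg.apply_of_level rfl ?_ (by linarith) hx hy ha, e1⟩
  have := P.η_le
  have := P.δ_pos
  rw [e1]
  exact level_inner P.η_pos.le (by linarith [(abs_le.1 ha).2]) (by linarith)
    (by linarith [(abs_le.1 hx).1]) h

/-- A tail has no tilt and constant level `8 * a - 1`. Top and bottom tails are treated together,
since everything depends on `|t|` only. -/
theorem tail (hg : IsStraightening P g) {a : ℝ} {q : E3} (hq : TailSpec a q ∨ TailSpec a (flip q))
    (ha : 0 ≤ a) (ha1 : a ≤ 1 / 4) (hm : |8 * a - 1| ≤ 1 - P.δ) (hx : |q.1| ≤ 1 - P.δ) :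
    g q = (8 * a - 1, 0, q.2.2) := by
  obtain ⟨x, y, z⟩ := q
  obtain ⟨t, rfl⟩ : ∃ t, z = 1 / 2 + t := ⟨z - 1 / 2, by ring⟩
  obtain ⟨u, hu, h⟩ : ∃ u : ℝ, u = |t| ∧ TailSpec a (x, y, 1 / 2 - u) := by
    rcases hq with h | h
    · refine ⟨-t, ?_, by simpa using h⟩
      have := h.2.2.1
      simp only at this
      rw [abs_of_nonpos (by linarith)]
    · refine ⟨t, ?_, ?_⟩
      · have := h.2.2.1
        simp only [flip] at this
        rw [abs_of_nonneg (by linarith)]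
      · convert h using 1
        simp only [flip]
        rw [Prod.mk.injEq, Prod.mk.injEq]
        exact ⟨rfl, rfl, by ring⟩
  clear hq
  obtain ⟨hy, h0, h1, h⟩ := h
  simp only at hy h0 h1 h hx ⊢
  subst hy
  have hδ := P.δ_le
  have hδ0 := P.δ_pos
  have hy : |(0 : ℝ)| ≤ 1 - P.δ := by rw [abs_zero]; linarith
  rcases h with ⟨h2, h3⟩ | ⟨h2, h3, h4⟩ | ⟨h2, h3⟩
  · rw [hg.far (by linarith), h3]
  · rcases h3.lt_or_eq with h3 | h3
    · refine hg.outer (by linarith) (by linarith) ha hm ?_ hx hy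
      rw [h4, ← hu]; ring
    · have hk := tiltSize_eq_zero (e := P.e) (K := P.K) (y := 0) P.e_pos P.K_nonneg
        (Or.inl (show x ≤ -1 / 2 by rw [h4, h3]; linarith))
      rw [(hg.inner (a := a) (by rw [hk]; linarith) (by rw [hk]; linarith)
        (by rw [hk, profile_left P.e_pos (by linarith [P.e_le]) (by rw [h4, h3]; linarith), h4, h3]; linarith)
        hm hx hy).1, hk, tilt_eq_self le_rfl (Or.inl rfl)]
  · have hk := tiltSize_eq_zero (e := P.e) (K := P.K) (y := 0) P.e_pos P.K_nonneg
      (Or.inl (show x ≤ -1 / 2 by linarith))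
    rw [(hg.inner (a := a) (by rw [hk]; linarith) (by rw [hk]; linarith)
        (by rw [hk, profile_left P.e_pos (by linarith [P.e_le]) (by linarith), h3]; linarith)
        hm hx hy).1, hk, tilt_eq_self le_rfl (Or.inl rfl)]

/-- Along the arc the level is constant, and the tilt lowers its highest point by at least `P.e /
2`. The arc therefore ends up below the slanted slab into which the right leg is carried. -/
theorem arc (hg : IsStraightening P g) {a : ℝ} {q : E3} (h : ArcSpec a q)
    (ha : P.e ≤ a) (ha1 : a ≤ 1 / 4) (hm : |8 * a - 1| ≤ 1 - P.δ) (hx : |q.1| ≤ 1 - P.δ) :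
    ∃ t', t' ≤ a - P.e / 2 ∧ -(1 / 4) ≤ t' ∧ g q = (8 * a - 1, 0, 1 / 2 + t') := by
  obtain ⟨x, y, z⟩ := q
  obtain ⟨t, rfl⟩ : ∃ t, z = 1 / 2 + t := ⟨z - 1 / 2, by ring⟩
  obtain ⟨hy, h0, h⟩ := h
  simp only at hy h0 h hx ⊢
  subst hy
  have he := P.e_pos
  have he1 := P.e_le
  have hy : |(0 : ℝ)| ≤ 1 - P.δ := by rw [abs_zero]; linarith [P.δ_le]
  have hu : x = a - |t| := by
    rcases h with ⟨h1, h2⟩ | ⟨h1, h2⟩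
    · rw [abs_of_nonpos (by linarith)]; linarith
    · rw [abs_of_nonneg (by linarith)]; linarith
  have h0' := abs_nonneg t
  have key : 2 * tiltSize P.e P.K x 0 ≤ |t| ∧ |t| + tiltSize P.e P.K x 0 ≤ 1 / 4 ∧
      profile P.e x + (|t| - tiltSize P.e P.K x 0) = a ∧
      |t| - tiltSize P.e P.K x 0 ≤ a - P.e / 2 := by
    rw [profile_right he (by linarith) h0]
    rcases le_total x P.e with h | h
    · rw [tiltSize_right he (by linarith) P.K_le P.K_nonneg h0 h hy, max_eq_right (by linarith)]
      refine ⟨by linarith, by linarith [P.e_eq, (abs_le.1 hm).2, P.δ_pos], by linarith, by linarith⟩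
    · rw [tiltSize_eq_zero he P.K_nonneg (Or.inr (Or.inl h)), max_eq_left (by linarith)]
      refine ⟨by linarith, by linarith, by linarith, by linarith⟩
  obtain ⟨k1, k2, k3, k4⟩ := key
  have h := hg.inner k1 k2 k3 hm hx hy
  have h3 := tiltSize_nonneg P.e P.K x 0
  have h4 := abs_le.1 (h.2.le)
  exact ⟨_, by linarith, by linarith, h.1⟩

/-- Inside the placed cylinder the tilt turns the lengthwise coordinate `v` into a height difference
`P.e * (1 - v) / 2`. The right leg becomes a thin slanted slab in which abscissa and depth are
already correct and `v` is an affine function of the height. -/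
theorem box (hg : IsStraightening P g) {s y v : ℝ} (hs : |s| ≤ 1 - P.δ) (hy : |y| ≤ 1 - P.δ)
    (hv : 0 ≤ v) (hv1 : v ≤ 1) :
    g (place ((s + 1) / 2, y, v)) = (s, y, 1 / 2 + ((s + 1) / 8 - P.e * (1 - v) / 2)) ∧
    g (place (-((s + 1) / 2), y, v)) = (s, y, 1 / 2 - ((s + 1) / 8 - P.e * (1 - v) / 2)) := by
  have he := P.e_pos
  have he1 := P.e_le
  have he2 := P.e_eq
  have hδ := P.δ_pos
  have hδ1 := P.δ_le
  have hs' := abs_le.1 hs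
  have hk : tiltSize P.e P.K (-v / 2) y = P.e * (-v / 2 + 1 / 2) :=
    tiltSize_mid he (by linarith) P.K_le P.K_nonneg (by linarith) (by linarith) hy
  have hp : profile P.e (-v / 2) = P.e * (-v / 2 + 1 / 2) :=
    profile_mid he (by linarith) (by linarith) (by linarith)
  have hk1 : P.e * (-v / 2 + 1 / 2) ≤ P.e / 2 := by nlinarith
  have hk0 : 0 ≤ P.e * (-v / 2 + 1 / 2) := by apply mul_nonneg <;> linarith
  have e1 : ∀ t : ℝ, |t| = (s + 1) / 8 → g (-v / 2, y, 1 / 2 + t) =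
      (s, y, 1 / 2 + tilt (P.e * (-v / 2 + 1 / 2)) t) := fun t ht => by
    have := (hg.inner (x := -v / 2) (y := y) (t := t) (a := (s + 1) / 8) (by rw [hk]; linarith)
      (by rw [hk]; linarith) (by rw [hk, hp]; linarith)
      (by rwa [show 8 * ((s + 1) / 8) - 1 = s by ring])
      (abs_le.2 ⟨by linarith, by linarith⟩) hy).1
    rw [this, hk]
    rw [show 8 * ((s + 1) / 8) - 1 = s by ring]
  have e2 : tilt (P.e * (-v / 2 + 1 / 2)) ((s + 1) / 8) = (s + 1) / 8 - P.e * (1 - v) / 2 := by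
    rw [tilt_near hk0 (by linarith) (by linarith)]; ring
  have e3 : place ((s + 1) / 2, y, v) = (-v / 2, y, 1 / 2 + (s + 1) / 8) := by
    simp only [place]
    rw [Prod.mk.injEq, Prod.mk.injEq]; exact ⟨rfl, rfl, by ring⟩
  have e4 : place (-((s + 1) / 2), y, v) = (-v / 2, y, 1 / 2 + -((s + 1) / 8)) := by
    simp only [place]
    rw [Prod.mk.injEq, Prod.mk.injEq]; exact ⟨rfl, rfl, by ring⟩
  constructor
  · rw [e3, e1 _ (abs_of_nonneg (by linarith)), e2]
  · rw [e4, e1 _ (by rw [abs_neg]; exact abs_of_nonneg (by linarith)), tilt_neg hk0, e2,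
      ← sub_eq_add_neg]

end IsStraightening

/-- A vertical homeomorphism of the cylinder rel boundary with prescribed values, up to windows near
the boundary. -/
theorem exists_vertical_clip {η K : ℝ} (hη : 0 < η) (hη1 : η ≤ 1) (hK : 0 ≤ K) (F : E3 → ℝ)
    (hc : Continuous F) (hm : ∀ x y, StrictMono fun z => F (x, y, z)) :
    ∃ g : E3 ≃ₜ E3, (∀ q, q ∉ cylinderInterior → g q = q) ∧ ∀ q, g q = (q.1, q.2.1,
      (max (botW η K (min (1 - |q.1|) (1 - |q.2.1|)) (2 * q.2.2 - 1))
        (min (topW η K (min (1 - |q.1|) (1 - |q.2.1|)) (2 * q.2.2 - 1)) (2 * F q - 1)) + 1) / 2) := by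
  have hid : ∀ q : E3, (1 ≤ |2 * q.2.2 - 1| ∨ min (1 - |q.1|) (1 - |q.2.1|) ≤ 0) →
      (max (botW η K (min (1 - |q.1|) (1 - |q.2.1|)) (2 * q.2.2 - 1))
        (min (topW η K (min (1 - |q.1|) (1 - |q.2.1|)) (2 * q.2.2 - 1)) (2 * F q - 1)) + 1) / 2 =
        q.2.2 := fun q hq => by
    rw [topW_eq hη1 hK hq, botW_eq hη1 hK hq, max_eq_left (min_le_left _ _)]; ring
  obtain ⟨g, hg⟩ := exists_zHomeo (fun q =>
      (max (botW η K (min (1 - |q.1|) (1 - |q.2.1|)) (2 * q.2.2 - 1))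
        (min (topW η K (min (1 - |q.1|) (1 - |q.2.1|)) (2 * q.2.2 - 1)) (2 * F q - 1)) + 1) / 2)
    (by unfold botW topW; fun_prop)
    (fun x y a b hab => by
      have h1 := botW_strictMono (d := min (1 - |x|) (1 - |y|)) hη hK
        (show 2 * a - 1 < 2 * b - 1 by linarith)
      have h2 := topW_strictMono (d := min (1 - |x|) (1 - |y|)) hη hK
        (show 2 * a - 1 < 2 * b - 1 by linarith)
      have h3 := hm x y hab
      have := max_lt_max h1 (min_lt_min h2 (show 2 * F (x, y, a) - 1 < 2 * F (x, y, b) - 1 by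
        simp only at h3; linarith))
      simp only
      linarith) 1
    (fun x y z hz => hid (x, y, z) (Or.inl (by
      rcases le_abs.1 hz with h | h
      · exact le_abs.2 (Or.inl (by simp only; linarith))
      · exact le_abs.2 (Or.inr (by simp only; linarith)))))
  refine ⟨g, fun q hq => ?_, hg⟩
  rw [hg, hid q]
  by_contra! hcon
  obtain ⟨c1, c2⟩ := hcon
  rw [lt_min_iff, sub_pos, sub_pos, abs_lt, abs_lt] at c2
  rw [abs_lt] at c1
  exact hq ⟨c2.1, c2.2, by linarith, by linarith⟩

/-! ### Bending a string link placed on the right legs -/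

namespace StringLink

/-- The straightening `g` carries the bend to vertical lines, except for a copy of `σ` in a thin
slanted slab. A vertical shear `f` then expands the slab to full height and pushes everything below
or above it into the collars. -/
theorem bend_one_juxt {l : ℕ} (σ : StringLink l) : ((one l).juxt σ).bend.HomeoEq σ := by
  obtain ⟨ε, hε, hε1, hv, hm⟩ := exists_collar σ
  obtain ⟨δ₁, hδ₁, hδ₁', hm₁⟩ := exists_margin σ
  obtain ⟨δ₂, hδ₂, hδ₂', hm₂⟩ := exists_margin ((one l).juxt σ).bend
  obtain ⟨P, hP1, hP2, hPε⟩ : ∃ P : StraightParams, P.δ ≤ δ₁ ∧ P.δ ≤ δ₂ ∧ P.η ≤ ε := by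
    have h0 : 0 < min (1 / 8) (min δ₁ δ₂) := by positivity
    refine ⟨⟨min (1 / 8) (min δ₁ δ₂), min (1 / 8) (min δ₁ δ₂) / 16,
      min ε (min (1 / 8) (min δ₁ δ₂) / 2), 2 / min (1 / 8) (min δ₁ δ₂), h0, min_le_left _ _, rfl,
      by positivity, ?_, by positivity, ?_⟩, ?_, ?_, min_le_left _ _⟩
    · linarith [min_le_right ε (min (1 / 8) (min δ₁ δ₂) / 2)]
    · rw [div_mul_cancel₀ _ h0.ne']
    · exact (min_le_right _ _).trans (min_le_left _ _)
    · exact (min_le_right _ _).trans (min_le_right _ _)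
  have he := P.e_pos
  have he1 := P.e_le
  have he2 := P.e_eq
  have hδ := P.δ_pos
  have hδ1 := P.δ_le
  have hη := P.η_pos
  have hηδ := P.η_le
  obtain ⟨g, hgc, hg⟩ := P.exists_straighten
  have hg : IsStraightening P g := hg
  -- The affine function inverse to the height formula of `IsStraightening.box`: it recovers `v`.
  obtain ⟨f, hfc, hf⟩ := exists_vertical_clip (η := P.η) (K := P.K) hη (by linarith) P.K_nonneg
    (fun q => (q.2.2 - 1 / 2 - (q.1 + 1) / 8 + P.e / 2) * (2 / P.e)) (by fun_prop)
    (fun x y a b hab => mul_lt_mul_of_pos_right (by simp only; linarith) (by positivity))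
  have hpt : ∀ i : Fin l, |pt l i| ≤ 1 - P.δ := fun i =>
    ((hm₁ i (marked l i 0) (hm i 0 le_rfl zero_le_one (Or.inl hε.le))).1).trans (by linarith)
  have hoff : ∀ i : Fin l, P.δ / 8 ≤ off l i ∧ off l i ≤ 1 / 4 - P.δ / 8 := fun i => by
    have h := abs_le.1 (hpt i)
    unfold off
    constructor <;> linarith
  have heε : 0 < P.e * ε := by positivity
  have heε1 : P.e * ε < P.e / 2 := by nlinarith
  -- Bottom tail, left leg and arc all lie on this part of the vertical line, and `f` pushes it into
  -- the bottom collar. Backtracking is harmless, since only containment is needed.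
  have hlow : ∀ (i : Fin l) (t : ℝ), -(1 / 2) ≤ t → t ≤ off l i - P.e / 2 + P.e * ε / 2 →
      f (pt l i, 0, 1 / 2 + t) ∈ range (σ.strand i) := fun i t h0 ht => by
    obtain ⟨o1, o2⟩ := hoff i
    have hd : P.δ ≤ min (1 - |pt l i|) (1 - |(0 : ℝ)|) :=
      le_min (by linarith [hpt i]) (by rw [abs_zero]; linarith)
    rw [hf]
    have hF : (1 / 2 + t - 1 / 2 - (pt l i + 1) / 8 + P.e / 2) * (2 / P.e) ≤ ε := by
      rw [mul_div_assoc', div_le_iff₀ he]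
      unfold off at ht
      linarith
    refine hm i _ ?_ ?_ (Or.inl ?_)
    · have := neg_one_le_botW (K := P.K) (d := min (1 - |pt l i|) (1 - |(0 : ℝ)|)) hη.le
        (show -1 ≤ 2 * (1 / 2 + t) - 1 by linarith)
      have := this.trans (le_max_left _ (min (topW P.η P.K (min (1 - |pt l i|) (1 - |(0 : ℝ)|))
        (2 * (1 / 2 + t) - 1)) (2 * ((1 / 2 + t - 1 / 2 - (pt l i + 1) / 8 + P.e / 2) * (2 / P.e)) - 1)))
      simp only
      linarith
    all_goals
      have h1 : max (botW P.η P.K (min (1 - |pt l i|) (1 - |(0 : ℝ)|)) (2 * (1 / 2 + t) - 1))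
          (min (topW P.η P.K (min (1 - |pt l i|) (1 - |(0 : ℝ)|)) (2 * (1 / 2 + t) - 1))
          (2 * ((1 / 2 + t - 1 / 2 - (pt l i + 1) / 8 + P.e / 2) * (2 / P.e)) - 1)) ≤ -1 + 2 * ε :=
        max_le (botW_le_of P.K_le P.K_nonneg hη.le (by linarith) (by linarith) hd)
          ((min_le_right _ _).trans (by linarith))
      simp only
      linarith
  have hhigh : ∀ (i : Fin l) (t : ℝ), t ≤ 1 / 2 → off l i - P.e * ε / 2 ≤ t →
      f (pt l i, 0, 1 / 2 + t) ∈ range (σ.strand i) := fun i t h0 ht => by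
    obtain ⟨o1, o2⟩ := hoff i
    have hd : P.δ ≤ min (1 - |pt l i|) (1 - |(0 : ℝ)|) :=
      le_min (by linarith [hpt i]) (by rw [abs_zero]; linarith)
    rw [hf]
    have hF : 1 - ε ≤ (1 / 2 + t - 1 / 2 - (pt l i + 1) / 8 + P.e / 2) * (2 / P.e) := by
      rw [mul_div_assoc', le_div_iff₀ he]
      unfold off at ht
      linarith
    have h1 : 1 - 2 * ε ≤
        max (botW P.η P.K (min (1 - |pt l i|) (1 - |(0 : ℝ)|)) (2 * (1 / 2 + t) - 1))
          (min (topW P.η P.K (min (1 - |pt l i|) (1 - |(0 : ℝ)|)) (2 * (1 / 2 + t) - 1))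
          (2 * ((1 / 2 + t - 1 / 2 - (pt l i + 1) / 8 + P.e / 2) * (2 / P.e)) - 1)) :=
      le_max_of_le_right (le_min
        (le_topW_of P.K_le P.K_nonneg hη.le (by linarith) (by linarith) hd) (by linarith))
    refine hm i _ ?_ ?_ (Or.inr ?_)
    · simp only
      linarith
    · have h2 := topW_le_one (K := P.K) (d := min (1 - |pt l i|) (1 - |(0 : ℝ)|)) hη.le
        (show 2 * (1 / 2 + t) - 1 ≤ 1 by linarith)
      have h3 := botW_le (η := P.η) (K := P.K) (d := min (1 - |pt l i|) (1 - |(0 : ℝ)|))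
        (2 * (1 / 2 + t) - 1)
      have := max_le (h3.trans (by linarith)) ((min_le_left _ (2 * ((1 / 2 + t - 1 / 2 -
        (pt l i + 1) / 8 + P.e / 2) * (2 / P.e)) - 1)).trans h2)
      simp only
      linarith
    · simp only
      linarith
  refine ⟨g.trans f, fun q hq => ?_, fun i q hq => ?_⟩
  · rw [Homeomorph.trans_apply, hgc q hq, hfc q hq]
  obtain ⟨o1, o2⟩ := hoff i
  have hx : |q.1| ≤ 1 - P.δ := ((hm₂ i q hq).1).trans (by linarith)
  have hp := hpt i
  rw [Homeomorph.trans_apply]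
  rw [bend_range, juxt_range_left, juxt_range_right] at hq
  rcases hq with (((hq | hq) | hq) | hq) | hq
  · have h := tail_spec hq
    rw [hg.tail (Or.inl h) (by linarith) (by linarith) (by rwa [← pt_eq_off]) hx, ← pt_eq_off]
    have h1 := h.2.1
    have h2 := h.2.2.1
    have := hlow i (q.2.2 - 1 / 2) (by linarith) (by linarith)
    rwa [add_sub_cancel] at this
  · obtain ⟨_, ⟨p, hp', rfl⟩, rfl⟩ := hq
    obtain ⟨v, hv0, hv1, rfl⟩ := mem_one_iff.1 hp'
    have := (hg.box (y := 0) hp (by rw [abs_zero]; linarith) hv0 hv1).2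
    rw [show leftHalf (marked l i.rev v) = (-((pt l i + 1) / 2), 0, v) by
      simp only [leftHalf, marked, pt_rev]
      rw [Prod.mk.injEq]; exact ⟨by ring, rfl⟩, this, sub_eq_add_neg]
    have e1 : P.e * (1 - v) ≤ P.e := by nlinarith
    have e2 : 0 ≤ P.e * (1 - v) := by apply mul_nonneg <;> linarith
    have e3 : (pt l i + 1) / 8 = off l i := rfl
    exact hlow i _ (by linarith) (by linarith)
  · obtain ⟨t, h1, h2, h3⟩ := hg.arc (arc_spec hq) (by linarith) (by linarith) (by rwa [← pt_eq_off]) hx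
    rw [h3, ← pt_eq_off]
    exact hlow i t (by linarith) (by linarith)
  · obtain ⟨_, ⟨p, hp', rfl⟩, rfl⟩ := hq
    obtain ⟨x, y, v⟩ := p
    obtain ⟨hpx, hpy⟩ := hm₁ i _ hp'
    obtain ⟨-, -, ⟨hv0, hv1⟩, -⟩ := σ.mem_bounds hp'
    simp only at hpx hpy hv0 hv1
    have h := (hg.box (s := x) (y := y) (by linarith) (by linarith) hv0 hv1).1
    rw [show rightHalf (x, y, v) = ((x + 1) / 2, y, v) from rfl, h]
    have hxb := abs_le.1 hpx
    have e1 : P.e * (1 - v) ≤ P.e := by nlinarith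
    have e2 : 0 ≤ P.e * (1 - v) := by apply mul_nonneg <;> linarith
    have hd : P.δ ≤ min (1 - |x|) (1 - |y|) := le_min (by linarith) (by linarith)
    -- In the collars of `σ` the point is on the axis and only has to land in a collar; between them
    -- the windows are inactive and its height is exactly `v`.
    by_cases hve : v ≤ ε ∨ 1 - ε ≤ v
    · obtain ⟨hx', hy'⟩ := hv i _ hp' hve
      simp only at hx' hy'
      rw [hx', hy']
      have e3 : (pt l i + 1) / 8 = off l i := rfl
      rcases hve with hve | hve
      · have : P.e * v ≤ P.e * ε := by gcongr
        exact hlow i _ (by linarith) (by linarith)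
      · have : P.e * (1 - v) ≤ P.e * ε := mul_le_mul_of_nonneg_left (by linarith) he.le
        exact hhigh i _ (by linarith) (by linarith)
    · push Not at hve
      have e3 : (1 / 2 + ((x + 1) / 8 - P.e * (1 - v) / 2) - 1 / 2 - (x + 1) / 8 + P.e / 2) *
          (2 / P.e) = v := by field_simp; ring
      rw [hf]
      simp only
      rw [e3, max_min_eq, show (2 * v - 1 + 1) / 2 = v by ring]
      · exact hp'
      · exact botW_le_of P.K_le P.K_nonneg hη.le (by linarith) (by linarith) hd
      · exact le_topW_of P.K_le P.K_nonneg hη.le (by linarith) (by linarith) hd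
  · have h := high_spec hq
    rw [hg.tail (Or.inr h) (by linarith) (by linarith) (by rwa [← pt_eq_off]) hx, ← pt_eq_off]
    have h1 := h.2.1
    have h2 := h.2.2.1
    simp only [flip] at h1 h2
    have := hhigh i (q.2.2 - 1 / 2) (by linarith) (by linarith)
    rwa [add_sub_cancel] at this

end StringLink

/-! ### Straightening a snake

The following maps take a cup followed by a bent string link to the cup followed by the string link
itself.  They are written in coordinates in which the strings are in the slab `|x| ≤ 2`. -/

/-- The part of space where the snake is straightened. -/
def snakeBox : Set E3 := {q | |q.1| < 40 ∧ |q.2.1| < 1 ∧ -3 < q.2.2 ∧ q.2.2 < 1}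

theorem notMem_snakeBox {q : E3} (h : q ∉ snakeBox) :
    40 ≤ |q.1| ∨ 1 ≤ |q.2.1| ∨ q.2.2 ≤ -3 ∨ 1 ≤ q.2.2 := by
  by_contra! hcon
  exact h hcon

/-- The interpolation parameter of the outer parts of the tails. -/
noncomputable def snakeTilt (z : ℝ) : ℝ := max 0 (min 1 (8 * min z (1 - z) - 1))

/-- The displacement of the middle parts of the tails. -/
noncomputable def snakeLift (z : ℝ) : ℝ := max 0 (min (8 * z) (min (4 * z + 1) (28 - 32 * z)))

theorem snakeTilt_le (z : ℝ) : snakeTilt z ≤ 1 := max_le zero_le_one (min_le_left _ _)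

/-- A shear in `x`, confined to `x ≥ 0`. The quotient undoes the slant of the tails, and the lift
then spaces out the pieces of the snake so that their later abscissas and heights can be read from
`x` and `z`. The lines of slope `p / 4` and `40 / p` only keep the half-space `x ≤ 0` fixed. -/
theorem exists_snakeSpread {p K : ℝ} (hp : 0 < p) (hp1 : p ≤ 1) (hK : 0 ≤ K) :
    ∃ f : E3 ≃ₜ E3, (∀ q ∉ snakeBox, f q = q) ∧ (∀ q : E3, q.1 ≤ 0 → f q = q) ∧
      ∀ x y z w, 0 ≤ x → x ≤ 2 → 30 ≤ K * (1 - |y|) → p / 4 * x ≤ w → w ≤ 40 / p * x → w ≤ 28 →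
        (x - snakeTilt z / 4) / (1 - 7 * snakeTilt z / 8) + snakeLift z = w →
          f (x, y, z) = (w, y, z) := by
  have hd : ∀ z, 0 < 1 - 7 * snakeTilt z / 8 := fun z => by linarith [snakeTilt_le z]
  let F : E3 → ℝ := fun q => max (min q.1 (p / 4 * q.1)) (min (40 / p * q.1)
    ((q.1 - snakeTilt q.2.2 / 4) / (1 - 7 * snakeTilt q.2.2 / 8) + snakeLift q.2.2))
  let B : E3 → ℝ := fun q => min q.1 (max (p / 4 * q.1) (max (3 * q.1 - 60) (q.1 - K * (1 - |q.2.1|))))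
  let T : E3 → ℝ := fun q => max q.1 (min (28 + q.1 / 15) (q.1 + K * (1 - |q.2.1|)))
  have hB : ∀ q, B q ≤ q.1 := fun q => min_le_left _ _
  have hT : ∀ q, q.1 ≤ T q := fun q => le_max_left _ _
  have hM : 1 ≤ 40 / p := by rw [le_div_iff₀ hp]; linarith
  have hneg : ∀ q : E3, q.1 ≤ 0 → F q = q.1 := fun q hq => by
    simp only [F]
    rw [min_eq_left (by nlinarith), max_eq_left ((min_le_left _ _).trans (by nlinarith))]
  have hid : ∀ q : E3, (40 ≤ |q.1| ∨ q.1 ≤ 0 ∨ 1 ≤ |q.2.1| ∨ q.2.2 ≤ 0 ∨ 7 / 8 ≤ q.2.2) →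
      max (B q) (min (T q) (F q)) = q.1 := by
    have h1 : ∀ q, F q = q.1 → max (B q) (min (T q) (F q)) = q.1 := fun q h => by
      rw [h, max_min_eq (hB q) (hT q)]
    have h2 : ∀ q, B q = q.1 → T q = q.1 → max (B q) (min (T q) (F q)) = q.1 := fun q h h' => by
      rw [h, h', max_eq_left (min_le_left _ _)]
    have h3 : ∀ q : E3, snakeTilt q.2.2 = 0 → snakeLift q.2.2 = 0 → F q = q.1 := fun q h h' => by
      rcases le_total q.1 0 with h0 | h0
      · exact hneg q h0
      · simp only [F]
        rw [h, h', min_eq_right (by nlinarith), min_eq_right (by norm_num; nlinarith)]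
        norm_num
        nlinarith
    intro q h
    rcases le_total q.1 0 with h0 | h0
    · exact h1 q (hneg q h0)
    rcases h with h | h | h | h | h
    · rw [abs_of_nonneg h0] at h
      exact h2 q (min_eq_left (le_max_of_le_right (le_max_of_le_left (by linarith))))
        (max_eq_left ((min_le_left _ _).trans (by linarith)))
    · exact h1 q (hneg q h)
    · exact h2 q (min_eq_left (le_max_of_le_right (le_max_of_le_right (by nlinarith))))
        (max_eq_left ((min_le_right _ _).trans (by nlinarith)))
    · refine h1 q (h3 q (max_eq_left ((min_le_right _ _).trans ?_)) (max_eq_left ((min_le_left _ _).trans ?_)))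
      · linarith [min_le_left q.2.2 (1 - q.2.2)]
      · linarith
    · refine h1 q (h3 q (max_eq_left ((min_le_right _ _).trans ?_)) (max_eq_left ((min_le_right _ _).trans
        ((min_le_right _ _).trans ?_))))
      · linarith [min_le_right q.2.2 (1 - q.2.2)]
      · linarith
  have ht : Continuous snakeTilt := by unfold snakeTilt; fun_prop
  have hl : Continuous snakeLift := by unfold snakeLift; fun_prop
  have hF : Continuous F := by
    refine Continuous.max (by fun_prop) (Continuous.min (by fun_prop) (Continuous.add ?_ (by fun_prop)))
    exact Continuous.div (by fun_prop) (by fun_prop) (fun q => (hd q.2.2).ne')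
  obtain ⟨f, hf⟩ := exists_xHomeo (fun q => max (B q) (min (T q) (F q)))
    (by simp only [B, T]; fun_prop)
    (fun y z => strictMono_clip (b := fun x => B (x, y, z)) (t := fun x => T (x, y, z))
      (f := fun x => F (x, y, z))
      (fun a b h => min_lt_min h (max_lt_max (by simp only; nlinarith)
        (max_lt_max (by simp only; linarith) (by simp only; linarith))))
      (fun a b h => max_lt_max h (min_lt_min (by simp only; linarith) (by simp only; linarith)))
      (fun a b h => max_lt_max (min_lt_min h (by simp only; nlinarith)) (min_lt_min
        (by simp only; nlinarith) (by
          have := hd z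
          have : (a - snakeTilt z / 4) / (1 - 7 * snakeTilt z / 8) <
            (b - snakeTilt z / 4) / (1 - 7 * snakeTilt z / 8) := by gcongr
          simp only; linarith)))) 40
    (fun x y z hx => hid (x, y, z) (Or.inl hx))
  refine ⟨f, fun q hq => ?_, fun q hq => ?_, fun x y z w h0 h2 hK hw hw' hw'' h => ?_⟩
  · rw [hf, hid]
    rcases notMem_snakeBox hq with h | h | h | h
    · exact Or.inl h
    · exact Or.inr (Or.inr (Or.inl h))
    · exact Or.inr (Or.inr (Or.inr (Or.inl (by linarith))))
    · exact Or.inr (Or.inr (Or.inr (Or.inr (by linarith))))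
  · rw [hf, hid q (Or.inr (Or.inl hq))]
  · have : F (x, y, z) = w := by
      simp only [F]
      rw [h, min_eq_right hw', min_eq_right (by nlinarith), max_eq_right hw]
    rw [hf]
    refine Prod.ext ?_ rfl
    simp only
    rw [this, max_min_eq]
    · refine (min_le_right _ _).trans (max_le hw (max_le ?_ ?_)) <;> simp only <;> nlinarith
    · refine le_max_of_le_right (le_min ?_ ?_) <;> simp only <;> linarith

/-- The level function of the spread snake. -/
noncomputable def snakeLevel (p x z : ℝ) : ℝ :=
  min (max (8 * min z (1 / 2) - 4) (max (2 * min z (1 / 2)) (max (8 * min z (1 / 2))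
      (12 * min z (1 / 2) - 1)) - x)) (p / 8 * (2 * min z (1 / 2) - 1)) +
    max (min (8 * max z (1 / 2) - 4) (max (4 * max z (1 / 2) - 7) (32 * max z (1 / 2) - 28) + x))
      (p / 8 * (2 * max z (1 / 2) - 1))

/-- The level is the future abscissa. The multiple of `2 * z - 1` forces it to be negative below
`1/2` and positive above, which separates the two halves of the strings; `8 * z - 4` is for the box
and the arcs, the terms with `x` for the tails. -/
theorem snakeLevel_low {p x z : ℝ} (hz : z ≤ 1 / 2) : snakeLevel p x z =
    min (max (8 * z - 4) (max (2 * z) (max (8 * z) (12 * z - 1)) - x)) (p / 8 * (2 * z - 1)) := by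
  unfold snakeLevel
  rw [min_eq_left hz, max_eq_right hz, max_eq_right ((min_le_left _ _).trans (by linarith))]
  ring

theorem snakeLevel_high {p x z : ℝ} (hz : 1 / 2 ≤ z) : snakeLevel p x z =
    max (min (8 * z - 4) (max (4 * z - 7) (32 * z - 28) + x)) (p / 8 * (2 * z - 1)) := by
  unfold snakeLevel
  rw [min_eq_right hz, max_eq_left hz, min_eq_right (le_max_of_le_left (by linarith))]
  ring

theorem snakeLevel_strictMono {p : ℝ} (hp : 0 < p) (x : ℝ) : StrictMono (snakeLevel p x) := by
  have hL : StrictMono fun a : ℝ => min (max (8 * a - 4) (max (2 * a) (max (8 * a) (12 * a - 1)) - x))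
      (p / 8 * (2 * a - 1)) := fun a b h => by
    refine min_lt_min (max_lt_max (by linarith) ?_) (by nlinarith)
    have : max (2 * a) (max (8 * a) (12 * a - 1)) < max (2 * b) (max (8 * b) (12 * b - 1)) :=
      max_lt_max (by linarith) (max_lt_max (by linarith) (by linarith))
    linarith
  have hR : StrictMono fun b : ℝ => max (min (8 * b - 4) (max (4 * b - 7) (32 * b - 28) + x))
      (p / 8 * (2 * b - 1)) := fun a b h => by
    refine max_lt_max (min_lt_min (by linarith) ?_) (by nlinarith)
    have : max (4 * a - 7) (32 * a - 28) < max (4 * b - 7) (32 * b - 28) :=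
      max_lt_max (by linarith) (by linarith)
    linarith
  intro a b h
  rcases lt_or_ge a (1 / 2) with h' | h'
  · have h1 := hL (show min a (1 / 2) < min b (1 / 2) by
      rw [min_eq_left h'.le]; exact lt_min h h')
    exact add_lt_add_of_lt_of_le h1 (hR.monotone (max_le_max_right _ h.le))
  · have h1 := hR (show max a (1 / 2) < max b (1 / 2) by
      rw [max_eq_left h', max_eq_left (h'.trans h.le)]; exact h)
    exact add_lt_add_of_le_of_lt (hL.monotone (min_le_min_right _ h.le)) h1

theorem snakeLevel_le {p x z : ℝ} (hp1 : p ≤ 1) (hz : 1 / 2 ≤ z) :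
    snakeLevel p x z ≤ 8 * z - 4 := by
  rw [snakeLevel_high hz]
  exact max_le (min_le_left _ _) (by nlinarith)

/-- This shear and the next two together act like a quarter turn. Here the horizontal displacement
`d` still to be made is recorded in the height; the factor `1/96` is so small that at `1 ≤ z` the
recorded height never exceeds `z`, and those points stay fixed. -/
theorem exists_snakeRaise {p K : ℝ} (hp : 0 < p) (hp1 : p ≤ 1) (hK : 0 ≤ K) :
    ∃ f : E3 ≃ₜ E3, (∀ q ∉ snakeBox, f q = q) ∧
      ∀ x y z u d w, |x| ≤ 20 → -1 ≤ z → 30 ≤ K * (1 - |y|) → 30 ≤ K →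
        snakeLevel p (max x 0) z = u → min (max (2 * z) u) (u + max (-x) 0) - max x 0 = d →
        max z (7 / 8 + d / 96) = w → w ≤ 10 → f (x, y, z) = (x, y, w) := by
  let D : E3 → ℝ := fun q => min (max (2 * q.2.2) (snakeLevel p (max q.1 0) q.2.2))
    (snakeLevel p (max q.1 0) q.2.2 + max (-q.1) 0) - max q.1 0
  let T : E3 → ℝ := fun q => min (q.2.2 + 20 * (q.2.2 + 3))
    (min (q.2.2 + K * (1 - |q.2.1|)) (q.2.2 + K * (40 - |q.1|)))
  have hD : Continuous D := by simp only [D]; unfold snakeLevel; fun_prop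
  have hone : ∀ q : E3, 1 ≤ q.2.2 → 7 / 8 + D q / 96 ≤ q.2.2 := fun q hq => by
    have h1 : snakeLevel p (max q.1 0) q.2.2 ≤ 8 * q.2.2 - 4 := snakeLevel_le hp1 (by linarith)
    have h2 : min (max (2 * q.2.2) (snakeLevel p (max q.1 0) q.2.2))
      (snakeLevel p (max q.1 0) q.2.2 + max (-q.1) 0) ≤ 8 * q.2.2 :=
      (min_le_left _ _).trans (max_le (by linarith) (by linarith))
    have h3 : 0 ≤ max q.1 0 := le_max_right _ _
    simp only [D]
    linarith
  have hid : ∀ q : E3, (40 ≤ |q.1| ∨ 1 ≤ |q.2.1| ∨ q.2.2 ≤ -3 ∨ 1 ≤ q.2.2) →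
      max q.2.2 (min (T q) (7 / 8 + D q / 96)) = q.2.2 := fun q h => by
    refine max_eq_left ?_
    rcases h with h | h | h | h
    · exact (min_le_left _ _).trans ((min_le_right _ _).trans ((min_le_right _ _).trans (by nlinarith)))
    · exact (min_le_left _ _).trans ((min_le_right _ _).trans ((min_le_left _ _).trans (by nlinarith)))
    · exact (min_le_left _ _).trans ((min_le_left _ _).trans (by linarith))
    · exact (min_le_right _ _).trans (hone q h)
  obtain ⟨f, hf⟩ := exists_zHomeo (fun q => max q.2.2 (min (T q) (7 / 8 + D q / 96)))
    (by simp only [T]; fun_prop)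
    (fun x y a b h => by
      have h1 := snakeLevel_strictMono hp (max x 0) h
      refine max_lt_max h (min_lt_min (min_lt_min ?_ (min_lt_min ?_ ?_)) ?_)
      · simp only; linarith
      · simp only; linarith
      · simp only; linarith
      · have : min (max (2 * a) (snakeLevel p (max x 0) a)) (snakeLevel p (max x 0) a + max (-x) 0) <
            min (max (2 * b) (snakeLevel p (max x 0) b)) (snakeLevel p (max x 0) b + max (-x) 0) :=
          min_lt_min (max_lt_max (by linarith) h1) (by linarith)
        simp only [D]
        linarith) 3
    (fun x y z hz => hid (x, y, z) (by
      rcases le_abs.1 hz with h | h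
      · exact Or.inr (Or.inr (Or.inr (by simp only; linarith)))
      · exact Or.inr (Or.inr (Or.inl (by simp only; linarith)))))
  refine ⟨f, fun q hq => by rw [hf, hid q (notMem_snakeBox hq)],
    fun x y z u d w hx hz hy hK hu hd hw hw' => ?_⟩
  rw [hf]
  refine Prod.ext rfl (Prod.ext rfl ?_)
  have : D (x, y, z) = d := by simp only [D]; rw [hu, hd]
  simp only
  rw [this]
  have h1 : w ≤ z + 20 * (z + 3) := by linarith
  have h2 : 7 / 8 + d / 96 ≤ T (x, y, z) := by
    have h3 : 7 / 8 + d / 96 ≤ w := hw ▸ le_max_right _ _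
    refine le_min ?_ (le_min ?_ ?_) <;> simp only <;> nlinarith
  rw [min_eq_right h2, hw]

/-- The displacement recorded as a defect of the height from `7/8` is carried out horizontally.
Points above `7/8` do not move. -/
theorem exists_snakePull {K : ℝ} (hK : 0 ≤ K) :
    ∃ f : E3 ≃ₜ E3, (∀ q ∉ snakeBox, f q = q) ∧
      ∀ x y z w, |x| ≤ 20 → -1 ≤ z → 30 ≤ K * (1 - |y|) → 30 ≤ K →
        x - 96 * max 0 (7 / 8 - z) = w → -10 ≤ w → f (x, y, z) = (w, y, z) := by
  let B : E3 → ℝ := fun q => min q.1 (max (-40 + (q.1 + 40) / 4) (max (3 * q.1 - 80)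
    (max (q.1 - K * (1 - |q.2.1|)) (q.1 - K * (q.2.2 + 3)))))
  have hid : ∀ q : E3, (40 ≤ |q.1| ∨ 1 ≤ |q.2.1| ∨ q.2.2 ≤ -3 ∨ 1 ≤ q.2.2) →
      max (B q) (q.1 - 96 * max 0 (7 / 8 - q.2.2)) = q.1 := fun q h => by
    have h0 : q.1 - 96 * max 0 (7 / 8 - q.2.2) ≤ q.1 := by
      linarith [le_max_left 0 (7 / 8 - q.2.2)]
    have h1 : B q = q.1 → max (B q) (q.1 - 96 * max 0 (7 / 8 - q.2.2)) = q.1 := fun h => by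
      rw [h, max_eq_left h0]
    rcases h with h | h | h | h
    · rcases le_abs.1 h with h | h
      · exact h1 (min_eq_left (le_max_of_le_right (le_max_of_le_left (by linarith))))
      · exact h1 (min_eq_left (le_max_of_le_left (by linarith)))
    · exact h1 (min_eq_left (le_max_of_le_right (le_max_of_le_right (le_max_of_le_left (by nlinarith)))))
    · exact h1 (min_eq_left (le_max_of_le_right (le_max_of_le_right (le_max_of_le_right (by nlinarith)))))
    · rw [max_eq_left (by linarith : 7 / 8 - q.2.2 ≤ 0), mul_zero, sub_zero,
        max_eq_right (min_le_left _ _)]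
  obtain ⟨f, hf⟩ := exists_xHomeo (fun q => max (B q) (q.1 - 96 * max 0 (7 / 8 - q.2.2)))
    (by simp only [B]; fun_prop)
    (fun y z a b h => max_lt_max (min_lt_min h (max_lt_max (by simp only; linarith) (max_lt_max
      (by simp only; linarith) (max_lt_max (by simp only; linarith) (by simp only; linarith)))))
      (by simp only; linarith)) 40
    (fun x y z hx => hid (x, y, z) (Or.inl hx))
  refine ⟨f, fun q hq => by rw [hf, hid q (notMem_snakeBox hq)], fun x y z w hx hz hy hK hw hw' => ?_⟩
  have hx := abs_le.1 hx
  rw [hf]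
  refine Prod.ext ?_ rfl
  simp only
  rw [hw, max_eq_right]
  refine (min_le_right _ _).trans (max_le ?_ (max_le ?_ (max_le ?_ ?_))) <;> simp only <;> nlinarith

/-- The final heights are restored: division by `4` on the side of the string link and by `2` on the
side of the cups. Heights near `1` are only controlled up to the collar, which suffices because the
target strings are vertical there. -/
theorem exists_snakeLower {e K : ℝ} (he : 0 < e) (he1 : e ≤ 1) (hK : 0 ≤ K) :
    ∃ f : E3 ≃ₜ E3, (∀ q ∉ snakeBox, f q = q) ∧
      ∀ x y z n, |x| ≤ 10 → -1 ≤ z → z ≤ 1 → 30 ≤ K * (1 - |y|) → 30 ≤ K →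
        min ((96 * (z - 7 / 8) + 9 - x / 2) / 4) ((96 * (z - 7 / 8) + 9 - x / 2) / 2) = n →
        -2 ≤ n → (n ≤ 1 - 2 * e → f (x, y, z) = (x, y, n)) ∧
          (∀ ε, 2 * e ≤ ε → 1 - ε ≤ n → ∃ w, 1 - ε ≤ w ∧ w ≤ 1 ∧ f (x, y, z) = (x, y, w)) := by
  let N : E3 → ℝ := fun q => min ((96 * (q.2.2 - 7 / 8) + 9 - q.1 / 2) / 4)
    ((96 * (q.2.2 - 7 / 8) + 9 - q.1 / 2) / 2)
  let T : E3 → ℝ := fun q => max q.2.2 (min (1 - e * (1 - q.2.2)) (min (q.2.2 + K * (1 - |q.2.1|))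
    (q.2.2 + K * (20 - |q.1|))))
  let B : E3 → ℝ := fun q => min q.2.2 (max (-3 + (q.2.2 + 3) / 20) (max (q.2.2 - K * (1 - |q.2.1|))
    (q.2.2 - K * (20 - |q.1|))))
  have hid : ∀ q : E3, (20 ≤ |q.1| ∨ 1 ≤ |q.2.1| ∨ q.2.2 ≤ -3 ∨ 1 ≤ q.2.2) →
      max (B q) (min (T q) (N q)) = q.2.2 := fun q h => by
    have h1 : B q = q.2.2 → T q = q.2.2 → max (B q) (min (T q) (N q)) = q.2.2 := fun h h' => by
      rw [h, h', max_eq_left (min_le_left _ _)]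
    rcases le_or_gt 20 |q.1| with h' | h'
    · exact h1 (min_eq_left (le_max_of_le_right (le_max_of_le_right (by nlinarith))))
        (max_eq_left ((min_le_right _ _).trans ((min_le_right _ _).trans (by nlinarith))))
    have h' := abs_lt.1 h'
    rcases h with h | h | h | h
    · linarith
    · exact h1 (min_eq_left (le_max_of_le_right (le_max_of_le_left (by nlinarith))))
        (max_eq_left ((min_le_right _ _).trans ((min_le_left _ _).trans (by nlinarith))))
    · have hB : B q = q.2.2 := min_eq_left (le_max_of_le_left (by linarith))
      rw [hB]
      exact max_eq_left ((min_le_right _ _).trans ((min_le_right _ _).trans (by linarith)))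
    · have hT : T q = q.2.2 := max_eq_left ((min_le_left _ _).trans (by nlinarith))
      rw [hT, min_eq_left (le_min (by linarith) (by linarith))]
      exact max_eq_right (min_le_left _ _)
  obtain ⟨f, hf⟩ := exists_zHomeo (fun q => max (B q) (min (T q) (N q)))
    (by simp only [B, T, N]; fun_prop)
    (fun x y a b h => max_lt_max (min_lt_min h (max_lt_max (by simp only; linarith) (max_lt_max
      (by simp only; linarith) (by simp only; linarith))))
      (min_lt_min (max_lt_max h (min_lt_min (by simp only; nlinarith) (min_lt_min
      (by simp only; linarith) (by simp only; linarith))))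
      (min_lt_min (by simp only; linarith) (by simp only; linarith)))) 3
    (fun x y z hz => hid (x, y, z) (by
      rcases le_abs.1 hz with h | h
      · exact Or.inr (Or.inr (Or.inr (by simp only; linarith)))
      · exact Or.inr (Or.inr (Or.inl (by simp only; linarith)))))
  refine ⟨f, fun q hq => by rw [hf, hid q ((notMem_snakeBox hq).imp_left fun h => by linarith)],
    fun x y z n hx hz hz1 hy hK hn hn' => ?_⟩
  have hB : B (x, y, z) ≤ -2 := by
    refine (min_le_right _ _).trans (max_le ?_ (max_le ?_ ?_)) <;> simp only <;> nlinarith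
  have hT : 1 - 2 * e ≤ T (x, y, z) := by
    refine le_max_of_le_right (le_min ?_ (le_min ?_ ?_)) <;> simp only <;> nlinarith
  have hT1 : T (x, y, z) ≤ 1 := max_le hz1 ((min_le_left _ _).trans (by simp only; nlinarith))
  have hN : N (x, y, z) = n := hn
  refine ⟨fun h => ?_, fun ε hε h => ⟨_, ?_, ?_, hf _⟩⟩
  · rw [hf]
    refine Prod.ext rfl (Prod.ext rfl ?_)
    simp only
    rw [hN, max_min_eq (by linarith) (by linarith)]
  · exact le_max_of_le_right (le_min (by linarith) (by rw [hN]; exact h))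
  · exact max_le (by linarith) ((min_le_left _ _).trans hT1)


theorem snakeTilt_mid {z : ℝ} (h : 1 / 4 ≤ z) (h' : z ≤ 3 / 4) : snakeTilt z = 1 := by
  unfold snakeTilt
  have : 1 / 4 ≤ min z (1 - z) := le_min h (by linarith)
  rw [min_eq_left (by linarith), max_eq_right zero_le_one]

theorem snakeTilt_side {z : ℝ} (h : 1 / 8 ≤ min z (1 - z)) (h' : min z (1 - z) ≤ 1 / 4) :
    snakeTilt z = 8 * min z (1 - z) - 1 := by
  unfold snakeTilt
  rw [min_eq_right (by linarith), max_eq_right (by linarith)]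

theorem snakeTilt_far {z : ℝ} (h : min z (1 - z) ≤ 1 / 8) : snakeTilt z = 0 := by
  unfold snakeTilt
  exact max_eq_left ((min_le_right _ _).trans (by linarith))

theorem snakeLift_low {z : ℝ} (h : 0 ≤ z) (h' : z ≤ 1 / 4) : snakeLift z = 8 * z := by
  unfold snakeLift
  rw [min_eq_left (le_min (by linarith) (by linarith)), max_eq_right (by linarith)]

theorem snakeLift_mid {z : ℝ} (h : 1 / 4 ≤ z) (h' : z ≤ 3 / 4) : snakeLift z = 4 * z + 1 := by
  unfold snakeLift
  rw [min_eq_left (by linarith : 4 * z + 1 ≤ 28 - 32 * z), min_eq_right (by linarith),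
    max_eq_right (by linarith)]

theorem snakeLift_high {z : ℝ} (h : 3 / 4 ≤ z) (h' : z ≤ 7 / 8) : snakeLift z = 28 - 32 * z := by
  unfold snakeLift
  rw [min_eq_right (by linarith : 28 - 32 * z ≤ 4 * z + 1), min_eq_right (by linarith),
    max_eq_right (by linarith)]

theorem snakeLift_far {z : ℝ} (h : 7 / 8 ≤ z) : snakeLift z = 0 := by
  unfold snakeLift
  exact max_eq_left ((min_le_right _ _).trans ((min_le_right _ _).trans (by linarith)))

theorem snakeLevel_low_eq {p x z u : ℝ} (hz : z ≤ 1 / 2)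
    (h : max (8 * z - 4) (max (2 * z) (max (8 * z) (12 * z - 1)) - x) = u)
    (hu : u ≤ p / 8 * (2 * z - 1)) : snakeLevel p x z = u := by
  rw [snakeLevel_low hz, h, min_eq_left hu]

theorem snakeLevel_high_eq {p x z u : ℝ} (hz : 1 / 2 ≤ z)
    (h : min (8 * z - 4) (max (4 * z - 7) (32 * z - 28) + x) = u)
    (hu : p / 8 * (2 * z - 1) ≤ u) : snakeLevel p x z = u := by
  rw [snakeLevel_high hz, h, max_eq_left hu]

/-- The three shears combined. Points whose recorded displacement is nonnegative, or which are
already above `7/8`, are not pulled and go to the top collar. The left half of the old cup is pulled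
onto the line `x = -c`. Elsewhere a point goes to abscissa `u` and a height depending on `W = u / 2
- x + 9`. -/
theorem exists_snakeSlide {p ε : ℝ} (hp : 0 < p) (hp1 : p ≤ 1) (hε : 0 < ε) (hε1 : ε ≤ 1) :
    ∃ g : E3 ≃ₜ E3, (∀ q ∉ snakeBox, g q = q) ∧
      (∀ x z d, |x| ≤ 2 → 0 ≤ z → z ≤ 1 → d ≤ 4 → (0 ≤ d ∨ 7 / 8 ≤ z) →
        min (max (2 * z) (snakeLevel p (max x 0) z)) (snakeLevel p (max x 0) z + max (-x) 0) -
          max x 0 = d → ∃ w, 1 - ε ≤ w ∧ w ≤ 1 ∧ g (x, 0, z) = (x, 0, w)) ∧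
      (∀ c x, p ≤ c → c ≤ 2 → x ≤ 0 → -c ≤ x →
        ∃ w, 1 - ε ≤ w ∧ w ≤ 1 ∧ g (x, 0, (-x - c) / 2) = (-c, 0, w)) ∧
      (∀ x y z u W, 0 ≤ x → x ≤ 12 → -1 ≤ z → z ≤ 7 / 8 + (u - x) / 96 → |y| ≤ 1 - p →
        snakeLevel p x z = u → u ≤ x → |u| ≤ 4 → u / 2 - x + 9 = W → -2 ≤ W →
        (W ≤ 0 → g (x, y, z) = (u, y, W / 2)) ∧
        (0 ≤ W → W / 4 ≤ 1 - ε → g (x, y, z) = (u, y, W / 4)) ∧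
        (1 - ε ≤ W / 4 → ∃ w, 1 - ε ≤ w ∧ w ≤ 1 ∧ g (x, y, z) = (u, y, w))) := by
  have hK : 0 ≤ 60 / p := by positivity
  have hK30 : 30 ≤ 60 / p := by rw [le_div_iff₀ hp]; linarith
  have hKy : ∀ y : ℝ, |y| ≤ 1 - p → 30 ≤ 60 / p * (1 - |y|) := fun y hy => by
    rw [div_mul_eq_mul_div, le_div_iff₀ hp]; linarith
  have hK0 : 30 ≤ 60 / p * (1 - |(0 : ℝ)|) := by rw [abs_zero]; linarith
  obtain ⟨f₂, o₂, h₂⟩ := exists_snakeRaise hp hp1 hK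
  obtain ⟨f₃, o₃, h₃⟩ := exists_snakePull hK
  obtain ⟨f₄, o₄, h₄⟩ := exists_snakeLower (e := ε / 2) (by linarith) (by linarith) hK
  have core : ∀ x y z u, 0 ≤ x → x ≤ 12 → -1 ≤ z → z ≤ 7 / 8 + (u - x) / 96 → 30 ≤ 60 / p * (1 - |y|) →
      snakeLevel p x z = u → u ≤ x → -10 ≤ u → f₃ (f₂ (x, y, z)) = (u, y, 7 / 8 + (u - x) / 96) := by
    intro x y z u h0 hx hz hz1 hy hl hu hu'
    have hx' : |x| ≤ 20 := abs_le.2 ⟨by linarith, by linarith⟩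
    rw [h₂ x y z u (u - x) (7 / 8 + (u - x) / 96) hx' hz hy hK30 (by rw [max_eq_left h0, hl])
      (by rw [max_eq_right (by linarith : -x ≤ 0), max_eq_left h0, add_zero,
        min_eq_right (le_max_right _ _)]) (max_eq_right hz1) (by linarith)]
    exact h₃ _ _ _ _ hx' (by linarith) hy hK30 (by rw [max_eq_right (by linarith)]; ring) hu'
  have keep : ∀ x z d, |x| ≤ 2 → 0 ≤ z → z ≤ 1 → d ≤ 4 → (0 ≤ d ∨ 7 / 8 ≤ z) →
      min (max (2 * z) (snakeLevel p (max x 0) z)) (snakeLevel p (max x 0) z + max (-x) 0) -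
        max x 0 = d → ∃ w, 1 - ε ≤ w ∧ w ≤ 1 ∧ f₄ (f₃ (f₂ (x, 0, z))) = (x, 0, w) := by
    intro x z d hx hz hz1 hd hd' h
    have hw : max z (7 / 8 + d / 96) ≤ 1 := max_le hz1 (by linarith)
    have hw' : 7 / 8 ≤ max z (7 / 8 + d / 96) := by
      rcases hd' with h | h
      · exact le_max_of_le_right (by linarith)
      · exact le_max_of_le_left h
    rw [h₂ x 0 z _ d _ (by linarith) (by linarith) hK0 hK30 rfl h rfl (by linarith),
      h₃ x 0 _ x (by linarith) (by linarith) hK0 hK30 (by rw [max_eq_left (by linarith)]; ring)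
        (by linarith [(abs_le.1 hx).1])]
    have hx2 := abs_le.1 hx
    have hn : 1 ≤ min ((96 * (max z (7 / 8 + d / 96) - 7 / 8) + 9 - x / 2) / 4)
        ((96 * (max z (7 / 8 + d / 96) - 7 / 8) + 9 - x / 2) / 2) := le_min (by linarith) (by linarith)
    exact (h₄ x 0 _ _ (by linarith) (by linarith) hw hK0 hK30 rfl (by linarith)).2 ε (by linarith)
      (by linarith)
  have lower : ∀ u y W, |u| ≤ 4 → 30 ≤ 60 / p * (1 - |y|) → W + u / 2 ≤ 9 → -2 ≤ W →
      (W ≤ 0 → f₄ (u, y, 7 / 8 + (W + u / 2 - 9) / 96) = (u, y, W / 2)) ∧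
      (0 ≤ W → W / 4 ≤ 1 - ε → f₄ (u, y, 7 / 8 + (W + u / 2 - 9) / 96) = (u, y, W / 4)) ∧
      (1 - ε ≤ W / 4 → ∃ w, 1 - ε ≤ w ∧ w ≤ 1 ∧ f₄ (u, y, 7 / 8 + (W + u / 2 - 9) / 96) = (u, y, w)) := by
    intro u y W hu hy hW hW'
    have hu' := abs_le.1 hu
    have e : 96 * (7 / 8 + (W + u / 2 - 9) / 96 - 7 / 8) + 9 - u / 2 = W := by ring
    have key := fun n => h₄ u y (7 / 8 + (W + u / 2 - 9) / 96) n (by linarith) (by linarith)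
      (by linarith) hy hK30
    rw [e] at key
    refine ⟨fun h => ?_, fun h h' => ?_, fun h => ?_⟩
    · exact (key _ (min_eq_right (by linarith)) (by linarith)).1 (by linarith)
    · exact (key _ (min_eq_left (by linarith)) (by linarith)).1 (by linarith)
    · exact (key _ (min_eq_left (by linarith)) (by linarith)).2 ε (by linarith) h
  refine ⟨f₂.trans (f₃.trans f₄), fun q hq => ?_, keep, ?_, ?_⟩
  · simp only [Homeomorph.trans_apply]
    rw [o₂ q hq, o₃ q hq, o₄ q hq]
  all_goals simp only [Homeomorph.trans_apply]
  · intro c x hc hc2 hx0 hcx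
    have hx4 : |-c| ≤ 4 := by rw [abs_neg, abs_of_nonneg (by linarith)]; linarith
    set z := (-x - c) / 2 with hz
    have hmax : max (2 * z) (max (8 * z) (12 * z - 1)) = 2 * z :=
      max_eq_left (max_le (by linarith) (by linarith))
    have hl : snakeLevel p (max x 0) z = min (2 * z) (p / 8 * (2 * z - 1)) := by
      rw [max_eq_right hx0, snakeLevel_low (by linarith), hmax, sub_zero, max_eq_right (by linarith)]
    rw [h₂ x 0 z _ (2 * z) (7 / 8 + 2 * z / 96) (abs_le.2 ⟨by linarith, by linarith⟩) (by linarith)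
      hK0 hK30 hl (by
        rw [max_eq_right hx0, max_eq_left (by linarith : 0 ≤ -x), max_eq_left (min_le_left _ _), sub_zero,
          min_eq_left]
        rw [← sub_le_iff_le_add]
        exact le_min (by linarith) (by nlinarith)) (max_eq_right (by linarith)) (by linarith),
      h₃ x 0 _ (-c) (abs_le.2 ⟨by linarith, by linarith⟩) (by linarith) hK0 hK30
        (by rw [max_eq_right (by linarith), hz]; ring) (by linarith)]
    have := (lower (-c) 0 (2 * z + 9 + c / 2) hx4 hK0 (by linarith) (by linarith)).2.2 (by linarith)
    rwa [show 2 * z + 9 + c / 2 + -c / 2 - 9 = 2 * z by ring] at this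
  · intro x y z u W h0 hx hz hz' hy hl hu hu4 hW hW2
    have hu' := abs_le.1 hu4
    rw [core x y z u h0 hx hz hz' (hKy y hy) hl hu (by linarith), show u - x = W + u / 2 - 9 by linarith]
    exact lower u y W hu4 (hKy y hy) (by linarith) hW2

-- The old left leg, the old cup and the low tail are crushed into the top collar of a left string;
-- the high tail goes to the top collar of the right string. The arc of the bend becomes the new
-- cup, and the placed box becomes the upright cylinder.
set_option maxHeartbeats 1000000 in
theorem exists_snake {p ε : ℝ} (hp : 0 < p) (hp1 : p ≤ 1) (hε : 0 < ε) (hε1 : ε ≤ 1) :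
    ∃ h : E3 ≃ₜ E3, (∀ q ∉ snakeBox, h q = q) ∧
      (∀ c z, p ≤ c → c ≤ 2 → 0 ≤ z → z ≤ 1 →
        ∃ w, 1 - ε ≤ w ∧ w ≤ 1 ∧ h (-c, 0, z) = (-c, 0, w)) ∧
      (∀ c x, p ≤ c → c ≤ 2 → |x| ≤ c →
        ∃ w, 1 - ε ≤ w ∧ w ≤ 1 ∧ h (x, 0, (|x| - c) / 2) = (-c, 0, w)) ∧
      (∀ c x z, p ≤ c → c ≤ 2 → TailSpec (c / 8) (x - 1, 0, z) →
        ∃ w, 1 - ε ≤ w ∧ w ≤ 1 ∧ h (x, 0, z) = (-c, 0, w)) ∧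
      (∀ c x z, p ≤ c → c ≤ 2 → TailSpec (c / 8) (x - 1, 0, 1 - z) →
        ∃ w, 1 - ε ≤ w ∧ w ≤ 1 ∧ h (x, 0, z) = (c, 0, w)) ∧
      (∀ c x z, p ≤ c → c ≤ 2 → ArcSpec (c / 8) (x - 1, 0, z) →
        ∃ x', |x'| ≤ c ∧ h (x, 0, z) = (x', 0, (|x'| - c) / 2)) ∧
      (∀ u y v, |u| ≤ 1 → |y| ≤ 1 - p → 0 ≤ v → v ≤ 1 →
        (v ≤ 1 - ε → h (1 - v / 2, y, 1 / 2 + u / 4) = (2 * u, y, v)) ∧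
        (1 - ε ≤ v → ∃ w, 1 - ε ≤ w ∧ w ≤ 1 ∧ h (1 - v / 2, y, 1 / 2 + u / 4) = (2 * u, y, w))) := by
  have hK : 0 ≤ 60 / p := by positivity
  have hK30 : 30 ≤ 60 / p := by rw [le_div_iff₀ hp]; linarith
  have hKy : ∀ y : ℝ, |y| ≤ 1 - p → 30 ≤ 60 / p * (1 - |y|) := fun y hy => by
    rw [div_mul_eq_mul_div, le_div_iff₀ hp]; linarith
  have hK0 : 30 ≤ 60 / p * (1 - |(0 : ℝ)|) := by rw [abs_zero]; linarith
  have hM : ∀ x w : ℝ, p ≤ 4 * x → w ≤ 10 → w ≤ 40 / p * x := fun x w h h' => by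
    rw [div_mul_eq_mul_div, le_div_iff₀ hp]; nlinarith
  have hη : ∀ x w : ℝ, x ≤ 2 → p ≤ w → p / 4 * x ≤ w := fun x w h h' => by nlinarith
  obtain ⟨f₁, o₁, n₁, h₁⟩ := exists_snakeSpread hp hp1 hK
  obtain ⟨g, o, keep, hv, slide⟩ := exists_snakeSlide hp hp1 hε hε1
  -- Spread to abscissa `w`, then slide: each piece of the snake amounts to computing `w`, the level
  -- `u` and the resulting `W`.
  have run : ∀ x y z w u W, 0 ≤ x → p ≤ 4 * x → x ≤ 2 → -1 ≤ z → |y| ≤ 1 - p → p ≤ w → (w ≤ 10 ∨ 1 ≤ x ∧ w ≤ 12) →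
      (x - snakeTilt z / 4) / (1 - 7 * snakeTilt z / 8) + snakeLift z = w → snakeLevel p w z = u →
      u ≤ w → |u| ≤ 4 → u / 2 - w + 9 = W → -2 ≤ W → z ≤ 7 / 8 + (u - w) / 96 →
        (W ≤ 0 → g (f₁ (x, y, z)) = (u, y, W / 2)) ∧
        (0 ≤ W → W / 4 ≤ 1 - ε → g (f₁ (x, y, z)) = (u, y, W / 4)) ∧
        (1 - ε ≤ W / 4 → ∃ w, 1 - ε ≤ w ∧ w ≤ 1 ∧ g (f₁ (x, y, z)) = (u, y, w)) := by
    intro x y z w u W h0 hpx hx hz hy hw hw' h hl hu hu' hW hW2 hz'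
    rw [h₁ x y z w h0 hx (hKy y hy) (hη x w hx hw)
      (hw'.elim (hM x w hpx) fun h => by
        rw [div_mul_eq_mul_div, le_div_iff₀ hp]; nlinarith) (by rcases hw' with h | h <;> linarith) h]
    exact slide w y z u W (by linarith) (by rcases hw' with h | h <;> linarith) hz hz' hy hl hu hu' hW hW2
  have h0p : |(0 : ℝ)| ≤ 1 - p := by rw [abs_zero]; linarith
  refine ⟨f₁.trans g, fun q hq => ?_, ?_, ?_, ?_, ?_, ?_, ?_⟩
  · simp only [Homeomorph.trans_apply]
    rw [o₁ q hq, o q hq]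
  all_goals simp only [Homeomorph.trans_apply]
  -- The left leg: the recorded displacement is nonnegative, so it is not pulled.
  · intro c z hc hc2 hz hz1
    rw [n₁ _ (by simp only; linarith)]
    have e0 : max (-c) 0 = 0 := max_eq_right (by linarith)
    have hl : -c ≤ snakeLevel p 0 z ∧ snakeLevel p 0 z ≤ 4 := by
      rcases le_total z (1 / 2) with h | h
      · rw [snakeLevel_low h]
        refine ⟨le_min (le_max_of_le_right ?_) (by nlinarith), (min_le_right _ _).trans (by nlinarith)⟩
        linarith [le_max_left (2 * z) (max (8 * z) (12 * z - 1))]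
      · rw [snakeLevel_high h]
        exact ⟨le_max_of_le_right (by nlinarith), max_le ((min_le_left _ _).trans (by linarith)) (by nlinarith)⟩
    refine keep (-c) z _ (by rw [abs_neg, abs_of_nonneg (by linarith)]; exact hc2) hz hz1 ?_ (Or.inl ?_) rfl
    · rw [e0, sub_zero]
      exact (min_le_left _ _).trans (max_le (by linarith) hl.2)
    · rw [e0, sub_zero, neg_neg, max_eq_left (by linarith : (0 : ℝ) ≤ c)]
      exact le_min (le_max_of_le_left (by linarith)) (by linarith)
  -- The old cup: its left half was treated by the slide; on its right half the level is `-c`.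
  · intro c x hc hc2 hx
    have hx' := abs_le.1 hx
    have h0 := abs_nonneg x
    have hx4 : |-c| ≤ 4 := by rw [abs_neg, abs_of_nonneg (by linarith)]; linarith
    rcases le_total x 0 with hx0 | hx0
    · rw [n₁ _ hx0, abs_of_nonpos hx0]
      exact hv c x hc hc2 hx0 hx'.1
    · rw [abs_of_nonneg hx0] at *
      set z := (x - c) / 2 with hz
      have hmin : min z (1 - z) ≤ 1 / 8 := (min_le_left _ _).trans (by linarith)
      have hlift : snakeLift z = 0 := max_eq_left ((min_le_left _ _).trans (by linarith))
      have hmax : max (2 * z) (max (8 * z) (12 * z - 1)) = 2 * z :=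
        max_eq_left (max_le (by linarith) (by linarith))
      have hl : snakeLevel p x z = -c := snakeLevel_low_eq (by linarith)
        (by rw [hmax, max_eq_right (by linarith)]; linarith) (by nlinarith)
      have e1 : f₁ (x, 0, z) = (x, 0, z) := h₁ x 0 z x hx0 (by linarith) hK0 (by nlinarith)
        (by
          have : 1 ≤ 40 / p := by rw [le_div_iff₀ hp]; linarith
          nlinarith) (by linarith) (by rw [snakeTilt_far hmin, hlift]; norm_num)
      rw [e1]
      exact (slide x 0 z (-c) _ hx0 (by linarith) (by linarith) (by linarith) h0p hl (by linarith)
        hx4 rfl (by linarith)).2.2 (by linarith)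
  -- The low tail: on each of its segments the level is `-c`, and `W ≥ 4` means that it ends in the
  -- collar.
  · rintro c x z hc hc2 ⟨-, hz, hz', h⟩
    simp only at hz hz' h
    have hx4 : |-c| ≤ 4 := by rw [abs_neg, abs_of_nonneg (by linarith)]; linarith
    have hmin : min z (1 - z) = z := min_eq_left (by linarith)
    have fin : ∀ w, 0 ≤ x → p ≤ 4 * x → x ≤ 2 → p ≤ w → w ≤ 5 - c / 2 →
        (x - snakeTilt z / 4) / (1 - 7 * snakeTilt z / 8) + snakeLift z = w →
        max (2 * z) (max (8 * z) (12 * z - 1)) = w - c →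
        ∃ w, 1 - ε ≤ w ∧ w ≤ 1 ∧ g (f₁ (x, 0, z)) = (-c, 0, w) := by
      intro w a1 a2 a3 a4 a5 a6 a7
      have hl : snakeLevel p w z = -c := snakeLevel_low_eq (by linarith)
        (by rw [a7, max_eq_right (by linarith)]; linarith) (by nlinarith)
      exact (run x 0 z w (-c) _ a1 a2 a3 (by linarith) h0p a4 (Or.inl (by linarith)) a6 hl (by linarith)
        hx4 rfl (by linarith) (by linarith)).2.2 (by linarith)
    rcases h with ⟨h1, h2⟩ | ⟨h1, h2, h3⟩ | ⟨h1, h2⟩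
    · refine fin (c + 8 * z) (by linarith) (by linarith) (by linarith) (by linarith) (by linarith) ?_ ?_
      · rw [snakeTilt_far (by rw [hmin]; exact h1), snakeLift_low hz (by linarith)]
        norm_num; linarith
      · rw [max_eq_left (by linarith : 12 * z - 1 ≤ 8 * z), max_eq_right (by linarith)]; ring
    · have hx : x = c * (1 - 7 * (8 * z - 1) / 8) + (8 * z - 1) / 4 := by linarith
      refine fin (c + 8 * z) (by nlinarith) (by nlinarith) (by nlinarith) (by linarith) (by linarith) ?_ ?_
      · rw [snakeTilt_side (by rw [hmin]; exact h1) (by rw [hmin]; exact h2), snakeLift_low hz h2, hmin, hx,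
          add_sub_cancel_right, mul_div_cancel_right₀]
        linarith
      · rw [max_eq_left (by linarith : 12 * z - 1 ≤ 8 * z), max_eq_right (by linarith)]; ring
    · refine fin (c + 12 * z - 1) (by linarith) (by linarith) (by linarith) (by linarith) (by linarith) ?_ ?_
      · rw [snakeTilt_mid h1 (by linarith), snakeLift_mid h1 (by linarith)]
        norm_num; linarith
      · rw [max_eq_right (by linarith : 8 * z ≤ 12 * z - 1), max_eq_right (by linarith)]; ring
  -- The high tail has level `c`; its vertical end is above `7/8` and is not pulled.
  · rintro c x z hc hc2 ⟨-, hz, hz', h⟩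
    simp only at hz hz' h
    have hx4 : |c| ≤ 4 := by rw [abs_of_nonneg (by linarith)]; linarith
    have hmin : min z (1 - z) = 1 - z := min_eq_right (by linarith)
    have fin : ∀ w, 0 ≤ x → p ≤ 4 * x → x ≤ 2 → c ≤ w → w ≤ 5 + c / 2 → z ≤ 7 / 8 + (c - w) / 96 →
        (x - snakeTilt z / 4) / (1 - 7 * snakeTilt z / 8) + snakeLift z = w →
        max (4 * z - 7) (32 * z - 28) = c - w →
        ∃ w, 1 - ε ≤ w ∧ w ≤ 1 ∧ g (f₁ (x, 0, z)) = (c, 0, w) := by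
      intro w a1 a2 a3 a4 a5 a6 a7 a8
      have hl : snakeLevel p w z = c := snakeLevel_high_eq (by linarith)
        (by rw [a8, min_eq_right (by linarith)]; linarith) (by nlinarith)
      exact (run x 0 z w c _ a1 a2 a3 (by linarith) h0p (by linarith) (Or.inl (by linarith)) a7 hl (by linarith)
        hx4 rfl (by linarith) a6).2.2 (by linarith)
    rcases h with ⟨h1, h2⟩ | ⟨h1, h2, h3⟩ | ⟨h1, h2⟩
    · have hx : x = c := by linarith
      subst hx
      rw [h₁ x 0 z x (by linarith) hc2 hK0 (hη x x hc2 hc) (hM x x (by linarith) (by linarith))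
        (by linarith) (by
          rw [snakeTilt_far (by rw [hmin]; exact h1), snakeLift_far (by linarith)]; norm_num)]
      refine keep x z _ (by rwa [abs_of_nonneg (by linarith)]) (by linarith) (by linarith) ?_
        (Or.inr (by linarith)) rfl
      have h5 : snakeLevel p (max x 0) z ≤ 8 * z - 4 := snakeLevel_le hp1 (by linarith)
      have h6 : min (max (2 * z) (snakeLevel p (max x 0) z)) (snakeLevel p (max x 0) z + max (-x) 0) ≤
        4 := (min_le_left _ _).trans (max_le (by linarith) (by linarith))
      linarith [le_max_right x 0]
    · have hx : x = c * (1 - 7 * (8 * (1 - z) - 1) / 8) + (8 * (1 - z) - 1) / 4 := by linarith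
      refine fin (c + 28 - 32 * z) (by nlinarith) (by nlinarith) (by nlinarith) (by linarith) (by linarith)
        (by linarith) ?_ ?_
      · rw [snakeTilt_side (by rw [hmin]; exact h1) (by rw [hmin]; exact h2),
          snakeLift_high (by linarith) (by linarith), hmin, hx, add_sub_cancel_right, mul_div_cancel_right₀]
        · ring
        · linarith
      · rw [max_eq_right (by linarith)]; ring
    · refine fin (7 + c - 4 * z) (by linarith) (by linarith) (by linarith) (by linarith) (by linarith)
        (by linarith) ?_ ?_
      · rw [snakeTilt_mid (by linarith) (by linarith), snakeLift_mid (by linarith) (by linarith)]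
        norm_num; linarith
      · rw [max_eq_left (by linarith)]; ring
  -- The arc: the level is `8 * z - 4` and `W` is the level's absolute value minus `c`, so halving
  -- `W` gives the equation of the cup.
  · rintro c x z hc hc2 ⟨-, hx, h⟩
    simp only at hx h
    have hz : 1 / 4 ≤ z ∧ z ≤ 3 / 4 := by rcases h with h | h <;> constructor <;> linarith
    have hw : (x - snakeTilt z / 4) / (1 - 7 * snakeTilt z / 8) + snakeLift z = 8 * x + 4 * z - 1 := by
      rw [snakeTilt_mid hz.1 hz.2, snakeLift_mid hz.1 hz.2]
      norm_num; linarith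
    refine ⟨8 * z - 4, ?_, ?_⟩
    · rcases h with h | h
      · rw [abs_of_nonpos (by linarith)]; linarith
      · rw [abs_of_nonneg (by linarith)]; linarith
    have hl : snakeLevel p (8 * x + 4 * z - 1) z = 8 * z - 4 := by
      rcases h with h | h
      · refine snakeLevel_low_eq h.1 ?_ (by nlinarith)
        rw [max_eq_right (by linarith : 8 * z ≤ 12 * z - 1),
          max_eq_right (by linarith : 2 * z ≤ 12 * z - 1), max_eq_left (by linarith)]
      · refine snakeLevel_high_eq h.1 ?_ (by nlinarith)
        rw [max_eq_left (by linarith), min_eq_left (by linarith)]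
    have hx2 : x ≤ 2 := by rcases h with h | h <;> linarith
    have hu4 : |8 * z - 4| ≤ 4 := abs_le.2 ⟨by linarith, by linarith⟩
    refine (run x 0 z _ _ (|8 * z - 4| - c) (by linarith) (by linarith) hx2 (by linarith) h0p (by linarith)
      (Or.inr ⟨by linarith, by rcases h with h | h <;> linarith⟩) hw hl (by linarith) hu4 ?_
      (by linarith [abs_nonneg (8 * z - 4)]) (by rcases h with h | h <;> linarith)).1 ?_
    · rcases h with h | h
      · rw [abs_of_nonpos (by linarith)]; linarith
      · rw [abs_of_nonneg (by linarith)]; linarith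
    · rcases h with h | h
      · rw [abs_of_nonpos (by linarith)]; linarith
      · rw [abs_of_nonneg (by linarith)]; linarith
  -- The box: `w = 9 - 4 * v + u` and the level is `2 * u`, hence `W = 4 * v`.
  · intro u y v hu hy hv hv1
    have hu' := abs_le.1 hu
    have hw : (1 - v / 2 - snakeTilt (1 / 2 + u / 4) / 4) / (1 - 7 * snakeTilt (1 / 2 + u / 4) / 8) +
        snakeLift (1 / 2 + u / 4) = 9 - 4 * v + u := by
      rw [snakeTilt_mid (by linarith) (by linarith), snakeLift_mid (by linarith) (by linarith)]
      norm_num; linarith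
    have hl : snakeLevel p (9 - 4 * v + u) (1 / 2 + u / 4) = 2 * u := by
      rcases le_total u 0 with h | h
      · refine snakeLevel_low_eq (by linarith) ?_ (by nlinarith)
        rw [max_eq_right (by linarith : 8 * (1 / 2 + u / 4) ≤ 12 * (1 / 2 + u / 4) - 1),
          max_eq_right (by linarith : 2 * (1 / 2 + u / 4) ≤ 12 * (1 / 2 + u / 4) - 1),
          max_eq_left (by linarith)]
        ring
      · refine snakeLevel_high_eq (by linarith) ?_ (by nlinarith)
        rw [max_eq_left (by linarith), min_eq_left (by linarith)]
        ring
    have hu4 : |2 * u| ≤ 4 := abs_le.2 ⟨by linarith, by linarith⟩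
    have key := run (1 - v / 2) y (1 / 2 + u / 4) _ _ (4 * v) (by linarith) (by linarith) (by linarith)
      (by linarith) hy (by linarith) (Or.inl (by linarith)) hw hl (by linarith) hu4 (by ring) (by linarith)
      (by linarith)
    rw [mul_div_cancel_left₀ v (by norm_num : (4 : ℝ) ≠ 0)] at key
    exact ⟨key.2.1 (by linarith), key.2.2⟩


/-- A homeomorphism of the line which doubles `x` if `|x| ≤ m`, and with slope `2 + L` elsewhere. -/
noncomputable def stretch (m L : ℝ) (hm : 0 ≤ m) (hL : 0 ≤ L) : E3 ≃ₜ E3 where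
  toFun q := (2 * q.1 + L * (max (q.1 - m) 0 - max (-q.1 - m) 0), q.2)
  invFun q := (q.1 / 2 - (1 / 2 - 1 / (2 + L)) * (max (q.1 - 2 * m) 0 - max (-q.1 - 2 * m) 0), q.2)
  left_inv q := by
    refine Prod.ext ?_ rfl
    have h2 : 2 + L ≠ 0 := by positivity
    simp only
    rcases le_total q.1 (-m) with h | h
    · rw [max_eq_right (by linarith : q.1 - m ≤ 0), max_eq_left (by linarith : 0 ≤ -q.1 - m),
        max_eq_right (by nlinarith), max_eq_left (by nlinarith)]
      field_simp
      ring
    · rw [max_eq_right (by linarith : -q.1 - m ≤ 0)]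
      rcases le_total q.1 m with h' | h'
      · rw [max_eq_right (by linarith : q.1 - m ≤ 0), max_eq_right (by linarith),
          max_eq_right (by linarith)]
        ring
      · rw [max_eq_left (by linarith : 0 ≤ q.1 - m), max_eq_left (by nlinarith),
          max_eq_right (by nlinarith)]
        field_simp
        ring
  right_inv q := by
    refine Prod.ext ?_ rfl
    have h2 : 0 < 2 + L := by positivity
    have h3 : (1 / 2 - 1 / (2 + L)) = L / (2 * (2 + L)) := by field_simp; ring
    have e1 : ∀ w, 0 ≤ w - 2 * m → w / 2 - L / (2 * (2 + L)) * (w - 2 * m - 0) - m = (w - 2 * m) / (2 + L) :=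
      fun w _ => by field_simp; ring
    have e2 : ∀ w, 0 ≤ -w - 2 * m →
        -(w / 2 - L / (2 * (2 + L)) * (0 - (-w - 2 * m))) - m = (-w - 2 * m) / (2 + L) :=
      fun w _ => by field_simp; ring
    simp only
    rw [h3]
    rcases le_total q.1 (-(2 * m)) with h | h
    · have hq : 0 ≤ -q.1 - 2 * m := by linarith
      have h4 : 0 ≤ (-q.1 - 2 * m) / (2 + L) := by positivity
      have h5 := e2 q.1 hq
      rw [max_eq_right (by linarith : q.1 - 2 * m ≤ 0), max_eq_left hq,
        max_eq_right (by linarith), max_eq_left (by linarith), h5]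
      field_simp
      ring
    · rw [max_eq_right (by linarith : -q.1 - 2 * m ≤ 0)]
      rcases le_total q.1 (2 * m) with h' | h'
      · rw [max_eq_right (by linarith : q.1 - 2 * m ≤ 0), max_eq_right (by linarith),
          max_eq_right (by linarith)]
        ring
      · have hq : 0 ≤ q.1 - 2 * m := by linarith
        have h4 : 0 ≤ (q.1 - 2 * m) / (2 + L) := by positivity
        have h5 := e1 q.1 hq
        rw [max_eq_left hq, max_eq_left (by linarith), max_eq_right (by linarith), h5]
        field_simp
        ring
  continuous_toFun := by fun_prop
  continuous_invFun := by fun_prop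

section Stretch

variable {m L : ℝ} (hm : 0 ≤ m) (hL : 0 ≤ L)

theorem stretch_apply {x y z : ℝ} (h : |x| ≤ m) : stretch m L hm hL (x, y, z) = (2 * x, y, z) := by
  have h := abs_le.1 h
  simp only [stretch, Homeomorph.homeomorph_mk_coe, Equiv.coe_fn_mk]
  rw [max_eq_right (by linarith : x - m ≤ 0), max_eq_right (by linarith)]
  simp

theorem stretch_symm_apply {x y z : ℝ} (h : |x| ≤ 2 * m) :
    (stretch m L hm hL).symm (x, y, z) = (x / 2, y, z) := by
  have h := abs_le.1 h
  rw [Homeomorph.symm_apply_eq, stretch_apply hm hL (abs_le.2 ⟨by linarith, by linarith⟩)]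
  rw [Prod.mk.injEq]; exact ⟨by ring, rfl⟩

/-- The part of space in which the cups below a string link are modified. -/
def cupBox : Set E3 := {q | |q.1| < 1 ∧ |q.2.1| < 1 ∧ -3 < q.2.2 ∧ q.2.2 < 1}

/-- The steep part of the stretch carries `1 ≤ |x|` beyond the wide box of the snake, so conjugation
by it confines the support to the narrow box. -/
theorem stretch_notMem (hm1 : m ≤ 1) (h40 : 40 ≤ L * (1 - m)) {q : E3} (h : q ∉ cupBox) :
    stretch m L hm hL q ∉ snakeBox := by
  rintro ⟨h1, h2, h3⟩
  refine h ⟨?_, h2, h3⟩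
  change |2 * q.1 + L * (max (q.1 - m) 0 - max (-q.1 - m) 0)| < 40 at h1
  have h1 := abs_lt.1 h1
  refine abs_lt.2 ⟨?_, ?_⟩
  · by_contra! hc
    rw [max_eq_right (by linarith), max_eq_left (by linarith)] at h1
    nlinarith
  · by_contra! hc
    rw [max_eq_left (by linarith), max_eq_right (by linarith)] at h1
    nlinarith

end Stretch

/-- A string link closed up by cups below: the arc running down along a string of the first half,
along a cup, and up along a string of the second half. -/
def capSet {l : ℕ} (S : StringLink (l + l)) (i : Fin l) : Set E3 :=
  range (S.strand (Fin.castAdd l i.rev)) ∪ range (cup l i) ∪ range (S.strand (Fin.natAdd l i))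

/-! ### Pulling a bent string link straight -/

namespace StringLink

/-- The map of `exists_snake` conjugated by a stretch which doubles the abscissa on the strings. The
parameter `c` is twice the radius of the cup; `p` is a common margin of the source and target string
links. -/
theorem exists_cup_snake {l : ℕ} (U : StringLink (l + l)) : ∃ h : E3 ≃ₜ E3,
    (∀ q ∉ cupBox, h q = q) ∧ ∀ i, ∀ q ∈ capSet ((one l).juxt U.bend) i, h q ∈ capSet U i := by
  obtain ⟨ε, hε, hε1, hv, hm⟩ := exists_collar U
  obtain ⟨δ₁, hδ₁, hδ₁', hm₁⟩ := exists_margin U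
  obtain ⟨δ₂, hδ₂, hδ₂', hm₂⟩ := exists_margin (one l)
  obtain ⟨δ₃, hδ₃, hδ₃', hm₃⟩ := exists_margin ((one l).juxt U.bend)
  obtain ⟨p, hp, hp1, hpδ, hpδ'⟩ : ∃ p : ℝ, 0 < p ∧ p ≤ δ₁ ∧ p ≤ δ₂ ∧ p ≤ δ₃ :=
    ⟨min δ₁ (min δ₂ δ₃), by positivity, min_le_left _ _, (min_le_right _ _).trans (min_le_left _ _),
      (min_le_right _ _).trans (min_le_right _ _)⟩
  obtain ⟨m, hmp⟩ : ∃ m, m = 1 - p := ⟨_, rfl⟩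
  have hm0 : 0 ≤ m := by linarith
  have hm1' : m ≤ 1 := by linarith
  obtain ⟨L, hL, h40⟩ : ∃ L : ℝ, 0 ≤ L ∧ 40 ≤ L * (1 - m) :=
    ⟨40 / p, by positivity, by rw [hmp, sub_sub_cancel, div_mul_cancel₀ _ hp.ne']⟩
  obtain ⟨H, ho, hleg, hcup, hlow, hhigh, harc, hbox⟩ :=
    exists_snake hp (by linarith) hε (by linarith)
  have hrad : ∀ i : Fin l, p ≤ 2 * rad l i ∧ 2 * rad l i ≤ 2 := fun i => by
    have h1 := (hm₂ i _ (mem_one_iff.2 ⟨0, le_rfl, zero_le_one, rfl⟩)).1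
    have h1 := abs_le.1 h1
    simp only [marked] at h1
    unfold rad
    constructor <;> linarith
  have hradm : ∀ i : Fin l, rad l i ≤ m := fun i => by
    have h1 := (hm₁ (Fin.natAdd l i) _ (hm _ 0 le_rfl zero_le_one (Or.inl hε.le))).1
    have h1 := (abs_le.1 h1).2
    rw [marked_high] at h1
    simp only at h1
    linarith
  have hoff : ∀ i : Fin l, off l i = 2 * rad l i / 8 := fun i => by unfold off rad; ring
  have endL : ∀ (i : Fin l) (w : ℝ), 1 - ε ≤ w → w ≤ 1 →
      (stretch m L hm0 hL).symm (-(2 * rad l i), 0, w) ∈ capSet U i := fun i w hw hw' => by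
    have h := hrad i
    rw [stretch_symm_apply hm0 hL (by rw [abs_neg, abs_of_nonneg (by linarith)]; linarith [hradm i])]
    refine Or.inl (Or.inl ?_)
    rw [show -(2 * rad l i) / 2 = -rad l i by ring, ← marked_low]
    exact hm (Fin.castAdd l i.rev) w (by linarith) hw' (Or.inr hw)
  have endR : ∀ (i : Fin l) (w : ℝ), 1 - ε ≤ w → w ≤ 1 →
      (stretch m L hm0 hL).symm (2 * rad l i, 0, w) ∈ capSet U i := fun i w hw hw' => by
    have h := hrad i
    rw [stretch_symm_apply hm0 hL (by rw [abs_of_nonneg (by linarith)]; linarith [hradm i])]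
    refine Or.inr ?_
    rw [show 2 * rad l i / 2 = rad l i by ring, ← marked_high]
    exact hm (Fin.natAdd l i) w (by linarith) hw' (Or.inr hw)
  refine ⟨(stretch m L hm0 hL).trans (H.trans (stretch m L hm0 hL).symm), fun q hq => ?_, fun i q hq => ?_⟩
  · simp only [Homeomorph.trans_apply]
    rw [ho _ (stretch_notMem hm0 hL hm1' h40 hq), Homeomorph.symm_apply_apply]
  simp only [Homeomorph.trans_apply]
  obtain ⟨hc, hc2⟩ := hrad i
  have hr := rad_bounds i
  -- A point of the placed `U` returns to itself, except in the top collar, where only its vertical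
  -- position may change.
  have box : ∀ k, ∀ a ∈ range (U.strand k), |(rightHalf (place a)).1| ≤ m → (∀ a ∈ range (U.strand k), a ∈ capSet U i) →
      (stretch m L hm0 hL).symm (H ((stretch m L hm0 hL) (rightHalf (place a)))) ∈ capSet U i := by
    intro k a ha ham hk
    obtain ⟨u, y, v⟩ := a
    obtain ⟨h1, h2⟩ := hm₁ k _ ha
    obtain ⟨-, -, ⟨hv0, hv1⟩, -⟩ := U.mem_bounds ha
    simp only at h1 h2 hv0 hv1
    have hu' := abs_le.1 h1
    have e : (stretch m L hm0 hL) (rightHalf (place (u, y, v))) = (1 - v / 2, y, 1 / 2 + u / 4) := by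
      rw [show rightHalf (place (u, y, v)) = ((-v / 2 + 1) / 2, y, 1 / 2 + u / 4) from rfl,
        stretch_apply hm0 hL (show |(-v / 2 + 1) / 2| ≤ m from ham), Prod.mk.injEq]
      exact ⟨by ring, rfl⟩
    have hu2 : |2 * u| ≤ 2 * m := by rw [abs_mul, abs_two]; linarith
    rw [e]
    rcases le_total v (1 - ε) with hve | hve
    · rw [(hbox u y v (by linarith) (by linarith) hv0 hv1).1 hve, stretch_symm_apply hm0 hL hu2,
        mul_div_cancel_left₀ u (by norm_num)]
      exact hk _ ha
    · obtain ⟨w, hw, hw', h⟩ := (hbox u y v (by linarith) (by linarith) hv0 hv1).2 hve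
      rw [h, stretch_symm_apply hm0 hL hu2, mul_div_cancel_left₀ u (by norm_num)]
      obtain ⟨hx, hy⟩ := hv k _ ha (Or.inr hve)
      simp only at hx hy
      rw [hx, hy]
      exact hk _ (hm k w (by linarith) hw' (Or.inr hw))
  rcases hq with (hq | hq) | hq
  · rw [juxt_range_left] at hq
    obtain ⟨_, hp', rfl⟩ := hq
    obtain ⟨s, h0, h1, rfl⟩ := mem_one_iff.1 hp'
    rw [← leftHalf_marked, marked_low, stretch_apply hm0 hL (by rw [abs_neg, abs_of_nonneg hr.1.le]; exact hradm i),
      mul_neg]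
    obtain ⟨w, hw, hw', h⟩ := hleg _ s hc hc2 h0 h1
    rw [h]
    exact endL i w hw hw'
  · obtain ⟨hy, hz, h⟩ := cup_spec hq
    obtain ⟨x, y, z⟩ := q
    simp only at hy hz h
    subst hy
    have hx : |x| ≤ rad l i := by
      rcases h with ⟨h, h'⟩ | ⟨h, h'⟩
      · rw [abs_of_nonpos h]; linarith
      · rw [abs_of_nonneg h]; linarith
    rw [stretch_apply hm0 hL (hx.trans (hradm i))]
    have h2x : |2 * x| ≤ 2 * rad l i := by rw [abs_mul, abs_two]; linarith
    obtain ⟨w, hw, hw', hH⟩ := hcup _ (2 * x) hc hc2 h2x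
    have hz : z = (|2 * x| - 2 * rad l i) / 2 := by
      rw [abs_mul, abs_two]
      rcases h with ⟨h, h'⟩ | ⟨h, h'⟩
      · rw [abs_of_nonpos h]; linarith
      · rw [abs_of_nonneg h]; linarith
    rw [hz, hH]
    exact endL i w hw hw'
  · have hqm : |q.1| ≤ m := ((hm₃ _ q hq).1).trans (by linarith)
    rw [juxt_range_right, bend_range] at hq
    obtain ⟨a, ha, rfl⟩ := hq
    have str : ∀ x z : ℝ, |(rightHalf (x, 0, z)).1| ≤ m →
        (stretch m L hm0 hL) (rightHalf (x, 0, z)) = (x + 1, 0, z) := by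
      intro x z h
      rw [show rightHalf (x, 0, z) = ((x + 1) / 2, 0, z) from rfl] at h ⊢
      rw [stretch_apply hm0 hL h, Prod.mk.injEq]
      exact ⟨by ring, rfl⟩
    rcases ha with (((ha | ha) | ha) | ha) | ha
    · have h := tail_spec ha
      obtain ⟨x, y, z⟩ := a
      obtain rfl : y = 0 := h.1
      rw [str x z hqm]
      rw [hoff] at h
      obtain ⟨w, hw, hw', hH⟩ := hlow _ (x + 1) z hc hc2 (by rwa [add_sub_cancel_right])
      rw [hH]
      exact endL i w hw hw'
    · obtain ⟨a, ha, rfl⟩ := ha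
      exact box _ a ha hqm fun a ha => Or.inl (Or.inl ha)
    · have h := arc_spec ha
      obtain ⟨x, y, z⟩ := a
      obtain rfl : y = 0 := h.1
      rw [str x z hqm]
      rw [hoff] at h
      obtain ⟨x', hx', hH⟩ := harc _ (x + 1) z hc hc2 (by rwa [add_sub_cancel_right])
      rw [hH, stretch_symm_apply hm0 hL (by linarith [hradm i])]
      refine Or.inl (Or.inr (mem_cup_iff.2 ⟨rfl, ?_, ?_⟩))
      · simp only; linarith
      · simp only
        rcases le_total x' 0 with h | h
        · left; rw [abs_of_nonpos h]; constructor <;> linarith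
        · right; rw [abs_of_nonneg h]; constructor <;> linarith
    · obtain ⟨a, ha, rfl⟩ := ha
      exact box _ a ha hqm fun a ha => Or.inr ha
    · have h := high_spec ha
      obtain ⟨x, y, z⟩ := a
      obtain rfl : y = 0 := h.1
      rw [str x z hqm]
      rw [hoff] at h
      obtain ⟨w, hw, hw', hH⟩ := hhigh _ (x + 1) z hc hc2 (by rwa [add_sub_cancel_right])
      rw [hH]
      exact endR i w hw hw'

/-! ### Modifying the cups of a bend -/

/-- The affine map which takes the cups below a string link to the arcs of a bend. -/
noncomputable def bendMap : E3 ≃ₜ E3 where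
  toFun q := (-q.2.2 / 4, q.2.1, 1 / 2 + q.1 / 4)
  invFun q := (4 * (q.2.2 - 1 / 2), q.2.1, -4 * q.1)
  left_inv q := by
    refine Prod.ext ?_ (Prod.ext rfl ?_)
    · simp only; ring
    · simp only; ring
  right_inv q := by
    refine Prod.ext ?_ (Prod.ext rfl ?_)
    · simp only; ring
    · simp only; ring
  continuous_toFun := by fun_prop
  continuous_invFun := by fun_prop

/-- Only the last term depends on `S`: it is the affine copy of `S` closed by cups. So `S` may be
modified without touching `T` or the tails. -/
theorem bend_stack_range {l : ℕ} (S T : StringLink (l + l)) (i : Fin l) :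
    range ((S.stack T).bend.strand i) = (range (tail l i) ∪ flip '' range (tail l i) ∪
      place '' (upperHalf '' range (T.strand (Fin.castAdd l i.rev))) ∪
      place '' (upperHalf '' range (T.strand (Fin.natAdd l i)))) ∪ bendMap '' capSet S i := by
  have e1 : ∀ A : Set E3, place '' (lowerHalf '' A) = bendMap '' A := fun A => by
    rw [image_image]
    refine image_congr fun q _ => ?_
    change ((-(q.2.2 / 2) / 2, q.2.1, 1 / 2 + q.1 / 4) : E3) = (-q.2.2 / 4, q.2.1, 1 / 2 + q.1 / 4)
    rw [Prod.mk.injEq]; exact ⟨by ring, rfl⟩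
  have e2 : range (arc l i) = bendMap '' range (cup l i) := by
    ext q
    rw [mem_arc_iff]
    have hr : off l i = rad l i / 4 := by unfold off rad; ring
    constructor
    · rintro ⟨hy, hx, h⟩
      refine ⟨bendMap.symm q, mem_cup_iff.2 ?_, bendMap.apply_symm_apply q⟩
      change q.2.1 = 0 ∧ -4 * q.1 ≤ 0 ∧ (4 * (q.2.2 - 1 / 2) ≤ 0 ∧ -4 * q.1 = -(4 * (q.2.2 - 1 / 2)) - rad l i ∨
        0 ≤ 4 * (q.2.2 - 1 / 2) ∧ -4 * q.1 = 4 * (q.2.2 - 1 / 2) - rad l i)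
      refine ⟨hy, by linarith, h.imp ?_ ?_⟩ <;> rintro ⟨h, h'⟩ <;> constructor <;> linarith
    · rintro ⟨p, hp, rfl⟩
      obtain ⟨hy, hz, h⟩ := cup_spec hp
      change p.2.1 = 0 ∧ 0 ≤ -p.2.2 / 4 ∧ (1 / 2 + p.1 / 4 ≤ 1 / 2 ∧ -p.2.2 / 4 = off l i - (1 / 2 - (1 / 2 + p.1 / 4)) ∨
        1 / 2 ≤ 1 / 2 + p.1 / 4 ∧ -p.2.2 / 4 = off l i - (1 / 2 + p.1 / 4 - 1 / 2))
      refine ⟨hy, by linarith, h.imp ?_ ?_⟩ <;> rintro ⟨h, h'⟩ <;> constructor <;> linarith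
  rw [bend_range, stack_range, stack_range, image_union, image_union, e1, e1, e2, capSet, image_union,
    image_union]
  ext q
  simp only [mem_union]
  tauto

/-- The box `cupBox` is carried by `bendMap` into the cylinder. It avoids the copy of `T`, which has
`x ≤ -1/4`, and the tails, so the conjugate of `h` fixes all of these. -/
theorem HomeoEq.bend_of_capSet {l : ℕ} {S S' : StringLink (l + l)} (T : StringLink (l + l)) (h : E3 ≃ₜ E3)
    (ho : ∀ q ∉ cupBox, h q = q) (hi : ∀ i, ∀ q ∈ capSet S i, h q ∈ capSet S' i) :
    (S.stack T).bend.HomeoEq (S'.stack T).bend := by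
  have hg : ∀ q, (bendMap.symm.trans (h.trans bendMap)) q = bendMap (h (bendMap.symm q)) := fun q => rfl
  have hs : ∀ q : E3, bendMap.symm q = (4 * (q.2.2 - 1 / 2), q.2.1, -4 * q.1) := fun q => rfl
  have hid : ∀ q : E3, bendMap.symm q ∉ cupBox → (bendMap.symm.trans (h.trans bendMap)) q = q :=
    fun q hq => by rw [hg, ho _ hq, Homeomorph.apply_symm_apply]
  have hfix : ∀ q : E3, q.1 ≤ -1 / 4 → (bendMap.symm.trans (h.trans bendMap)) q = q := fun q hq => by
    refine hid q ?_
    rintro ⟨-, -, -, h4⟩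
    rw [hs] at h4
    simp only at h4
    linarith
  have htail : ∀ i q, TailSpec (off l i) q → (bendMap.symm.trans (h.trans bendMap)) q = q ∧
      (bendMap.symm.trans (h.trans bendMap)) (flip q) = flip q := by
    rintro i q ⟨-, h0, h1, h2⟩
    have ho := off_bounds i
    have far : ∀ q : E3, (q.2.2 ≤ 1 / 4 ∨ 3 / 4 ≤ q.2.2) →
        (bendMap.symm.trans (h.trans bendMap)) q = q := fun q hq => by
      refine hid q ?_
      rintro ⟨h1, -⟩
      rw [hs, abs_lt] at h1
      simp only at h1
      rcases hq with hq | hq <;> linarith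
    rcases h2 with h | h | h
    · exact ⟨far q (Or.inl (by linarith)), far _ (Or.inr (by simp only [flip]; linarith))⟩
    · exact ⟨far q (Or.inl h.2.1), far _ (Or.inr (by simp only [flip]; linarith))⟩
    · exact ⟨hfix q (by linarith), hfix _ (by simp only [flip]; linarith)⟩
  refine ⟨bendMap.symm.trans (h.trans bendMap), fun q hq => hid q ?_, fun i q hq => ?_⟩
  · rintro ⟨h1, h2, h3, h4⟩
    rw [hs] at h1 h2 h3 h4
    simp only at h1 h2 h3 h4
    rw [abs_lt] at h1 h2
    exact hq ⟨⟨by linarith, by linarith⟩, h2, by linarith, by linarith⟩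
  rw [bend_stack_range] at hq ⊢
  have hup : ∀ k, ∀ q ∈ place '' (upperHalf '' range (T.strand k)), q.1 ≤ -1 / 4 := by
    rintro k _ ⟨_, ⟨p, hp, rfl⟩, rfl⟩
    obtain ⟨-, -, ⟨hz0, hz1⟩, -⟩ := T.mem_bounds hp
    simp only [place, upperHalf]
    linarith
  rcases hq with (((hq | hq) | hq) | hq) | hq
  · rw [show (bendMap.symm.trans (h.trans bendMap)) q = q from ?_]
    · exact Or.inl (Or.inl (Or.inl (Or.inl hq)))
    · exact (htail i q (tail_spec hq)).1
  · rw [show (bendMap.symm.trans (h.trans bendMap)) q = q from ?_]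
    · exact Or.inl (Or.inl (Or.inl (Or.inr hq)))
    · have := (htail i _ (high_spec hq)).2
      rwa [flip_flip] at this
  · rw [hfix q (hup _ q hq)]
    exact Or.inl (Or.inl (Or.inr hq))
  · rw [hfix q (hup _ q hq)]
    exact Or.inl (Or.inr hq)
  · obtain ⟨p, hp, rfl⟩ := hq
    refine Or.inr ⟨h p, hi i p hp, ?_⟩
    rw [hg, Homeomorph.symm_apply_apply]

/-- With `U = (1 ⊗ σ) S` this is associativity of the right action. -/
theorem bend_snake {l : ℕ} (U T : StringLink (l + l)) :
    (((one l).juxt U.bend).stack T).bend.HomeoEq (U.stack T).bend := by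
  obtain ⟨h, ho, hi⟩ := exists_cup_snake U
  exact HomeoEq.bend_of_capSet T h ho hi

end StringLink

/-! ### Transporting a homeomorphism by a chart -/

/-- A homeomorphism with compact support in the chart extends by the identity. The chart need not be
defined on all of `X`, which matters for the coordinates along the cups: they degenerate above the
core. -/
theorem exists_transport {X Y : Type*} [TopologicalSpace X] [T2Space X] [TopologicalSpace Y]
    {A : Set X} {B C : Set Y} {f : X → Y} {f' : Y → X} (hA : IsOpen A)
    (hf : ContinuousOn f A) (hf' : ContinuousOn f' B) (mf : ∀ x ∈ A, f x ∈ B) (mf' : ∀ y ∈ B, f' y ∈ A)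
    (l : ∀ x ∈ A, f' (f x) = x) (r : ∀ y ∈ B, f (f' y) = y) (hC : IsCompact C) (hCB : C ⊆ B)
    (g : Y ≃ₜ Y) (hg : ∀ y, y ∉ C → g y = y) :
    ∃ h : X ≃ₜ X, (∀ x ∈ A, h x = f' (g (f x))) ∧ ∀ x, (x ∈ A → f x ∉ C) → h x = x := by
  classical
  have hg' : ∀ y, y ∉ C → g.symm y = y := fun y hy => by rw [Homeomorph.symm_apply_eq, hg y hy]
  have maps : ∀ g : Y ≃ₜ Y, (∀ y, y ∉ C → g y = y) → ∀ y ∈ B, g y ∈ B := fun g hg y hy => by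
    by_contra h
    have h1 := hg (g y) (fun hc => h (hCB hc))
    rw [g.injective h1] at h
    exact h hy
  have outside : ∀ g : Y ≃ₜ Y, (∀ y, y ∉ C → g y = y) → ∀ x, x ∉ f' '' C →
      (if x ∈ A then f' (g (f x)) else x) = x := fun g hg x hx => by
    split_ifs with h
    · rw [hg, l x h]
      exact fun hc => hx ⟨f x, hc, l x h⟩
    · rfl
  have cont : ∀ g : Y ≃ₜ Y, (∀ y, y ∉ C → g y = y) →
      Continuous fun x => if x ∈ A then f' (g (f x)) else x := fun g hg => by
    refine continuous_iff_continuousAt.2 fun x => ?_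
    by_cases h : x ∈ A
    · have h1 : ContinuousOn (fun x => f' (g (f x))) A :=
        hf'.comp (g.continuous.comp_continuousOn hf) fun x hx => maps g hg _ (mf x hx)
      refine (h1.continuousAt (hA.mem_nhds h)).congr ?_
      filter_upwards [hA.mem_nhds h] with y hy
      rw [if_pos hy]
    -- Off the chart domain the point has a neighbourhood missing the compact image of the support,
    -- where the map is the identity.
    · have hK : IsClosed (f' '' C) := (hC.image_of_continuousOn (hf'.mono hCB)).isClosed
      have hx : x ∈ (f' '' C)ᶜ := by
        rintro ⟨y, hy, rfl⟩
        exact h (mf' y (hCB hy))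
      refine continuousAt_id.congr ?_
      filter_upwards [hK.isOpen_compl.mem_nhds hx] with y hy
      rw [outside g hg y hy]; rfl
  have inv : ∀ g : Y ≃ₜ Y, (∀ y, y ∉ C → g y = y) → ∀ x,
      (if (if x ∈ A then f' (g (f x)) else x) ∈ A then
        f' (g.symm (f (if x ∈ A then f' (g (f x)) else x))) else (if x ∈ A then f' (g (f x)) else x)) =
        x := fun g hg x => by
    by_cases h : x ∈ A
    · have hB := maps g hg _ (mf x h)
      rw [if_pos h, if_pos (mf' _ hB), r _ hB, g.symm_apply_apply, l x h]
    · rw [if_neg h, if_neg h]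
  refine ⟨{ toFun := fun x => if x ∈ A then f' (g (f x)) else x
            invFun := fun x => if x ∈ A then f' (g.symm (f x)) else x
            left_inv := inv g hg
            right_inv := inv g.symm hg'
            continuous_toFun := cont g hg
            continuous_invFun := cont g.symm hg' }, fun x hx => if_pos hx, fun x hx => ?_⟩
  refine outside g hg x ?_
  rintro ⟨y, hy, rfl⟩
  exact hx (mf' y (hCB hy)) (by rwa [r y (hCB hy)])

/-! ### Sliding along the cups -/

/-- The coordinates along parallel cups: the distance from the core, `y`, and the position along the
cup. -/
noncomputable def cupCoord (q : E3) : E3 :=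
  (|q.1| + max (-q.2.2) 0, q.2.1, q.1 / (|q.1| + max (-q.2.2) 0) + q.1 / |q.1| * max q.2.2 0)

/-- The inverse of `cupCoord`. -/
noncomputable def cupPoint (q : E3) : E3 :=
  (q.1 * max (-1) (min 1 q.2.2), q.2.1, q.1 * (min |q.2.2| 1 - 1) + max (|q.2.2| - 1) 0)

/-- The domain of `cupCoord`. -/
def cupDomain : Set E3 := {q | q.1 ≠ 0 ∨ q.2.2 < 0}

theorem cupCoord_pos {q : E3} (h : q ∈ cupDomain) : 0 < |q.1| + max (-q.2.2) 0 := by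
  rcases h with h | h
  · exact add_pos_of_pos_of_nonneg (abs_pos.2 h) (le_max_right _ _)
  · exact add_pos_of_nonneg_of_pos (abs_nonneg _) (lt_max_of_lt_left (by linarith))

theorem isOpen_cupDomain : IsOpen cupDomain :=
  (isOpen_ne_fun continuous_fst continuous_const).union
    (isOpen_lt (by fun_prop : Continuous fun q : E3 => q.2.2) continuous_const)

theorem cupCoord_continuousOn : ContinuousOn cupCoord cupDomain := by
  intro q hq
  refine ContinuousAt.continuousWithinAt ?_
  have hr : ContinuousAt (fun q : E3 => |q.1| + max (-q.2.2) 0) q := by fun_prop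
  have hx : ContinuousAt (fun q : E3 => q.1 / (|q.1| + max (-q.2.2) 0)) q :=
    continuousAt_fst.div hr (cupCoord_pos hq).ne'
  refine hr.prodMk ((by fun_prop : ContinuousAt (fun q : E3 => q.2.1) q).prodMk (hx.add ?_))
  -- The sign `x / |x|` jumps only at `x = 0`; there the domain forces `z < 0`, and the term
  -- containing it vanishes.
  by_cases h : q.1 = 0
  · have hz : q.2.2 < 0 := hq.resolve_left (not_not.2 h)
    refine (continuousAt_const (y := (0 : ℝ))).congr ?_
    filter_upwards [(isOpen_lt (by fun_prop : Continuous fun q : E3 => q.2.2)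
      continuous_const).mem_nhds hz] with p hp
    have hp : p.2.2 < 0 := hp
    rw [max_eq_right hp.le, mul_zero]
  · exact (continuousAt_fst.div (by fun_prop) (abs_ne_zero.2 h)).mul (by fun_prop)

theorem cupPoint_continuous : Continuous cupPoint := by unfold cupPoint; fun_prop

theorem cupPoint_inner {r y t : ℝ} (ht : |t| ≤ 1) : cupPoint (r, y, t) = (r * t, y, r * (|t| - 1)) := by
  have h := abs_le.1 ht
  simp only [cupPoint]
  rw [min_eq_right h.2, max_eq_right h.1, min_eq_left ht, max_eq_right (by linarith), add_zero]

theorem cupPoint_right {r y t : ℝ} (ht : 1 ≤ t) : cupPoint (r, y, t) = (r, y, t - 1) := by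
  simp only [cupPoint]
  rw [abs_of_nonneg (by linarith), min_eq_left ht, max_eq_right (by linarith), min_eq_right ht,
    max_eq_left (by linarith)]
  simp

theorem cupPoint_left {r y t : ℝ} (ht : t ≤ -1) : cupPoint (r, y, t) = (-r, y, -t - 1) := by
  simp only [cupPoint]
  rw [abs_of_nonpos (by linarith), min_eq_right (by linarith : t ≤ 1), max_eq_left ht,
    min_eq_right (by linarith), max_eq_left (by linarith)]
  simp

theorem cupCoord_right {x y z : ℝ} (hx : 0 < x) (hz : 0 ≤ z) : cupCoord (x, y, z) = (x, y, 1 + z) := by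
  simp only [cupCoord]
  rw [abs_of_pos hx, max_eq_right (by linarith), max_eq_left hz, add_zero, div_self hx.ne', one_mul]

theorem cupCoord_left {x y z : ℝ} (hx : x < 0) (hz : 0 ≤ z) : cupCoord (x, y, z) = (-x, y, -1 - z) := by
  simp only [cupCoord]
  rw [abs_of_neg hx, max_eq_right (by linarith), max_eq_left hz, add_zero, div_neg, div_self hx.ne]
  rw [Prod.mk.injEq, Prod.mk.injEq]; exact ⟨rfl, rfl, by ring⟩

theorem cupCoord_low {x y z : ℝ} (hz : z ≤ 0) :
    cupCoord (x, y, z) = (|x| - z, y, x / (|x| - z)) := by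
  simp only [cupCoord]
  rw [max_eq_left (by linarith : 0 ≤ -z), max_eq_right hz, mul_zero, add_zero, ← sub_eq_add_neg]

theorem cupPoint_cupCoord {q : E3} (h : q ∈ cupDomain) : cupPoint (cupCoord q) = q := by
  have hp := cupCoord_pos h
  obtain ⟨x, y, z⟩ := q
  rcases le_total z 0 with hz | hz
  · simp only at hp
    rw [max_eq_left (by linarith : 0 ≤ -z)] at hp
    have hp' : 0 < |x| - z := by linarith
    have ha : |x / (|x| - z)| = |x| / (|x| - z) := by rw [abs_div, abs_of_pos hp']
    rw [cupCoord_low hz, cupPoint_inner (by rw [ha, div_le_one hp']; linarith), ha,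
      Prod.mk.injEq, Prod.mk.injEq]
    refine ⟨by field_simp, rfl, by field_simp; ring⟩
  · have hx : x ≠ 0 := h.elim id (fun h => by simp only at h; linarith)
    rcases lt_or_gt_of_ne hx with hx | hx
    · rw [cupCoord_left hx hz, cupPoint_left (by linarith), Prod.mk.injEq, Prod.mk.injEq]
      exact ⟨by ring, rfl, by ring⟩
    · rw [cupCoord_right hx hz, cupPoint_right (by linarith), Prod.mk.injEq, Prod.mk.injEq]
      exact ⟨by ring, rfl, by ring⟩

theorem cupPoint_mem {q : E3} (h : 0 < q.1) : cupPoint q ∈ cupDomain := by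
  obtain ⟨r, y, t⟩ := q
  simp only at h
  rcases le_total |t| 1 with ht | ht
  · rw [cupPoint_inner ht]
    by_cases h0 : t = 0
    · right; rw [h0]; simpa using h
    · left; exact mul_ne_zero h.ne' h0
  · left
    rcases le_abs.1 ht with h' | h'
    · rw [cupPoint_right h']; exact h.ne'
    · rw [cupPoint_left (by linarith)]; exact (neg_ne_zero.2 h.ne')

theorem cupCoord_cupPoint {q : E3} (h : 0 < q.1) : cupCoord (cupPoint q) = q := by
  obtain ⟨r, y, t⟩ := q
  simp only at h
  rcases le_total |t| 1 with ht | ht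
  · have e : |r * t| - r * (|t| - 1) = r := by rw [abs_mul, abs_of_pos h]; ring
    rw [cupPoint_inner ht, cupCoord_low (by nlinarith), e, mul_div_cancel_left₀ _ h.ne']
  · rcases le_abs.1 ht with h' | h'
    · rw [cupPoint_right h', cupCoord_right h (by linarith), add_sub_cancel]
    · rw [cupPoint_left (by linarith), cupCoord_left (by linarith) (by linarith), Prod.mk.injEq,
        Prod.mk.injEq]
      exact ⟨by ring, rfl, by ring⟩

/-- A slide along the cups by three units, with windows. -/
theorem exists_cupSlide {c ε : ℝ} (hc : 0 < c) (hε : 0 < ε) (hε1 : ε ≤ 1 / 2) :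
    ∃ h : E3 ≃ₜ E3, (∀ q ∉ cupBox, h q = q) ∧ ∀ r y t, 2 * c ≤ r → r ≤ 1 - c → |y| ≤ 1 - c →
      -2 ≤ t → t ≤ 2 → ∃ t', -2 ≤ t' ∧ t' ≤ t ∧ t - 3 ≤ t' ∧ h (cupPoint (r, y, t)) = cupPoint (r, y, t') ∧
        (t ≤ 1 + ε → t' ≤ -2 + ε) ∧ (1 + ε ≤ t → t ≤ 2 - ε → t' = t - 3) := by
  let d : E3 → ℝ := fun q => min (1 - |q.2.1|) (min (1 - q.1) (q.1 - c))
  -- A shift by `-3`, slowed down near the far end `t = -2`, and damped to the identity near `t = 2`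
  -- and near the walls by slopes `5 / ε` and `5 / c`. At unit scale `5` beats any displacement in
  -- `[-2, 2]`.
  let G : E3 → ℝ := fun q => min q.2.2 (max (q.2.2 - 3) (max (-2 + ε / 4 * (q.2.2 + 2))
    (max (q.2.2 - 5 / ε * (2 - q.2.2)) (q.2.2 - 5 / c * d q))))
  have hG : ∀ q : E3, 2 ≤ |q.2.2| ∨ d q ≤ 0 → G q = q.2.2 := fun q hq => by
    refine min_eq_left (le_max_of_le_right ?_)
    have h5 : 0 < 5 / ε := by positivity
    have h6 : 0 < 5 / c := by positivity
    rcases hq with h | h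
    · rcases le_abs.1 h with h | h
      · exact le_max_of_le_right (le_max_of_le_left (by nlinarith))
      · exact le_max_of_le_left (by nlinarith)
    · exact le_max_of_le_right (le_max_of_le_right (by nlinarith))
  obtain ⟨g, hg⟩ := exists_zHomeo G (by simp only [G, d]; fun_prop)
    (fun x y a b h => min_lt_min h (max_lt_max (by simp only; linarith) (max_lt_max
      (by simp only; nlinarith) (max_lt_max (by
        have : 0 < 5 / ε := by positivity
        simp only; nlinarith) (by simp only [d]; linarith))))) 2
    (fun x y z hz => hG (x, y, z) (Or.inl hz))
  have hgC : ∀ q : E3, q ∉ Icc c 1 ×ˢ (Icc (-1) 1 ×ˢ Icc (-2) 2) → g q = q := fun q hq => by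
    rw [hg, hG]
    by_contra! hcon
    obtain ⟨h1, h2⟩ := hcon
    rw [lt_min_iff, lt_min_iff, sub_pos, abs_lt] at h2
    rw [abs_lt] at h1
    exact hq ⟨⟨by linarith [h2.2.2], by linarith [h2.2.1]⟩, ⟨h2.1.1.le, h2.1.2.le⟩, h1.1.le, h1.2.le⟩
  obtain ⟨h, hh, hh'⟩ := exists_transport (A := cupDomain) (B := {q : E3 | 0 < q.1}) isOpen_cupDomain
    cupCoord_continuousOn cupPoint_continuous.continuousOn (fun q hq => cupCoord_pos hq)
    (fun q hq => cupPoint_mem hq) (fun q hq => cupPoint_cupCoord hq) (fun q hq => cupCoord_cupPoint hq)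
    (C := Icc c 1 ×ˢ (Icc (-1) 1 ×ˢ Icc (-2) 2)) (isCompact_Icc.prod (isCompact_Icc.prod isCompact_Icc))
    (fun q hq => hc.trans_le hq.1.1) g hgC
  refine ⟨h, fun q hq => ?_, fun r y t hr hr1 hy ht ht2 => ?_⟩
  · by_cases hd : q ∈ cupDomain
    · rw [hh _ hd]
      by_cases hf : 2 ≤ |(cupCoord q).2.2| ∨ d (cupCoord q) ≤ 0
      · rw [hg, hG _ hf]
        exact cupPoint_cupCoord hd
      · refine absurd ?_ hq
        rw [← cupPoint_cupCoord hd]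
        generalize cupCoord q = p at hf
        obtain ⟨r, y, t⟩ := p
        push Not at hf
        obtain ⟨h1, h2⟩ := hf
        rw [lt_min_iff, lt_min_iff, sub_pos] at h2
        obtain ⟨h2, h3, h4⟩ := h2
        simp only at h1 h2 h3 h4
        rcases le_total |t| 1 with ht | ht
        · rw [cupPoint_inner ht]
          refine ⟨?_, h2, ?_, ?_⟩
          · simp only
            rw [abs_mul, abs_of_pos (by linarith : 0 < r)]
            nlinarith [abs_nonneg t]
          · simp only; nlinarith [abs_nonneg t]
          · simp only; nlinarith [abs_nonneg t]
        · rcases le_abs.1 ht with h' | h'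
          · rw [abs_of_nonneg (by linarith)] at h1
            rw [cupPoint_right h']
            refine ⟨abs_lt.2 ⟨?_, ?_⟩, h2, ?_, ?_⟩ <;> simp only <;> linarith
          · rw [abs_of_nonpos (by linarith)] at h1
            rw [cupPoint_left (by linarith)]
            refine ⟨abs_lt.2 ⟨?_, ?_⟩, h2, ?_, ?_⟩ <;> simp only <;> linarith
    · exact hh' q fun h => absurd h hd
  · have hd : c ≤ d (r, y, t) := le_min (by linarith) (le_min (by simp only; linarith) (by simp only; linarith))
    have h5 : 5 ≤ 5 / c * d (r, y, t) := by rw [div_mul_eq_mul_div, le_div_iff₀ hc]; linarith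
    refine ⟨G (r, y, t), ?_, min_le_left _ _, ?_, ?_, ?_, ?_⟩
    · exact le_min ht (le_max_of_le_right (le_max_of_le_left (by simp only; nlinarith)))
    · exact le_min (by simp only; linarith) (le_max_left _ _)
    · rw [hh _ (cupPoint_mem (by simp only; linarith)), cupCoord_cupPoint (by simp only; linarith), hg]
    · intro h
      refine (min_le_right _ _).trans (max_le (by simp only; linarith) (max_le (by simp only; nlinarith)
        (max_le ?_ (by simp only; linarith))))
      simp only
      have : 5 ≤ 5 / ε * (2 - t) := by
        rw [div_mul_eq_mul_div, le_div_iff₀ hε]; linarith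
      linarith
    · intro h h'
      have : 5 ≤ 5 / ε * (2 - t) := by
        rw [div_mul_eq_mul_div, le_div_iff₀ hε]; linarith
      simp only [G]
      rw [max_eq_left, min_eq_right (by linarith)]
      exact max_le (by nlinarith) (max_le (by linarith) (by linarith))

/-! ### Moving a string link from the right legs to the left legs -/

namespace StringLink

/-- The right leg occupies `1 ≤ t ≤ 2` and the left leg `-2 ≤ t ≤ -1`. The shift by `3` sends height
`v` on the right to height `1 - v` on the left, at the same distance from the core: this is the half
turn, whence `X.rot`. -/
theorem exists_cup_slide {l : ℕ} (X : StringLink l) : ∃ h : E3 ≃ₜ E3, (∀ q ∉ cupBox, h q = q) ∧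
    ∀ i, ∀ q ∈ capSet ((one l).juxt X) i, h q ∈ capSet (X.rot.juxt (one l)) i := by
  obtain ⟨ε₁, hε₁, hε₁', hv, -⟩ := exists_collar X
  obtain ⟨ε₂, hε₂, hε₂', -, hm⟩ := exists_collar (X.rot.juxt (one l))
  obtain ⟨δ, hδ, hδ', hX⟩ := exists_margin X
  obtain ⟨ε, hε, hle₁, hle₂⟩ : ∃ ε : ℝ, 0 < ε ∧ ε ≤ ε₁ ∧ ε ≤ ε₂ :=
    ⟨min ε₁ ε₂, by positivity, min_le_left _ _, min_le_right _ _⟩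
  obtain ⟨h, ho, hh⟩ := exists_cupSlide (c := δ / 4) (ε := ε) (by linarith) hε (by linarith)
  have slide : ∀ i, ∀ q ∈ range (X.strand i), ∀ t, -2 ≤ t → t ≤ 2 → ∃ t', -2 ≤ t' ∧ t' ≤ t ∧ t - 3 ≤ t' ∧
      h (cupPoint ((q.1 + 1) / 2, q.2.1, t)) = cupPoint ((q.1 + 1) / 2, q.2.1, t') ∧
        (t ≤ 1 + ε → t' ≤ -2 + ε) ∧ (1 + ε ≤ t → t ≤ 2 - ε → t' = t - 3) := fun i q hq t ht ht' => by
    obtain ⟨h1, h2⟩ := hX i q hq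
    have h1 := abs_le.1 h1
    exact hh _ _ t (by linarith) (by linarith) (h2.trans (by linarith)) ht ht'
  -- On a core line the target is known in the collars of `X.rot`, along the cup, and on the trivial
  -- right leg; everything except the non-vertical part of `X` lands there.
  have core : ∀ i t, -2 ≤ t → t ≤ 2 → (t ≤ -2 + ε ∨ -1 - ε ≤ t) →
      cupPoint (rad l i, 0, t) ∈ capSet (X.rot.juxt (one l)) i := fun i t ht ht' h => by
    have hr := rad_bounds i
    rcases le_total |t| 1 with h1 | h1
    · have h2 := abs_le.1 h1
      rw [cupPoint_inner h1]
      refine Or.inl (Or.inr (mem_cup_iff.2 ⟨rfl, ?_, ?_⟩))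
      · simp only; nlinarith
      · simp only
        rcases le_total t 0 with h | h
        · left; rw [abs_of_nonpos h]; exact ⟨by nlinarith, by ring⟩
        · right; rw [abs_of_nonneg h]; exact ⟨by nlinarith, by ring⟩
    · rcases le_abs.1 h1 with h2 | h2
      · rw [cupPoint_right h2, ← marked_high]
        refine Or.inr ?_
        rw [juxt_range_right, rightHalf_marked]
        exact mem_image_of_mem _ (mem_one_iff.2 ⟨_, by linarith, by linarith, rfl⟩)
      · rw [cupPoint_left (by linarith), ← marked_low]
        exact Or.inl (Or.inl (hm _ _ (by linarith) (by linarith)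
          (h.elim (fun h => Or.inr (by linarith)) (fun h => Or.inl (by linarith)))))
  have slide_core : ∀ i t, -2 ≤ t → t ≤ 1 → h (cupPoint (rad l i, 0, t)) ∈ capSet (X.rot.juxt (one l)) i :=
    fun i t ht ht' => by
      obtain ⟨t', h1, h2, -, h3, h4, -⟩ := slide i (marked l i 0) ⟨0, (X.strand i).source⟩ t ht (by linarith)
      change h (cupPoint (rad l i, 0, t)) = cupPoint (rad l i, 0, t') at h3
      rw [h3]
      exact core i t' h1 (by linarith) (Or.inl (h4 (by linarith)))
  refine ⟨h, ho, fun i q hq => ?_⟩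
  have hr := rad_bounds i
  rcases hq with (hq | hq) | hq
  · rw [juxt_range_left] at hq
    obtain ⟨_, hp', rfl⟩ := hq
    obtain ⟨s, h0, h1, rfl⟩ := mem_one_iff.1 hp'
    have := slide_core i (-1 - s) (by linarith) (by linarith)
    rwa [cupPoint_left (by linarith), show -(-1 - s) - 1 = s by ring, ← marked_low, leftHalf_marked] at this
  · obtain ⟨hy, hz, h'⟩ := cup_spec hq
    obtain ⟨x, y, z⟩ := q
    simp only at hy hz h'
    subst hy
    have hz' : |x| = z + rad l i := by
      rcases h' with ⟨h, h'⟩ | ⟨h, h'⟩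
      · rw [abs_of_nonpos h]; linarith
      · rw [abs_of_nonneg h]; linarith
    have ht : |x / rad l i| ≤ 1 := by
      rw [abs_div, abs_of_pos hr.1, div_le_one hr.1]; linarith
    have := slide_core i (x / rad l i) (by linarith [(abs_le.1 ht).1]) (abs_le.1 ht).2
    rwa [cupPoint_inner ht, abs_div, abs_of_pos hr.1, mul_div_cancel₀ _ hr.1.ne', hz', mul_sub,
      mul_div_cancel₀ _ hr.1.ne', mul_one, add_sub_cancel_right] at this
  · rw [juxt_range_right] at hq
    obtain ⟨⟨u, y, v⟩, hp, rfl⟩ := hq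
    obtain ⟨-, -, ⟨hv0, hv1⟩, -⟩ := X.mem_bounds hp
    simp only at hv0 hv1
    have e : rightHalf (u, y, v) = cupPoint ((u + 1) / 2, y, 1 + v) := by
      rw [cupPoint_right (by linarith), add_sub_cancel_left]; rfl
    obtain ⟨t', h1, h2, h2', h3, h4, h5⟩ := slide i _ hp (1 + v) (by linarith) (by linarith)
    simp only at h3
    rw [e, h3]
    have hcore : (v ≤ ε ∨ 1 - ε ≤ v) → (u + 1) / 2 = rad l i ∧ y = 0 := fun hve => by
      obtain ⟨hx, hy⟩ := hv i _ hp (hve.imp (fun h => h.trans hle₁) (fun h => by simp only; linarith))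
      simp only at hx hy
      exact ⟨by rw [hx]; rfl, hy⟩
    rcases le_total v ε with hve | hve
    · obtain ⟨hx, rfl⟩ := hcore (Or.inl hve)
      rw [hx]
      exact core i t' h1 (by linarith) (Or.inl (h4 (by linarith)))
    · rcases le_total v (1 - ε) with hve' | hve'
      · rw [h5 (by linarith) (by linarith), cupPoint_left (by linarith)]
        refine Or.inl (Or.inl ?_)
        rw [juxt_range_left, rot_range, Fin.rev_rev]
        refine ⟨_, ⟨_, hp, rfl⟩, ?_⟩
        simp only [leftHalf, turn]
        rw [Prod.mk.injEq, Prod.mk.injEq]; exact ⟨by ring, rfl, by ring⟩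
      · obtain ⟨hx, rfl⟩ := hcore (Or.inr hve')
        rw [hx]
        exact core i t' h1 (by linarith) (Or.inr (by linarith))

theorem bend_slide {l : ℕ} (X : StringLink l) (T : StringLink (l + l)) :
    (((one l).juxt X).stack T).bend.HomeoEq ((X.rot.juxt (one l)).stack T).bend := by
  obtain ⟨h, ho, hi⟩ := exists_cup_slide X
  exact HomeoEq.bend_of_capSet T h ho hi

end StringLink

/-! ### Orientation preserving homeomorphisms of the circle -/

/-- Cut the circle at the fixed point `0`. On the open interval the homeomorphism is monotone, and
the two further points show that it is increasing. -/
theorem exists_lift_of_zero {ψ : UnitAddCircle → UnitAddCircle} (hc : Continuous ψ)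
    (hb : Function.Bijective ψ) (h0 : ψ 0 = 0) {a b a' b' : ℝ} (ha : 0 < a) (hab : a < b) (hb1 : b < 1)
    (ha' : 0 < a') (hab' : a' < b') (hb1' : b' < 1) (hψa : ψ a = a') (hψb : ψ b = b') :
    ∃ φ : ℝ ≃o ℝ, (∀ t, φ (t + 1) = φ t + 1) ∧ ∀ t : ℝ, ψ t = (φ t : ℝ) := by
  let u : ℝ → ℝ := fun t => (AddCircle.equivIco (1 : ℝ) 0 (ψ t) : ℝ)
  have hu : ∀ t, ((u t : ℝ) : UnitAddCircle) = ψ t := fun t =>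
    (AddCircle.equivIco (1 : ℝ) 0).symm_apply_apply (ψ t)
  have hu0 : ∀ t, 0 ≤ u t := fun t => (AddCircle.equivIco (1 : ℝ) 0 (ψ t)).2.1
  have hu1 : ∀ t, u t < 1 := fun t => by
    simpa using (AddCircle.equivIco (1 : ℝ) 0 (ψ t)).2.2
  have huv : ∀ t v : ℝ, 0 ≤ v → v < 1 → ψ t = v → u t = v := fun t v h h' e => by
    change (AddCircle.equivIco (1 : ℝ) 0 (ψ t) : ℝ) = v
    rw [e, AddCircle.equivIco_coe_eq (by simpa using ⟨h, h'⟩)]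
  have hper : ∀ t, u (Int.fract t) = u t := fun t => by
    change (AddCircle.equivIco (1 : ℝ) 0 (ψ _) : ℝ) = AddCircle.equivIco (1 : ℝ) 0 (ψ _)
    rw [AddCircle.coe_fract]
  have hinj : ∀ s t : ℝ, 0 ≤ s → s < 1 → 0 ≤ t → t < 1 → ψ s = ψ t → s = t := fun s t hs hs' ht ht' h =>
    (AddCircle.coe_eq_coe_iff_of_mem_Ico (p := (1 : ℝ)) (a := 0) (by simpa using ⟨hs, hs'⟩)
      (by simpa using ⟨ht, ht'⟩)).1 (hb.1 h)
  have hz : ∀ t ∈ Ioo (0 : ℝ) 1, ψ t ≠ 0 := fun t ht h =>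
    ht.1.ne (hinj 0 t le_rfl one_pos ht.1.le ht.2 (by rw [h]; simpa using h0))
  have hcont : ContinuousOn u (Ioo 0 1) := fun t ht => by
    refine ContinuousAt.continuousWithinAt ?_
    have h1 : ContinuousAt (fun t : ℝ => ψ t) t :=
      (hc.comp (AddCircle.continuous_mk' (1 : ℝ))).continuousAt
    exact continuous_subtype_val.continuousAt.comp
      ((AddCircle.continuousAt_equivIco (1 : ℝ) 0 (by simpa using hz t ht)).comp h1)
  -- A continuous injection of an interval is strictly increasing or strictly decreasing; the points
  -- `a < b` exclude the second case.
  have hmono : StrictMonoOn u (Ioo 0 1) := by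
    rcases hcont.strictMonoOn_of_injOn_Ioo one_pos (fun s hs t ht h => hinj s t hs.1.le hs.2 ht.1.le ht.2
      (by rw [← hu, ← hu, h])) with h | h
    · exact h
    · have := h ⟨ha, hab.trans hb1⟩ ⟨ha.trans hab, hb1⟩ hab
      rw [huv a a' ha'.le (hab'.trans hb1') hψa, huv b b' (ha'.trans hab').le hb1' hψb] at this
      linarith
  have hpos : ∀ t ∈ Ioo (0 : ℝ) 1, 0 < u t := fun t ht => (hu0 t).lt_of_ne fun h => hz t ht (by
    rw [← hu, ← h]; simp)
  have hu_zero : u 0 = 0 := huv 0 0 le_rfl one_pos (by simpa using h0)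
  -- The lift: integer part plus the representative in `[0, 1)` of the image.
  let f : ℝ → ℝ := fun t => ⌊t⌋ + u t
  have hf : StrictMono f := fun s t hst => by
    rcases (Int.floor_mono hst.le).eq_or_lt with h | h
    · have h1 : Int.fract s < Int.fract t := by unfold Int.fract; rw [h]; linarith
      have h2 : u (Int.fract s) < u (Int.fract t) := by
        have h3 : Int.fract t ∈ Ioo (0 : ℝ) 1 := ⟨(Int.fract_nonneg s).trans_lt h1, Int.fract_lt_one t⟩
        rcases (Int.fract_nonneg s).eq_or_lt with h4 | h4
        · rw [← h4, hu_zero]; exact hpos _ h3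
        · exact hmono ⟨h4, Int.fract_lt_one s⟩ h3 h1
      rw [hper, hper] at h2
      change (⌊s⌋ : ℝ) + u s < ⌊t⌋ + u t
      rw [h]; linarith
    · have h1 : (⌊s⌋ : ℝ) + 1 ≤ ⌊t⌋ := by exact_mod_cast h
      change (⌊s⌋ : ℝ) + u s < ⌊t⌋ + u t
      linarith [hu1 s, hu0 t]
  have hadd : ∀ (t : ℝ) (k : ℤ), u (t + k) = u t := fun t k => by
    rw [← hper (t + k), Int.fract_add_intCast, hper]
  have hs : Function.Surjective f := fun y => by
    obtain ⟨x, hx⟩ := hb.2 (Int.fract y : ℝ)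
    obtain ⟨t, ht, rfl⟩ := exists_rep x
    refine ⟨t + ⌊y⌋, ?_⟩
    change ((⌊t + ⌊y⌋⌋ : ℤ) : ℝ) + u (t + ⌊y⌋) = y
    rw [hadd, huv t _ (Int.fract_nonneg y) (Int.fract_lt_one y) hx, Int.floor_add_intCast,
      Int.floor_eq_zero_iff.2 ht, zero_add, Int.floor_add_fract]
  refine ⟨hf.orderIsoOfSurjective f hs, fun t => ?_, fun t => ?_⟩
  · change ((⌊t + 1⌋ : ℤ) : ℝ) + u (t + 1) = ⌊t⌋ + u t + 1
    have := hadd t 1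
    push_cast at this
    rw [this, Int.floor_add_one]
    push_cast; ring
  · change ψ t = (((⌊t⌋ : ℝ) + u t : ℝ) : UnitAddCircle)
    have h : ((⌊t⌋ : ℝ) : UnitAddCircle) = 0 := (AddCircle.coe_eq_zero_iff (1 : ℝ)).2 ⟨⌊t⌋, by simp⟩
    rw [AddCircle.coe_add, hu, h, zero_add]

/-- Translating `t₁` and `s₁` to `0` reduces this to the previous lemma: three points in cyclic
order fix the orientation. -/
theorem exists_lift {ψ : UnitAddCircle → UnitAddCircle} (hc : Continuous ψ)
    (hb : Function.Bijective ψ) {t₁ t₂ t₃ s₁ s₂ s₃ : ℝ} (ht : t₁ < t₂) (ht' : t₂ < t₃) (ht1 : t₃ < t₁ + 1)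
    (hs : s₁ < s₂) (hs' : s₂ < s₃) (hs1 : s₃ < s₁ + 1) (h₁ : ψ t₁ = s₁) (h₂ : ψ t₂ = s₂) (h₃ : ψ t₃ = s₃) :
    ∃ φ : ℝ ≃o ℝ, (∀ t, φ (t + 1) = φ t + 1) ∧ ∀ t : ℝ, ψ t = (φ t : ℝ) := by
  obtain ⟨φ, h, h'⟩ := exists_lift_of_zero (ψ := fun x => ψ (x + t₁) - s₁) (by fun_prop)
    ((Equiv.subRight (s₁ : UnitAddCircle)).bijective.comp
      (hb.comp (Equiv.addRight (t₁ : UnitAddCircle)).bijective)) (by simp [h₁])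
    (a := t₂ - t₁) (b := t₃ - t₁) (a' := s₂ - s₁) (b' := s₃ - s₁) (by linarith) (by linarith) (by linarith)
    (by linarith) (by linarith) (by linarith) (by simp [h₂]) (by simp [h₃])
  refine ⟨(OrderIso.subRight t₁).trans (φ.trans (OrderIso.addRight s₁)), fun t => ?_, fun t => ?_⟩
  · simp only [OrderIso.trans_apply, OrderIso.subRight_apply, OrderIso.addRight_apply]
    rw [show t + 1 - t₁ = t - t₁ + 1 by ring, h]; ring
  · simp only [OrderIso.trans_apply, OrderIso.subRight_apply, OrderIso.addRight_apply]
    rw [AddCircle.coe_add, ← h']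
    simp

/-! ### Isotopies of links -/

theorem AmbientIsotopy.at_continuous (H : AmbientIsotopy) (s : unitInterval) : Continuous (H.at s) := by
  unfold AmbientIsotopy.at; fun_prop

theorem AmbientIsotopy.at_injective (H : AmbientIsotopy) (s : unitInterval) :
    Function.Injective (H.at s) := fun x y h => by
  have : H.toHomeo (s, x) = H.toHomeo (s, y) := Prod.ext (by rw [H.level, H.level]) h
  exact (Prod.ext_iff.1 (H.toHomeo.injective this)).2

theorem Link.component_injective {n : ℕ} (K : Link n) (i : Fin n) : Function.Injective (K.component i) :=
  fun x y h => (Prod.ext_iff.1 (@K.injective (i, x) (i, y) h)).2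

/-- An ambient isotopy which takes each component of `K` to that of `L`, and three points on each
component to three points in the same cyclic order, is an isotopy of links. -/
theorem Link.Isotopic.of_image {n : ℕ} {K L : Link n} (H : AmbientIsotopy)
    (hr : ∀ i, H.at 1 '' range (K.component i) = range (L.component i))
    (hp : ∀ i, ∃ t₁ t₂ t₃ s₁ s₂ s₃ : ℝ, t₁ < t₂ ∧ t₂ < t₃ ∧ t₃ < t₁ + 1 ∧ s₁ < s₂ ∧ s₂ < s₃ ∧ s₃ < s₁ + 1 ∧
      H.at 1 (K.component i t₁) = L.component i s₁ ∧ H.at 1 (K.component i t₂) = L.component i s₂ ∧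
      H.at 1 (K.component i t₃) = L.component i s₃) : K.Isotopic L := by
  refine ⟨H, fun i => ?_⟩
  have hL := L.component_injective i
  have hK := (H.at_injective 1).comp (K.component_injective i)
  have hKc := (H.at_continuous 1).comp (K.component i).continuous
  have hrange : range (H.at 1 ∘ K.component i) = range (L.component i) := by rw [range_comp, hr]
  obtain ⟨ψ, hψ, h⟩ := exists_reparam hKc (L.component i).continuous hL hrange.subset
  have hb : Function.Bijective ψ := by
    refine ⟨fun x y e => hK (by rw [← h, ← h, e]), fun y => ?_⟩
    obtain ⟨x, hx⟩ := hrange.superset (mem_range_self y)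
    exact ⟨x, hL (by rw [h, hx])⟩
  obtain ⟨t₁, t₂, t₃, s₁, s₂, s₃, h1, h2, h3, h4, h5, h6, e1, e2, e3⟩ := hp i
  obtain ⟨φ, hφ, hφ'⟩ := exists_lift hψ hb h1 h2 h3 h4 h5 h6 (hL ((h _).trans e1)) (hL ((h _).trans e2))
    (hL ((h _).trans e3))
  exact ⟨φ, hφ, fun t => by rw [← hφ', h]; rfl⟩


/-! ### Plat closures -/

theorem extend_one {a b : E3} (γ : Path a b) {t : ℝ} (h : t = 1) : γ.extend t = b := by
  rw [h, Path.extend_one]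

/-- Concatenation by halving gives the cup the times `[0, 1/8]`, the right string `[1/8, 1/4]`, the
cap `[1/4, 1/2]`, and the left string the rest. These points are the witnesses for cyclic order. -/
theorem platLoop_extend {l : ℕ} (S : StringLink (l + l)) (i : Fin l) :
    (platLoop S i).extend 0 = (-rad l i, 0, 0) ∧ (platLoop S i).extend (1 / 16) = (0, 0, -rad l i) ∧
    (platLoop S i).extend (1 / 8) = (rad l i, 0, 0) ∧ (platLoop S i).extend (1 / 4) = (rad l i, 0, 1) ∧
    (platLoop S i).extend (3 / 8) = (0, 0, 1 + rad l i) ∧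
    (platLoop S i).extend (1 / 2) = (-rad l i, 0, 1) := by
  have first : ∀ t : ℝ, t ≤ 1 / 8 → (platLoop S i).extend t = (cup l i).extend (8 * t) := fun t ht => by
    rw [platLoop, Path.extend_trans_of_le_half _ _ (by linarith), platPath,
      Path.extend_trans_of_le_half _ _ (by linarith), Path.extend_trans_of_le_half _ _ (by linarith)]
    congr 1; ring
  have second : ∀ t : ℝ, 1 / 4 ≤ t → t ≤ 1 / 2 → (platLoop S i).extend t = (cap l i).extend (4 * t - 1) :=
    fun t ht ht' => by
      rw [platLoop, Path.extend_trans_of_le_half _ _ (by linarith), platPath,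
        Path.extend_trans_of_half_le _ _ (by linarith)]
      congr 1; ring
  refine ⟨?_, ?_, ?_, ?_, ?_, ?_⟩
  · rw [Path.extend_zero, marked_low]
  · rw [first _ (by norm_num), cup, Path.extend_trans_of_le_half _ _ (by norm_num), extend_one _ (by norm_num)]
  · rw [first _ (by norm_num), extend_one _ (by norm_num), marked_high]
  · rw [second _ (by norm_num) (by norm_num), show (4 * (1 / 4) - 1 : ℝ) = 0 by norm_num, Path.extend_zero,
      marked_high]
  · rw [second _ (by norm_num) (by norm_num), cap, Path.extend_trans_of_le_half _ _ (by norm_num),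
      extend_one _ (by norm_num)]
  · rw [second _ (by norm_num) (by norm_num), extend_one _ (by norm_num), marked_low]

theorem plat_apply {l : ℕ} (S : StringLink (l + l)) (i : Fin l) {t : ℝ} (h0 : 0 ≤ t) (h1 : t < 1) :
    S.plat.component i (t : UnitAddCircle) = (platLoop S i).extend t :=
  circleMap_apply (platLoop S i) ⟨h0, h1⟩

theorem plat_range {l : ℕ} (S : StringLink (l + l)) (i : Fin l) :
    range (S.plat.component i) = capSet S i ∪ range (cap l i) := by
  change range (circleMap (platLoop S i)) = _
  rw [circleMap_range, platLoop_range, capSet]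
  ext q
  simp only [mem_union]
  tauto

namespace StringLink

/-- The arc `capSet S i`, from its left end to its right end. -/
noncomputable def capPath {l : ℕ} (S : StringLink (l + l)) (i : Fin l) :
    Path (marked (l + l) (Fin.castAdd l i.rev) 1) (marked (l + l) (Fin.natAdd l i) 1) :=
  ((S.strand (Fin.castAdd l i.rev)).symm.trans (cup l i)).trans (S.strand (Fin.natAdd l i))

theorem capPath_range {l : ℕ} (S : StringLink (l + l)) (i : Fin l) :
    range (capPath S i) = capSet S i := by
  rw [capPath, Path.trans_range, Path.trans_range, Path.symm_range, capSet]

theorem capPath_injective {l : ℕ} (S : StringLink (l + l)) (i : Fin l) :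
    Function.Injective (capPath S i) := by
  refine trans_injective (trans_injective (symm_injective (S.strand_injective _)) (cup_injective i) ?_)
    (S.strand_injective _) ?_
  · intro q h h'
    rw [Path.symm_range] at h
    exact (cup_strand (cup_spec h') h).2
  · intro q h h'
    rw [Path.trans_range, Path.symm_range] at h
    rcases h with h | h
    · exact absurd (S.eq_of_mem h h') (castAdd_ne_natAdd _ _)
    · exact (cup_strand (cup_spec h) h').2

/-- A component is the arc `capSet` together with its cap. The support of `h` lies below the caps,
so the arcs keep their ends and containment again gives equality. -/
theorem plat_of_capSet {l : ℕ} {S S' : StringLink (l + l)} (h : E3 ≃ₜ E3) (ho : ∀ q ∉ cupBox, h q = q)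
    (hi : ∀ i, ∀ q ∈ capSet S i, h q ∈ capSet S' i) : S.plat.Isotopic S'.plat := by
  obtain ⟨H, H1, -⟩ := exists_ambientIsotopy h (R := 3) (fun x hx => ho x (fun hm => by
    obtain ⟨h1, h2, h3, h4⟩ := hm
    have : ‖x‖ ≤ 3 := by
      rw [Prod.norm_def, Prod.norm_def]
      exact max_le (h1.le.trans (by norm_num)) (max_le (h2.le.trans (by norm_num))
        (abs_le.2 ⟨h3.le, by linarith⟩))
    linarith)) 0
  have fix : ∀ q : E3, 1 ≤ q.2.2 → h q = q := fun q hq => ho q fun hm => by linarith [hm.2.2.2]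
  have hcap : ∀ i, ∀ q ∈ range (cap l i), h q = q := fun i q hq => by
    refine fix q ?_
    have := (cap_spec hq).2.1
    simp only [flip] at this
    linarith
  refine Link.Isotopic.of_image H (fun i => ?_) (fun i => ?_)
  · rw [image_congr fun x _ => H1 x, plat_range, plat_range, image_union,
      (image_congr (hcap i)).trans (image_id' _)]
    congr 1
    have e0 : h (marked (l + l) (Fin.castAdd l i.rev) 1) = marked (l + l) (Fin.castAdd l i.rev) 1 :=
      fix _ le_rfl
    have e1 : h (marked (l + l) (Fin.natAdd l i) 1) = marked (l + l) (Fin.natAdd l i) 1 := fix _ le_rfl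
    rw [← capPath_range, ← capPath_range, ← mapPath_range (capPath S i) h.continuous e0.symm e1.symm]
    refine arc_eq_of_subset _ _ (capPath_injective S' i) ?_
    rw [mapPath_range, capPath_range, capPath_range]
    rintro _ ⟨q, hq, rfl⟩
    exact hi i q hq
  -- Three points of the cap are fixed, so orientation is preserved.
  · have hr := rad_bounds i
    obtain ⟨-, -, -, a1, a2, a3⟩ := platLoop_extend S i
    obtain ⟨-, -, -, b1, b2, b3⟩ := platLoop_extend S' i
    refine ⟨1 / 4, 3 / 8, 1 / 2, 1 / 4, 3 / 8, 1 / 2, by norm_num, by norm_num, by norm_num, by norm_num,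
      by norm_num, by norm_num, ?_, ?_, ?_⟩ <;>
    rw [plat_apply _ _ (by norm_num) (by norm_num), plat_apply _ _ (by norm_num) (by norm_num), H1]
    · rw [a1, b1, fix _ le_rfl]
    · rw [a2, b2, fix _ (by simp only; linarith)]
    · rw [a3, b3, fix _ le_rfl]

theorem plat_snake {l : ℕ} (U : StringLink (l + l)) : U.bend.closure.Isotopic U.plat := by
  obtain ⟨h, ho, hi⟩ := exists_cup_snake U
  exact plat_of_capSet h ho hi

end StringLink

/-- The rotation about the axis `x = 0`, `z = 1 / 2` through the angle `θ`. -/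
noncomputable def rotation (θ : ℝ) (q : E3) : E3 :=
  (Real.cos θ * q.1 - Real.sin θ * (q.2.2 - 1 / 2), q.2.1,
    1 / 2 + (Real.sin θ * q.1 + Real.cos θ * (q.2.2 - 1 / 2)))

theorem rotation_neg (θ : ℝ) (q : E3) : rotation (-θ) (rotation θ q) = q := by
  have h := Real.sin_sq_add_cos_sq θ
  simp only [rotation, Real.cos_neg, Real.sin_neg]
  refine Prod.ext ?_ (Prod.ext rfl ?_)
  · simp only; linear_combination q.1 * h
  · simp only; linear_combination (q.2.2 - 1 / 2) * h

/-- The half turn as an ambient isotopy. -/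
noncomputable def halfTurn : AmbientIsotopy where
  toHomeo :=
    { toFun := fun p => (p.1, rotation (Real.pi * p.1) p.2)
      invFun := fun p => (p.1, rotation (-(Real.pi * p.1)) p.2)
      left_inv := fun p => Prod.ext rfl (rotation_neg _ _)
      right_inv := fun p => Prod.ext rfl (by
        have := rotation_neg (-(Real.pi * p.1)) p.2
        rwa [neg_neg] at this)
      continuous_toFun := by unfold rotation; fun_prop
      continuous_invFun := by unfold rotation; fun_prop }
  level := fun _ => rfl
  start := fun x => Prod.ext rfl (by simp [rotation])

theorem halfTurn_one (q : E3) : halfTurn.at 1 q = turn q := by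
  change rotation (Real.pi * ((1 : unitInterval) : ℝ)) q = turn q
  simp only [rotation, turn, Icc.coe_one, mul_one, Real.cos_pi, Real.sin_pi]
  refine Prod.ext ?_ (Prod.ext rfl ?_)
  · simp only; ring
  · simp only; ring

theorem turn_turn (q : E3) : turn (turn q) = q := by
  simp [turn]

theorem turn_image_cup {l : ℕ} (i : Fin l) : turn '' range (cup l i) = range (cap l i) := by
  have ha := rad_bounds i
  rw [cup, cap, Path.trans_range, Path.trans_range, image_union, Path.range_segment, Path.range_segment,
    Path.range_segment, Path.range_segment]
  have seg : ∀ a b : E3, turn '' segment ℝ a b = segment ℝ (turn a) (turn b) := fun a b => by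
    ext q
    constructor
    · rintro ⟨_, ⟨s, t, hs, ht, hst, rfl⟩, rfl⟩
      exact ⟨s, t, hs, ht, hst, (turn_aff a b s t hst).symm⟩
    · rintro ⟨s, t, hs, ht, hst, rfl⟩
      exact ⟨_, ⟨s, t, hs, ht, hst, rfl⟩, turn_aff a b s t hst⟩
  rw [seg, seg, marked_low, marked_high, marked_low, marked_high]
  simp [turn]

/-- The half turn exchanges cups and caps, and the two halves of the strings; it carries the run of
each component along a cup to the run along the corresponding cap, in the same direction. -/
theorem StringLink.plat_rot {l : ℕ} (S : StringLink (l + l)) : S.plat.Isotopic S.rot.plat := by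
  refine Link.Isotopic.of_image halfTurn (fun i => ?_) (fun i => ?_)
  · rw [image_congr fun x _ => halfTurn_one x, plat_range, plat_range, capSet, capSet, image_union,
      image_union, image_union, rot_range, rot_range, rev_castAdd, rev_natAdd, Fin.rev_rev, turn_image_cup,
      ← turn_image_cup, image_image]
    simp only [turn_turn, image_id']
    ext q
    simp only [mem_union]
    tauto
  · obtain ⟨a1, a2, a3, -, -, -⟩ := platLoop_extend S i
    obtain ⟨-, -, -, b1, b2, b3⟩ := platLoop_extend S.rot i
    refine ⟨0, 1 / 16, 1 / 8, 1 / 4, 3 / 8, 1 / 2, by norm_num, by norm_num, by norm_num, by norm_num,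
      by norm_num, by norm_num, ?_, ?_, ?_⟩ <;>
    rw [plat_apply _ _ (by norm_num) (by norm_num), plat_apply _ _ (by norm_num) (by norm_num), halfTurn_one]
    · rw [a1, b1]; simp [turn]
    · rw [a2, b2]; simp [turn]
    · rw [a3, b3]; simp [turn]


/-! ### The isotopies in the form used by the algebra -/

namespace StringLink

theorem one_rightAct {l : ℕ} (S : StringLink (l + l)) : ((one l).rightAct S).HomeoEq S.bend :=
  ((one_juxt_one l).stack (RangeEq.refl S)).bend.homeoEq.trans (one_stack S).bend

/-- Stacking is a special case of the right action; this is how its compatibility with `E` is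
deduced. -/
theorem rightAct_juxt {l : ℕ} (σ τ : StringLink l) :
    (σ.rightAct ((one l).juxt τ)).HomeoEq (σ.stack τ) := by
  unfold rightAct
  exact (one_juxt_stack σ τ).bend.homeoEq.trans (bend_one_juxt (σ.stack τ))

theorem rightAct_one {l : ℕ} (σ : StringLink l) : (σ.rightAct (one (l + l))).HomeoEq σ :=
  (stack_one _).bend.trans (bend_one_juxt σ)

theorem rightAct_rightAct {l : ℕ} (σ : StringLink l) (S T : StringLink (l + l)) :
    ((σ.rightAct S).rightAct T).HomeoEq (σ.rightAct (S.stack T)) :=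
  (bend_snake _ T).trans (stack_assoc _ S T).bend

/-- The left action is the right action by the turned string link. -/
theorem leftAct_homeoEq {l : ℕ} (S : StringLink (l + l)) (σ : StringLink l) :
    (S.leftAct σ).HomeoEq (σ.rightAct S.rot) := by
  have h : (S.stack ((one l).juxt σ)).rot.RangeEq ((σ.rot.juxt (one l)).stack S.rot) :=
    (rot_stack S _).trans (((rot_juxt _ σ).trans ((RangeEq.refl _).juxt (rot_one l))).stack (RangeEq.refl _))
  exact h.bend.homeoEq.trans (bend_slide σ S.rot).symm

theorem one_leftAct {l : ℕ} (σ : StringLink l) : ((one (l + l)).leftAct σ).HomeoEq σ := by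
  have h : (σ.rightAct (one (l + l)).rot).RangeEq (σ.rightAct (one (l + l))) :=
    ((RangeEq.refl _).stack (rot_one _)).bend
  exact (leftAct_homeoEq _ σ).trans (h.homeoEq.trans (rightAct_one σ))

/-- By definition the left side is, up to a trivial factor, the left action of the trivial string
link on `σ`. -/
theorem rot_one_juxt_bend {l : ℕ} (σ : StringLink l) : ((one l).juxt σ).rot.bend.HomeoEq σ := by
  have h : ((one (l + l)).leftAct σ).RangeEq ((((one l).juxt σ).rot).stack (one (l + l))).bend :=
    ((rot_stack _ _).trans ((RangeEq.refl _).stack (rot_one _))).bend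
  exact (stack_one _).bend.symm.trans (h.symm.homeoEq.trans (one_leftAct σ))

/-- The snake read backwards, then `rightAct_juxt`: `1 (S (1 ⊗ σ)) ≅ (1 S)(1 ⊗ σ) ≅ (1 S) σ`. -/
theorem bend_stack_one_juxt {l : ℕ} (S : StringLink (l + l)) (σ : StringLink l) :
    (S.stack ((one l).juxt σ)).bend.HomeoEq (S.bend.stack σ) :=
  (bend_snake S _).symm.trans (rightAct_juxt _ σ)

end StringLink

/-! ### Consequences for a local equivalence relation -/

namespace LinkRelation

variable {E : LinkRelation}

theorem cls_eq {n : ℕ} {σ τ : StringLink n} (h : σ.HomeoEq τ) : E.cls σ = E.cls τ :=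
  Quotient.sound (E.stringLink_isotopic h.isotopic)

theorem linkCls_eq {n : ℕ} {K L : Link n} (h : K.Isotopic L) : E.linkCls K = E.linkCls L :=
  Quotient.sound (E.link_isotopic h)

namespace IsLocal

theorem bend (hE : E.IsLocal) {l : ℕ} {S T : StringLink (l + l)} (h : E.cls S = E.cls T) :
    E.cls S.bend = E.cls T.bend := by
  rw [← cls_eq S.one_rightAct, ← cls_eq T.one_rightAct, hE.rightAct rfl h]

theorem stack (hE : E.IsLocal) {l : ℕ} {σ₁ σ₂ τ₁ τ₂ : StringLink l} (h : E.cls σ₁ = E.cls σ₂)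
    (h' : E.cls τ₁ = E.cls τ₂) : E.cls (σ₁.stack τ₁) = E.cls (σ₂.stack τ₂) := by
  rw [← cls_eq (σ₁.rightAct_juxt τ₁), ← cls_eq (σ₂.rightAct_juxt τ₂), hE.rightAct h (hE.juxt h')]

/-- A plat closure is the closure of the bend, and both operations are compatible with `E`. -/
theorem plat (hE : E.IsLocal) {l : ℕ} {S T : StringLink (l + l)} (h : E.cls S = E.cls T) :
    E.linkCls S.plat = E.linkCls T.plat := by
  rw [← linkCls_eq S.plat_snake, ← linkCls_eq T.plat_snake, hE.closure (hE.bend h)]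

theorem sandwich (hE : E.IsLocal) {l : ℕ} {σ₁ σ₂ τ₁ τ₂ : StringLink l} {S₁ S₂ : StringLink (l + l)}
    (h : E.cls σ₁ = E.cls σ₂) (h' : E.cls τ₁ = E.cls τ₂) (hS : E.cls S₁ = E.cls S₂) :
    E.linkCls (σ₁.sandwich S₁ τ₁) = E.linkCls (σ₂.sandwich S₂ τ₂) :=
  hE.plat (hE.stack (hE.stack (hE.juxt h) hS) (hE.juxt h'))

/-- The monoid of classes of string links. -/
@[reducible] noncomputable def monoid (hE : E.IsLocal) (l : ℕ) : Monoid (E.SL l) where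
  mul := Quotient.lift₂ (fun σ τ => E.cls (σ.stack τ))
    fun _ _ _ _ h h' => hE.stack (Quotient.sound h) (Quotient.sound h')
  one := E.cls (StringLink.one l)
  mul_assoc := by
    rintro ⟨σ⟩ ⟨τ⟩ ⟨ρ⟩
    exact cls_eq (StringLink.stack_assoc σ τ ρ)
  one_mul := by
    rintro ⟨σ⟩
    exact cls_eq (StringLink.one_stack σ)
  mul_one := by
    rintro ⟨σ⟩
    exact cls_eq (StringLink.stack_one σ)

/-- The right action on classes of string links. -/
@[reducible] noncomputable def rightMulAction (hE : E.IsLocal) (l : ℕ) :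
    letI := hE.monoid; MulAction (E.SL (l + l))ᵐᵒᵖ (E.SL l) :=
  letI := hE.monoid
  { smul := fun a x => Quotient.lift₂ (fun σ S => E.cls (σ.rightAct S))
      (fun _ _ _ _ h h' => hE.rightAct (Quotient.sound h) (Quotient.sound h')) x a.unop
    one_smul := by
      rintro ⟨σ⟩
      exact cls_eq σ.rightAct_one
    mul_smul := by
      rintro ⟨⟨S⟩⟩ ⟨⟨T⟩⟩ ⟨σ⟩
      exact (cls_eq (σ.rightAct_rightAct T S)).symm }

/-- The left action on classes of string links. -/
@[reducible] noncomputable def leftMulAction (hE : E.IsLocal) (l : ℕ) :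
    letI := hE.monoid; MulAction (E.SL (l + l)) (E.SL l) :=
  letI := hE.monoid
  { smul := Quotient.lift₂ (fun S σ => E.cls (S.leftAct σ))
      fun _ _ _ _ h h' => hE.leftAct (Quotient.sound h') (Quotient.sound h)
    one_smul := by
      rintro ⟨σ⟩
      exact cls_eq σ.one_leftAct
    mul_smul := by
      rintro ⟨S⟩ ⟨T⟩ ⟨σ⟩
      change E.cls ((S.stack T).leftAct σ) = E.cls (S.leftAct (T.leftAct σ))
      -- Turning reverses products, which converts associativity of the right action into that of a
      -- left action.
      have h : (σ.rightAct (S.stack T).rot).RangeEq (σ.rightAct (T.rot.stack S.rot)) :=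
        ((StringLink.RangeEq.refl _).stack (StringLink.rot_stack S T)).bend
      rw [cls_eq ((S.stack T).leftAct_homeoEq σ), cls_eq h.homeoEq, ← cls_eq (σ.rightAct_rightAct _ _),
        cls_eq (S.leftAct_homeoEq _), hE.rightAct (cls_eq (T.leftAct_homeoEq σ)) rfl] }

/-- Turning the plat closure of `S (1 ⊗ σ)` moves the bend from the bottom to the top: the closure
of `S σ` is that of `(1 S) σ`, and `1 S` is trivial by hypothesis. -/
theorem closure_leftAct (hE : E.IsLocal) {l : ℕ} {S : StringLink (l + l)} (σ : StringLink l)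
    (h : E.cls ((StringLink.one l).rightAct S) = E.cls (StringLink.one l)) :
    E.linkCls (S.leftAct σ).closure = E.linkCls σ.closure := by
  rw [cls_eq S.one_rightAct] at h
  have h1 : E.linkCls (S.leftAct σ).closure =
      E.linkCls (S.stack ((StringLink.one l).juxt σ)).bend.closure := by
    rw [linkCls_eq (StringLink.plat_snake _), linkCls_eq (S.stack ((StringLink.one l).juxt σ)).plat_rot]
    exact linkCls_eq (StringLink.plat_snake _)
  rw [h1]
  refine hE.closure ?_
  rw [cls_eq (S.bend_stack_one_juxt σ), hE.stack h rfl, cls_eq σ.one_stack]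

/-- The mirror argument: after the half turn, `S.rot.bend`, which is `S 1`, appears at the bottom
and may be replaced by the unit. What remains, the bend of the turned `1 ⊗ σ`, is `σ`. -/
theorem closure_rightAct (hE : E.IsLocal) {l : ℕ} {S : StringLink (l + l)} (σ : StringLink l)
    (h : E.cls (S.leftAct (StringLink.one l)) = E.cls (StringLink.one l)) :
    E.linkCls (σ.rightAct S).closure = E.linkCls σ.closure := by
  rw [cls_eq (S.leftAct_homeoEq _), cls_eq S.rot.one_rightAct] at h
  have h1 : E.linkCls (σ.rightAct S).closure =
      E.linkCls (((StringLink.one l).juxt σ).stack S).rot.bend.closure := by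
    rw [linkCls_eq (StringLink.plat_snake (((StringLink.one l).juxt σ).stack S).rot),
      ← linkCls_eq (((StringLink.one l).juxt σ).stack S).plat_rot]
    exact linkCls_eq (StringLink.plat_snake _)
  rw [h1]
  refine hE.closure ?_
  rw [cls_eq (StringLink.rot_stack _ S).bend.homeoEq, ← cls_eq (StringLink.bend_snake S.rot _)]
  change E.cls (S.rot.bend.rightAct _) = _
  rw [hE.rightAct h rfl, cls_eq (StringLink.one_rightAct _), cls_eq (StringLink.rot_one_juxt_bend σ)]

/-- In a monoid in which all elements have right inverses, the right inverse of `b` equals its left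
inverse `a`. -/
theorem mul_eq_one_comm (hE : E.IsLocal) (hr : E.HasRightInverses) {l : ℕ} :
    letI := hE.monoid; ∀ {a b : E.SL l}, a * b = 1 → b * a = 1 := by
  let _ := hE.monoid l
  intro a b hab
  obtain ⟨c, hc⟩ : ∃ c, b * c = 1 := by
    obtain ⟨τ⟩ := b
    obtain ⟨ρ, h⟩ := hr l τ
    exact ⟨E.cls ρ, h⟩
  rw [left_inv_eq_right_inv hab hc, hc]

/-- The group of classes of string links, if there are right inverses. -/
@[reducible] noncomputable def group (hE : E.IsLocal) (hr : E.HasRightInverses) (l : ℕ) :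
    Group (E.SL l) :=
  { hE.monoid l with
    inv := fun a => E.cls (hr l a.out).choose
    inv_mul_cancel := fun a => hE.mul_eq_one_comm hr (by
      have h := (hr l a.out).choose_spec
      have h' : E.cls a.out = a := Quotient.out_eq a
      nth_rw 1 [← h']
      exact h) }

/-- If either factor of `σ σ̄ ∼ 1` is trivial, so is the other. -/
theorem cls_bar_eq_one_iff (hE : E.IsLocal) (hr : E.HasReflectionInverses) {l : ℕ} (σ : StringLink l) :
    E.cls σ.bar = E.cls (StringLink.one l) ↔ E.cls σ = E.cls (StringLink.one l) := by
  have h := hr l σ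
  constructor
  · intro h'
    rw [← cls_eq σ.stack_one, ← hE.stack rfl h', h]
  · intro h'
    rw [← cls_eq σ.bar.one_stack, ← hE.stack h' rfl, h]

end IsLocal
end LinkRelation

theorem exists_subgroup {G : Type*} [Group G] (M : Submonoid G) (h : ∀ a b : G, a * b = 1 → a ∈ M → b ∈ M) :
    ∃ K : Subgroup G, (K : Set G) = M :=
  ⟨{ M with inv_mem' := fun {a} ha => h a a⁻¹ (mul_inv_cancel a) ha }, rfl⟩

end HL

/-! ### The proposition -/

theorem proposition3p1 (E : HL.LinkRelation) (hE : E.IsLocal) :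
    -- compatibility with stacking and with the closed links `σ S σ'`
    (∀ (l : ℕ) (σ₁ σ₂ σ₁' σ₂' : HL.StringLink l) (S₁ S₂ : HL.StringLink (l + l)),
      E.cls σ₁ = E.cls σ₂ → E.cls σ₁' = E.cls σ₂' → E.cls S₁ = E.cls S₂ →
        E.cls (σ₁.stack σ₁') = E.cls (σ₂.stack σ₂') ∧
        E.linkCls (σ₁.sandwich S₁ σ₁') = E.linkCls (σ₂.sandwich S₂ σ₂')) ∧
    -- the induced monoids, right and left actions, closure maps, and stabilizers of the unit
    ∃ (mon : ∀ l, Monoid (E.SL l))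
      (_ : ∀ l, MulAction (E.SL (l + l))ᵐᵒᵖ (E.SL l))
      (_ : ∀ l, MulAction (E.SL (l + l)) (E.SL l))
      (cl : ∀ l, E.SL l → E.L l)
      (ESR ESL : ∀ l, Submonoid (E.SL (l + l))),
      (∀ (l : ℕ) (σ τ : HL.StringLink l), E.cls σ * E.cls τ = E.cls (σ.stack τ)) ∧
      (∀ l : ℕ, (1 : E.SL l) = E.cls (HL.StringLink.one l)) ∧
      (∀ (l : ℕ) (σ : HL.StringLink l) (S : HL.StringLink (l + l)),
        MulOpposite.op (E.cls S) • E.cls σ = E.cls (σ.rightAct S)) ∧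
      (∀ (l : ℕ) (S : HL.StringLink (l + l)) (σ : HL.StringLink l),
        E.cls S • E.cls σ = E.cls (S.leftAct σ)) ∧
      (∀ (l : ℕ) (σ : HL.StringLink l), cl l (E.cls σ) = E.linkCls σ.closure) ∧
      (∀ (l : ℕ) (a : E.SL (l + l)), a ∈ ESR l ↔ MulOpposite.op a • (1 : E.SL l) = 1) ∧
      (∀ (l : ℕ) (a : E.SL (l + l)), a ∈ ESL l ↔ a • (1 : E.SL l) = 1) ∧
      -- the closure map passes to the orbit sets
      (∀ l : ℕ, ∃ f : Quot (fun a b : E.SL l => ∃ s ∈ ESR l, s • a = b) → E.L l,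
        ∀ a : E.SL l, f (Quot.mk _ a) = cl l a) ∧
      (∀ l : ℕ, ∃ f : Quot (fun a b : E.SL l => ∃ s ∈ ESL l, MulOpposite.op s • a = b) → E.L l,
        ∀ a : E.SL l, f (Quot.mk _ a) = cl l a) ∧
      -- the consequences of the two further axioms
      (E.HasRightInverses →
        ∃ grp : ∀ l, Group (E.SL l),
          (∀ l, (grp l).toDivInvMonoid.toMonoid = mon l) ∧
          ∀ l : ℕ,
            (∃ K : Subgroup (E.SL (l + l)), (K : Set (E.SL (l + l))) = ESR l) ∧
            (∃ K : Subgroup (E.SL (l + l)), (K : Set (E.SL (l + l))) = ESL l)) ∧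
      (E.HasReflectionInverses → ∀ l : ℕ, ESR l = ESL l) := by
  refine ⟨fun l σ₁ σ₂ σ₁' σ₂' S₁ S₂ h h' hS => ⟨hE.stack h h', hE.sandwich h h' hS⟩, ?_⟩
  let mon := hE.monoid
  let right := hE.rightMulAction
  let left := hE.leftMulAction
  let cl : ∀ l, E.SL l → E.L l := fun l => Quotient.lift (fun σ => E.linkCls σ.closure)
    fun _ _ h => hE.closure (Quotient.sound h)
  let ESR : ∀ l, Submonoid (E.SL (l + l)) := fun l =>
    { carrier := {a | MulOpposite.op a • (1 : E.SL l) = 1}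
      one_mem' := one_smul _ (1 : E.SL l)
      mul_mem' := fun {a b} (ha : MulOpposite.op a • (1 : E.SL l) = 1) (hb : MulOpposite.op b • (1 : E.SL l) = 1) => by
        rw [Set.mem_ofPred_eq, MulOpposite.op_mul, mul_smul, ha, hb] }
  let ESL : ∀ l, Submonoid (E.SL (l + l)) := fun l => MulAction.stabilizerSubmonoid (E.SL (l + l)) (1 : E.SL l)
  -- `1 b = (1 a) b = 1 (a b) = 1`. This gives the inverses in the stabilizer and, under the
  -- reflection axiom, the passage between `S` and `S.bar`.
  have inv_right : ∀ l (a b : E.SL (l + l)), a * b = 1 → a ∈ ESR l → b ∈ ESR l := fun l a b hab ha => by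
    change MulOpposite.op b • (1 : E.SL l) = 1
    have ha : MulOpposite.op a • (1 : E.SL l) = 1 := ha
    nth_rw 1 [← ha]
    rw [← mul_smul, ← MulOpposite.op_mul, hab, MulOpposite.op_one, one_smul]
  have inv_left : ∀ l (a b : E.SL (l + l)), b * a = 1 → a ∈ ESL l → b ∈ ESL l := fun l a b hab ha => by
    change b • (1 : E.SL l) = 1
    have ha : a • (1 : E.SL l) = 1 := ha
    nth_rw 1 [← ha]
    rw [← mul_smul, hab, one_smul]
  refine ⟨mon, right, left, cl, ESR, ESL, fun _ _ _ => rfl, fun _ => rfl, fun _ _ _ => rfl, fun _ _ _ => rfl,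
    fun _ _ => rfl, fun _ _ => Iff.rfl, fun _ _ => Iff.rfl, fun l => ⟨Quot.lift (cl l) ?_, fun _ => rfl⟩,
    fun l => ⟨Quot.lift (cl l) ?_, fun _ => rfl⟩, fun hr => ⟨hE.group hr, fun _ => rfl, fun l => ⟨?_, ?_⟩⟩,
    fun hr l => ?_⟩
  · rintro ⟨σ⟩ _ ⟨⟨S⟩, hS, rfl⟩
    exact (hE.closure_leftAct σ hS).symm
  · rintro ⟨σ⟩ _ ⟨⟨S⟩, hS, rfl⟩
    exact (hE.closure_rightAct σ hS).symm
  · let := hE.group hr (l + l)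
    exact HL.exists_subgroup (ESR l) (inv_right l)
  · let := hE.group hr (l + l)
    exact HL.exists_subgroup (ESL l) fun a b hab => inv_left l a b (hE.mul_eq_one_comm hr hab)
  · have hr' : E.HasRightInverses := fun l σ => ⟨σ.bar, hr l σ⟩
    ext ⟨S⟩
    have hinv : E.cls S * E.cls S.bar = 1 := hr _ S
    -- `S 1` is the bend of `S.rot`, which is the reflection of the bend of `S.bar`, that is, of `1
    -- S.bar`; and a string link is trivial iff its reflection is.
    have h1 : E.cls S ∈ ESL l ↔ E.cls S.bar ∈ ESR l := by
      change E.cls (S.leftAct (HL.StringLink.one l)) = E.cls (HL.StringLink.one l) ↔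
        E.cls ((HL.StringLink.one l).rightAct S.bar) = E.cls (HL.StringLink.one l)
      rw [HL.LinkRelation.cls_eq (S.leftAct_homeoEq _), HL.LinkRelation.cls_eq S.rot.one_rightAct,
        HL.LinkRelation.cls_eq S.bend_rot.homeoEq, hE.cls_bar_eq_one_iff hr,
        HL.LinkRelation.cls_eq S.bar.one_rightAct]
    change E.cls S ∈ ESR l ↔ E.cls S ∈ ESL l
    rw [h1]
    exact ⟨inv_right l _ _ hinv, inv_right l _ _ (hE.mul_eq_one_comm hr' hinv)⟩
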